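/- Let $M$ be a $C^\infty$ manifold of real dimension $2n+1$ with a CR structure $T_{1,0}(M)\subset T(M)\otimes\mathbb C$ of CR dimension $n$ (a smooth complex subbundle of rank $n$ with $T_{1,0}(M)\cap\overline{T_{1,0}(M)}=(0)$ whose local smooth sections are closed under the Lie bracket). A pseudohermitian structure is a nowhere zero global $C^\infty$ real $1$-form $\theta$ vanishing on $H(M)=\mathrm{Re}\{T_{1,0}(M)\oplus T_{0,1}(M)\}$, where $T_{0,1}(M)=\overline{T_{1,0}(M)}$; its Levi form is $L_\theta(Z,\overline W)=-i\,d\theta(Z,\overline W)$, $Z,W\in T_{1,0}(M)$. Assume that $M$ is strictly pseudoconvex, i.e. $L_\theta$ is positive definite for some pseudohermitian structure $\theta$, and that the first de Rham cohomology group $H^1(M;\mathbb R)$ vanishes. For a pseudohermitian structure $\theta$ let $T$ be its characteristic direction ($\theta(T)=1$, $i_T\,d\theta=0$); an admissible coframe on an open set $V$ consists of the complex $1$-forms $\theta^1,\dots,\theta^n$ on $V$ with $\theta^\alpha(T_\beta)=\delta^\alpha_\beta$, $\theta^\alpha(\overline{T_\beta})=0$, $\theta^\alpha(T)=0$ for a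 smooth frame $T_1,\dots,T_n$ of $T_{1,0}(M)$ on $V$. A symmetry of the CR structure is a $C^\infty$ vector field $X$ on $M$ such that $\mathcal L_X\theta=t\,\theta$ and $\mathcal L_X\theta^\alpha=w^\alpha_\beta\theta^\beta+\ell^\alpha\theta$ for some functions $t$ (real), $w^\alpha_\beta,\ell^\alpha$, where $\theta$ is a pseudohermitian structure and $\theta^\alpha$ are admissible coframes around each point (the choice is immaterial). Let $X_1,\dots,X_{2n+1}$ be symmetries of the CR structure that are linearly independent at every point of $M$ and satisfy $[X_i,X_j]=\sum_k c_{ij}^kX_k$ with real constants $c_{ij}^k$. Let $\theta$ be a pseudohermitian structure on $M$. Then there is $u\in C^\infty(M,\mathbb R)$ such that $\Omega=e^u\theta$ satisfies $\mathcal L_{X_i}\Omega=0$ for $1\le i\le 2n+1$, and for every admissible coframe $\{\theta^\alpha\}$ relative to $\theta$ on an open set $V$, every point of $V$ has an open neighbourhood $W\subseteq V$ with $C^\infty$ functions $U=[U^\alpha_\beta]:W\to GL(n,\mathbb C)$ and $v^\alpha:W\to\mathbb C$ such that the forms $\Omega^\alpha=U^\alpha_\beta\theta^\beta+v^\alpha\theta$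 satisfy $\mathcal L_{X_i}\Omega^\alpha=0$ on $W$ for all $i,\alpha$. Moreover, if $L_\theta$ is positive definite, then $U$ and $v$ can be chosen so that in addition $d\Omega=2i\sum_{\alpha=1}^n\Omega^\alpha\wedge\overline{\Omega^\alpha}$ on $W$. -/

import Mathlib

open scoped Manifold ContDiff TensorProduct

namespace CRGeom

noncomputable section

/-! ### Vectors in a complexified real vector space `ℂ ⊗ V` -/

section Complexification

variable {V : Type*} [AddCommGroup V] [Module ℝ V]

/-- Real part `ℂ ⊗ V → V`. -/
def rePart : ℂ ⊗[ℝ] V →ₗ[ℝ] V :=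
  (TensorProduct.lid ℝ V).toLinearMap ∘ₗ LinearMap.rTensor V Complex.reLm

/-- Imaginary part `ℂ ⊗ V → V`. -/
def imPart : ℂ ⊗[ℝ] V →ₗ[ℝ] V :=
  (TensorProduct.lid ℝ V).toLinearMap ∘ₗ LinearMap.rTensor V Complex.imLm

/-- Complex conjugation `a ⊗ v ↦ ā ⊗ v` on `ℂ ⊗ V`. -/
def conjVec : ℂ ⊗[ℝ] V →ₗ[ℝ] ℂ ⊗[ℝ] V :=
  LinearMap.rTensor V Complex.conjAe.toLinearMap

/-- The vector `a + i b` of `ℂ ⊗ V`, for `a b : V`. -/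
def mkVec (a b : V) : ℂ ⊗[ℝ] V := (1 : ℂ) ⊗ₜ[ℝ] a + Complex.I ⊗ₜ[ℝ] b

end Complexification

/-! ### Vector fields and 1-forms on a manifold of real dimension `m` -/

section Calculus

/-- Real vector fields (sections of `T(M)`, without regularity). -/
abbrev VField (m : ℕ) (M : Type*) [TopologicalSpace M]
    [ChartedSpace (EuclideanSpace ℝ (Fin m)) M] : Type _ :=
  (x : M) → TangentSpace (𝓡 m) x

/-- Complex vector fields (sections of `T(M) ⊗ ℂ`, without regularity). -/
abbrev CField (m : ℕ) (M : Type*) [TopologicalSpace M]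
    [ChartedSpace (EuclideanSpace ℝ (Fin m)) M] : Type _ :=
  (x : M) → ℂ ⊗[ℝ] TangentSpace (𝓡 m) x

/-- 1-forms with values in `F` (`F = ℝ` or `F = ℂ`), without regularity. -/
abbrev OneForm (m : ℕ) (M : Type*) [TopologicalSpace M]
    [ChartedSpace (EuclideanSpace ℝ (Fin m)) M]
    (F : Type*) [NormedAddCommGroup F] [NormedSpace ℝ F] : Type _ :=
  (x : M) → TangentSpace (𝓡 m) x →L[ℝ] F

variable {m : ℕ} {M : Type*} [TopologicalSpace M] [ChartedSpace (EuclideanSpace ℝ (Fin m)) M]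
variable {F : Type*} [NormedAddCommGroup F] [NormedSpace ℝ F]

/-- The vector field `X` is `C^∞` at `x`. -/
def VField.SmoothAt [IsManifold (𝓡 m) ∞ M] (X : VField m M) (x : M) : Prop :=
  ContMDiffAt (𝓡 m) (𝓡 m).tangent ∞ (fun y => (⟨y, X y⟩ : TangentBundle (𝓡 m) M)) x

/-- The complex vector field `Z` is `C^∞` at `x`. -/
def CField.SmoothAt [IsManifold (𝓡 m) ∞ M] (Z : CField m M) (x : M) : Prop :=
  VField.SmoothAt (fun y => rePart (Z y)) x ∧ VField.SmoothAt (fun y => imPart (Z y)) x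

/-- The 1-form `φ` is `C^∞` on `U`: it maps smooth vector fields to smooth functions. -/
def OneForm.SmoothOn [IsManifold (𝓡 m) ∞ M] (φ : OneForm m M F) (U : Set M) : Prop :=
  ∀ x ∈ U, ∀ Y : VField m M, VField.SmoothAt Y x →
    ContMDiffAt (𝓡 m) 𝓘(ℝ, F) ∞ (fun y => φ y (Y y)) x

/-- The derivative `X(f)` of a function `f` along `X`. -/
def dirDeriv (X : VField m M) (f : M → F) (x : M) : F :=
  mfderiv (𝓡 m) 𝓘(ℝ, F) f x (X x)

/-- `(L_X φ)(Y) = X(φ(Y)) - φ([X, Y])`. -/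
def lieDeriv (X : VField m M) (φ : OneForm m M F) (Y : VField m M) (x : M) : F :=
  dirDeriv X (fun y => φ y (Y y)) x - φ x (VectorField.mlieBracket (𝓡 m) X Y x)

/-- `(dφ)(X, Y) = X(φ(Y)) - Y(φ(X)) - φ([X, Y])`. -/
def extD (φ : OneForm m M F) (X Y : VField m M) (x : M) : F :=
  dirDeriv X (fun y => φ y (Y y)) x - dirDeriv Y (fun y => φ y (X y)) x
    - φ x (VectorField.mlieBracket (𝓡 m) X Y x)

/-- `(α ∧ β)(X, Y) = α(X) β(Y) - α(Y) β(X)`, for complex 1-forms. -/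
def wedge (α β : OneForm m M ℂ) (X Y : VField m M) (x : M) : ℂ :=
  α x (X x) * β x (Y x) - α x (Y x) * β x (X x)

/-- `L_X φ = β` on the set `U`. -/
def LieDerivEqOn [IsManifold (𝓡 m) ∞ M] (X : VField m M) (φ β : OneForm m M F)
    (U : Set M) : Prop :=
  ∀ x ∈ U, ∀ Y : VField m M, VField.SmoothAt Y x → lieDeriv X φ Y x = β x (Y x)

/-- A real 1-form regarded as a complex 1-form. -/
def OneForm.toComplex (φ : OneForm m M ℝ) : OneForm m M ℂ :=
  fun x => Complex.ofRealCLM ∘L φ x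

/-- The complex conjugate of a complex 1-form. -/
def OneForm.conj (φ : OneForm m M ℂ) : OneForm m M ℂ :=
  fun x => Complex.conjCLE.toContinuousLinearMap ∘L φ x

/-- The `ℂ`-linear extension of a complex 1-form to `T(M) ⊗ ℂ`. -/
def OneForm.evalC (φ : OneForm m M ℂ) (x : M) (z : ℂ ⊗[ℝ] TangentSpace (𝓡 m) x) : ℂ :=
  φ x (rePart z) + Complex.I * φ x (imPart z)

/-- The `ℂ`-bilinear extension of `dφ` to complex vector fields. -/
def extDC (φ : OneForm m M ℂ) (Z W : CField m M) (x : M) : ℂ :=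
  (extD φ (fun y => rePart (Z y)) (fun y => rePart (W y)) x
      - extD φ (fun y => imPart (Z y)) (fun y => imPart (W y)) x)
    + Complex.I * (extD φ (fun y => rePart (Z y)) (fun y => imPart (W y)) x
      + extD φ (fun y => imPart (Z y)) (fun y => rePart (W y)) x)

/-- The `ℂ`-bilinear extension of the Lie bracket to complex vector fields. -/
def bracketC (Z W : CField m M) : CField m M := fun x =>
  mkVec
    (VectorField.mlieBracket (𝓡 m) (fun y => rePart (Z y)) (fun y => rePart (W y)) x
      - VectorField.mlieBracket (𝓡 m) (fun y => imPart (Z y)) (fun y => imPart (W y)) x)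
    (VectorField.mlieBracket (𝓡 m) (fun y => rePart (Z y)) (fun y => imPart (W y)) x
      + VectorField.mlieBracket (𝓡 m) (fun y => imPart (Z y)) (fun y => rePart (W y)) x)

end Calculus

/-! ### The first de Rham cohomology group -/

section DeRham

variable (m : ℕ) (M : Type*) [TopologicalSpace M] [ChartedSpace (EuclideanSpace ℝ (Fin m)) M]
  [IsManifold (𝓡 m) ∞ M]

variable {m M} in
theorem extD_add {φ η : OneForm m M ℝ} (hf0 : φ.SmoothOn Set.univ)
    (hη : η.SmoothOn Set.univ) {X Y : VField m M} {x : M} (hX : X.SmoothAt x)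
    (hY : Y.SmoothAt x) :
    extD (φ + η) X Y x = extD φ X Y x + extD η X Y x := by
  have key : ∀ Z W : VField m M, Z.SmoothAt x →
      dirDeriv W (fun y => (φ + η) y (Z y)) x
        = dirDeriv W (fun y => φ y (Z y)) x + dirDeriv W (fun y => η y (Z y)) x := by
    intro Z W hZ
    have h1 := (hf0 x trivial Z hZ).mdifferentiableAt (by simp)
    have h2 := (hη x trivial Z hZ).mdifferentiableAt (by simp)
    have h3 := (h1.hasMFDerivAt.add h2.hasMFDerivAt).mfderiv
    exact congrArg (fun L => L (W x)) h3
  have h4 : (φ + η) x (VectorField.mlieBracket (𝓡 m) X Y x)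
      = φ x (VectorField.mlieBracket (𝓡 m) X Y x)
        + η x (VectorField.mlieBracket (𝓡 m) X Y x) := rfl
  simp only [extD, key X Y hX, key Y X hY, h4]
  ring

variable {m M} in
theorem extD_smul (c : ℝ) {φ : OneForm m M ℝ} (hf0 : φ.SmoothOn Set.univ)
    {X Y : VField m M} {x : M} (hX : X.SmoothAt x) (hY : Y.SmoothAt x) :
    extD (c • φ) X Y x = c * extD φ X Y x := by
  have key : ∀ Z W : VField m M, Z.SmoothAt x →
      dirDeriv W (fun y => (c • φ) y (Z y)) x = c * dirDeriv W (fun y => φ y (Z y)) x := by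
    intro Z W hZ
    have h1 := (hf0 x trivial Z hZ).mdifferentiableAt (by simp)
    have h3 := (h1.hasMFDerivAt.const_smul c).mfderiv
    exact congrArg (fun L => L (W x)) h3
  have h4 : (c • φ) x (VectorField.mlieBracket (𝓡 m) X Y x)
      = c * φ x (VectorField.mlieBracket (𝓡 m) X Y x) := rfl
  simp only [extD, key X Y hX, key Y X hY, h4]
  ring

/-- The closed `C^∞` real 1-forms on `M`. -/
def closedForms : Submodule ℝ (OneForm m M ℝ) where
  carrier := {φ | φ.SmoothOn Set.univ ∧ ∀ (x : M) (X Y : VField m M),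
    X.SmoothAt x → Y.SmoothAt x → extD φ X Y x = 0}
  add_mem' := by
    rintro φ η ⟨h1, h2⟩ ⟨h3, h4⟩
    refine ⟨fun x hx Y hY => (h1 x hx Y hY).add (h3 x hx Y hY), fun x X Y hX hY => ?_⟩
    rw [extD_add h1 h3 hX hY, h2 x X Y hX hY, h4 x X Y hX hY, add_zero]
  zero_mem' := by
    refine ⟨fun x _ Y _ => contMDiffAt_const, fun x X Y _ _ => ?_⟩
    have h0 : ∀ Z W : VField m M,
        dirDeriv W (fun y => (0 : OneForm m M ℝ) y (Z y)) x = 0 := fun Z W =>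
      congrArg (fun L => L (W x))
        (mfderiv_const (I := 𝓡 m) (I' := 𝓘(ℝ, ℝ)) (M := M) (c := (0 : ℝ)) (x := x))
    have h4 : (0 : OneForm m M ℝ) x (VectorField.mlieBracket (𝓡 m) X Y x) = 0 := rfl
    simp only [extD, h0, h4, sub_zero]
  smul_mem' := by
    rintro c φ ⟨h1, h2⟩
    refine ⟨fun x hx Y hY => contMDiffAt_const.mul (h1 x hx Y hY), fun x X Y hX hY => ?_⟩
    rw [extD_smul c h1 hX hY, h2 x X Y hX hY, mul_zero]

/-- The exact real 1-forms `df`, `f` a `C^∞` real function on `M`. -/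
def exactForms : Submodule ℝ (OneForm m M ℝ) where
  carrier := {φ | ∃ f : M → ℝ, ContMDiff (𝓡 m) 𝓘(ℝ, ℝ) ∞ f ∧
    ∀ x, φ x = mfderiv (𝓡 m) 𝓘(ℝ, ℝ) f x}
  add_mem' := by
    rintro φ η ⟨f, hf, h1⟩ ⟨g, hg, h2⟩
    refine ⟨f + g, hf.add hg, fun x => ?_⟩
    have h3 := ((hf x).mdifferentiableAt (by simp)).hasMFDerivAt.add
      ((hg x).mdifferentiableAt (by simp)).hasMFDerivAt
    rw [h3.mfderiv, Pi.add_apply, h1 x, h2 x]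
  zero_mem' := ⟨fun _ => 0, contMDiff_const, fun x => (mfderiv_const (x := x)).symm⟩
  smul_mem' := by
    rintro c φ ⟨f, hf, h1⟩
    refine ⟨c • f, contMDiff_const.mul hf, fun x => ?_⟩
    have h3 := ((hf x).mdifferentiableAt (by simp)).hasMFDerivAt.const_smul c
    rw [h3.mfderiv, Pi.smul_apply, h1 x]

/-- The first de Rham cohomology group `H¹(M; ℝ)`: closed 1-forms modulo exact ones. -/
abbrev DeRhamH1 : Type _ :=
  closedForms m M ⧸ (exactForms m M).comap (closedForms m M).subtype

end DeRham

/-! ### CR structures -/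

/-- A CR structure of CR dimension `n` on a manifold `M` of real dimension `2 n + 1`. -/
structure CRStructure (n : ℕ) (M : Type*) [TopologicalSpace M]
    [ChartedSpace (EuclideanSpace ℝ (Fin (2 * n + 1))) M]
    [IsManifold (𝓡 (2 * n + 1)) ∞ M] where
  /-- The fibres of `T_{1,0}(M)`. -/
  T10 : (x : M) → Submodule ℂ (ℂ ⊗[ℝ] TangentSpace (𝓡 (2 * n + 1)) x)
  /-- `T_{1,0}(M)` is a `C^∞` complex subbundle of rank `n`: it has smooth local frames. -/
  exists_frame : ∀ x : M, ∃ U : Set M, IsOpen U ∧ x ∈ U ∧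
    ∃ Z : Fin n → CField (2 * n + 1) M, (∀ α, ∀ y ∈ U, (Z α).SmoothAt y) ∧
      ∀ y ∈ U, LinearIndependent ℂ (fun α => Z α y) ∧
        Submodule.span ℂ (Set.range fun α => Z α y) = T10 y
  /-- `T_{1,0}(M) ∩ T_{0,1}(M) = (0)`. -/
  inter_conj : ∀ x : M, ∀ z ∈ T10 x, conjVec z ∈ T10 x → z = 0
  /-- The space of (local) smooth sections is closed under the bracket. -/
  bracket_mem : ∀ U : Set M, IsOpen U → ∀ Z W : CField (2 * n + 1) M,
    (∀ y ∈ U, Z.SmoothAt y ∧ Z y ∈ T10 y) → (∀ y ∈ U, W.SmoothAt y ∧ W y ∈ T10 y) →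
      ∀ y ∈ U, bracketC Z W y ∈ T10 y

namespace CRStructure

variable {n : ℕ} {M : Type*} [TopologicalSpace M]
  [ChartedSpace (EuclideanSpace ℝ (Fin (2 * n + 1))) M] [IsManifold (𝓡 (2 * n + 1)) ∞ M]
  (S : CRStructure n M)

/-- `Z` is a `C^∞` section of `T_{1,0}(M)` over `U`. -/
def IsSectionOn (U : Set M) (Z : CField (2 * n + 1) M) : Prop :=
  ∀ y ∈ U, Z.SmoothAt y ∧ Z y ∈ S.T10 y

/-- The Levi distribution `H(M) = Re (T_{1,0}(M) ⊕ T_{0,1}(M))`; its fibre consists of the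
vectors `Z + Z̄` with `Z ∈ T_{1,0}(M)_x`, that is of the real parts of such `Z`. -/
def levi (x : M) : Submodule ℝ (TangentSpace (𝓡 (2 * n + 1)) x) :=
  ((S.T10 x).restrictScalars ℝ).map rePart

/-- A pseudohermitian structure: a globally defined, nowhere zero `C^∞` real 1-form `θ` with
`Ker θ ⊇ H(M)`. -/
structure IsPseudohermitian (θ : OneForm (2 * n + 1) M ℝ) : Prop where
  smooth : θ.SmoothOn Set.univ
  ne_zero : ∀ x, θ x ≠ 0
  levi_le : ∀ x, ∀ v ∈ S.levi x, θ x v = 0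

/-- The Levi form `L_θ(Z, W̄) = -i (dθ)(Z, W̄)`. -/
def leviForm (θ : OneForm (2 * n + 1) M ℝ) (Z W : CField (2 * n + 1) M) (x : M) : ℂ :=
  -Complex.I * extDC θ.toComplex Z (fun y => conjVec (W y)) x

/-- `L_θ` is positive definite on `T_{1,0}(M)` (`L_θ(Z, Z̄)` is a real number). -/
def LeviPositive (θ : OneForm (2 * n + 1) M ℝ) : Prop :=
  ∀ U : Set M, IsOpen U → ∀ Z : CField (2 * n + 1) M, S.IsSectionOn U Z →
    ∀ x ∈ U, Z x ≠ 0 → 0 < (leviForm θ Z Z x).re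

/-- Strict pseudoconvexity: `L_θ` is positive definite for some pseudohermitian structure. -/
def StrictlyPseudoconvex : Prop :=
  ∃ θ : OneForm (2 * n + 1) M ℝ, S.IsPseudohermitian θ ∧ S.LeviPositive θ

/-- `T` is (over `V`) the characteristic direction of `dθ`: `θ(T) = 1`, `i_T dθ = 0`. -/
structure IsCharacteristicOn (θ : OneForm (2 * n + 1) M ℝ) (V : Set M)
    (T : VField (2 * n + 1) M) : Prop where
  smooth : ∀ x ∈ V, T.SmoothAt x
  eval : ∀ x ∈ V, θ x (T x) = 1
  contract : ∀ x ∈ V, ∀ Y : VField (2 * n + 1) M, Y.SmoothAt x → extD θ T Y x = 0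

/-- `Z_1, …, Z_n` is a `C^∞` frame of `T_{1,0}(M)` over `V`. -/
structure IsFrameOn (V : Set M) (Z : Fin n → CField (2 * n + 1) M) : Prop where
  isSection : ∀ α, S.IsSectionOn V (Z α)
  linearIndependent : ∀ x ∈ V, LinearIndependent ℂ (fun α => Z α x)
  span_eq : ∀ x ∈ V, Submodule.span ℂ (Set.range fun α => Z α x) = S.T10 x

/-- `ϑ^1, …, ϑ^n` is the admissible coframe on the open set `V`, relative to `θ`, of some local
frame `T_1, …, T_n` of `T_{1,0}(M)`: `ϑ^α(T_β) = δ^α_β`, `ϑ^α(T̄_β) = 0`, `ϑ^α(T) = 0`. -/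
structure IsAdmissibleCoframe (θ : OneForm (2 * n + 1) M ℝ) (V : Set M)
    (ϑ : Fin n → OneForm (2 * n + 1) M ℂ) : Prop where
  isOpen : IsOpen V
  smooth : ∀ α, (ϑ α).SmoothOn V
  exists_frame : ∃ Z : Fin n → CField (2 * n + 1) M, S.IsFrameOn V Z ∧
    ∀ x ∈ V, ∀ α β, (ϑ α).evalC x (Z β x) = (if α = β then 1 else 0) ∧
      (ϑ α).evalC x (conjVec (Z β x)) = 0
  exists_char : ∃ T : VField (2 * n + 1) M, IsCharacteristicOn θ V T ∧
    ∀ x ∈ V, ∀ α, ϑ α x (T x) = 0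

/-- The forms `U^α_β ϑ^β + v^α θ`. -/
def changeCoframe (θ : OneForm (2 * n + 1) M ℝ) (ϑ : Fin n → OneForm (2 * n + 1) M ℂ)
    (U : M → Matrix (Fin n) (Fin n) ℂ) (v : M → Fin n → ℂ) :
    Fin n → OneForm (2 * n + 1) M ℂ :=
  fun α x => ∑ β, U x α β • ϑ β x + v x α • θ.toComplex x

/-- `X` is a symmetry of the CR structure: `X` is a `C^∞` vector field on `M` and, for some
pseudohermitian structure `θ` and some admissible coframe `ϑ^α` around each point,
`L_X θ = t θ` and `L_X ϑ^α = w^α_β ϑ^β + ℓ^α θ`. (The choice of `θ`, `ϑ^α` is immaterial.) -/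
def IsSymmetry (X : VField (2 * n + 1) M) : Prop :=
  (∀ x, X.SmoothAt x) ∧
  ∃ θ : OneForm (2 * n + 1) M ℝ, S.IsPseudohermitian θ ∧
    (∃ t : M → ℝ, LieDerivEqOn X θ (fun x => t x • θ x) Set.univ) ∧
    ∀ x : M, ∃ V : Set M, x ∈ V ∧ ∃ ϑ : Fin n → OneForm (2 * n + 1) M ℂ,
      S.IsAdmissibleCoframe θ V ϑ ∧
      ∃ (w : M → Matrix (Fin n) (Fin n) ℂ) (ℓ : M → Fin n → ℂ),
        ∀ α, LieDerivEqOn X (ϑ α) (changeCoframe θ ϑ w ℓ α) V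

end CRStructure

end

end CRGeom

/-!
The symmetries `X_i` form a global frame whose brackets have constant coefficients, so `M` is
locally a Lie group with the `X_i` as left invariant fields, and the forms killed by all
`L_{X_i}` play the part of right invariant forms. Their components solve the system
`X_i f_j = ∑ c_{ij}^k f_k`, which is flat by the Jacobi identity. Read in a chart it has local
solutions with any prescribed value at a point (`exists_hasFDerivAt_of_flat`,
`IsLieFrame.exists_invariant_form`), and two solutions that agree at a point agree nearby, since
`|X_i g| ≤ K |g|` forces `g` to vanish near each of its zeros (`IsLieFrame.eventually_eq_zero`).

*The conformal factor.* A symmetry preserves the kernel of every pseudohermitian structure, so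
`L_{X_i} θ = t_i θ` with smooth `t_i` (`exists_smooth_multiplier`). Because `[L_X, L_Y] = L_{[X, Y]}`,
the `-t_i` are the components of a closed 1-form (`multiplier_cocycle`); as `H¹(M; ℝ) = 0`, it is
`du` for some `u`, and `Ω = e^u θ` is invariant (`exists_invariant_pseudohermitian`).

*The coframe.* The covectors `U₀ ϑ + v₀ θ` at a point `x` extend to invariant local forms `Ω^α`.
These still annihilate `T_{0,1}(M)`, because the symmetries preserve `T_{1,0}(M)` and the functions
`Ω^α(Z̄_β)` therefore solve a homogeneous linear system with zero value at `x`
(`eventually_conj_eval_eq_zero`). So they are of the form `U ϑ + v θ` near `x`, with `U` invertible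
by continuity (`exists_invariant_coframe`).

*The normalization.* On `H(M)` the form `dΩ` is `e^u dθ`; it is of type `(1,1)` by integrability, and
positive when `L_θ` is. Hence in that case `U₀`, and then `v₀`, can be chosen so that `dΩ = 2i ∑ Ω^α ∧ Ω̄^α` at the single point
`x` (`exists_normal_form_at`). Both sides are invariant, so the equality propagates to a
neighbourhood of `x` (`IsLieFrame.eventually_extD_eq`).
-/

namespace CRGeom

-- Instances on iterated spaces of continuous linear maps are nested this deep.
set_option maxSynthPendingDepth 3

open Set Filter Topology

/-! ### Flat linear systems in a normed space -/

section FlatSystems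

variable {E G : Type*} [NormedAddCommGroup E] [NormedSpace ℝ E]
  [NormedAddCommGroup G] [NormedSpace ℝ G]

/-- Solutions of `Df = B f` are as smooth as `B`. -/
theorem contDiffAt_of_hasFDerivAt_flip {B : E → E →L[ℝ] G →L[ℝ] G} {f : E → G} {x : E}
    (hB : ContDiffAt ℝ ∞ B x) (hf : ∀ᶠ y in 𝓝 x, HasFDerivAt f ((B y).flip (f y)) y) :
    ContDiffAt ℝ ∞ f x := by
  have key : ∀ k : ℕ, ContDiffAt ℝ k f x := by
    intro k
    induction k with
    | zero =>
      rw [Nat.cast_zero, contDiffAt_zero]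
      exact ⟨_, hf, fun y hy => (HasFDerivAt.continuousAt hy).continuousWithinAt⟩
    | succ k ih =>
      rw [Nat.cast_succ, contDiffAt_succ_iff_hasFDerivAt]
      refine ⟨fun y => (B y).flip (f y), ⟨_, hf, fun y hy => hy⟩, ?_⟩
      have h0 : ContDiff ℝ k (fun T : E →L[ℝ] G →L[ℝ] G => T.flip) :=
        let Φ : (E →L[ℝ] G →L[ℝ] G) →L[ℝ] G →L[ℝ] E →L[ℝ] G :=
          (ContinuousLinearMap.flipₗᵢ ℝ E G G).toContinuousLinearEquiv.toContinuousLinearMap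
        Φ.contDiff
      have h1 : ContDiffAt ℝ k (fun y => (B y).flip) x :=
        h0.contDiffAt.comp x (contDiffAt_infty.1 hB k)
      exact h1.clm_apply ih
  exact contDiffAt_infty.2 key

/-- A function satisfying `‖Df‖ ≤ K ‖f‖` near a zero vanishes near that zero. -/
theorem eventually_eq_zero_of_norm_fderiv_le {g : E → G} {g' : E → E →L[ℝ] G} {K : ℝ} {x : E}
    (hg : ∀ᶠ y in 𝓝 x, HasFDerivAt g (g' y) y) (hK : ∀ᶠ y in 𝓝 x, ‖g' y‖ ≤ K * ‖g y‖)
    (hx : g x = 0) : ∀ᶠ y in 𝓝 x, g y = 0 := by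
  obtain ⟨r, hr, hball⟩ := Metric.eventually_nhds_iff_ball.1 (hg.and hK)
  refine Metric.eventually_nhds_iff_ball.2 ⟨r, hr, fun y hy => ?_⟩
  have hseg : ∀ t ∈ Icc (0 : ℝ) 1, x + t • (y - x) ∈ Metric.ball x r := by
    intro t ht
    rw [Metric.mem_ball, dist_eq_norm] at hy ⊢
    rw [add_sub_cancel_left, norm_smul, Real.norm_of_nonneg ht.1]
    exact (mul_le_of_le_one_left (norm_nonneg _) ht.2).trans_lt hy
  have hd : ∀ t ∈ Icc (0 : ℝ) 1, HasDerivAt (fun t : ℝ => g (x + t • (y - x)))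
      (g' (x + t • (y - x)) (y - x)) t := by
    intro t ht
    have h1 : HasDerivAt (fun t : ℝ => x + t • (y - x)) (y - x) t := by
      simpa using ((hasDerivAt_id t).smul_const (y - x)).const_add x
    exact (hball _ (hseg t ht)).1.comp_hasDerivAt t h1
  have := eq_zero_of_abs_deriv_le_mul_abs_self_of_eq_zero_right (K := K * ‖y - x‖)
    (fun t ht => (hd t ht).continuousAt.continuousWithinAt)
    (fun t ht => (hd t (Ico_subset_Icc_self ht)).hasDerivWithinAt) (by simpa using hx)
    (fun t ht => by
      refine ((g' _).le_opNorm _).trans ?_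
      have := (hball _ (hseg t (Ico_subset_Icc_self ht))).2
      calc _ ≤ (K * ‖g (x + t • (y - x))‖) * ‖y - x‖ := by gcongr
        _ = _ := by ring) 1 (by simp)
  simpa using this

/-- A linear time-dependent differential equation with small coefficients has a solution
on `[0, 1]`. -/
theorem exists_solution_linear_ode [CompleteSpace G] {A : ℝ → G →L[ℝ] G}
    (hA : ContinuousOn A (Icc 0 1)) (hb : ∀ t ∈ Icc (0 : ℝ) 1, ‖A t‖ ≤ 1 / 2) (f₀ : G) :
    ∃ f : ℝ → G, f 0 = f₀ ∧
      ∀ t ∈ Icc (0 : ℝ) 1, HasDerivWithinAt f (A t (f t)) (Icc 0 1) t := by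
  have hP : IsPicardLindelof (fun t g => A t g) (⟨0, by simp⟩ : Icc (0 : ℝ) 1) f₀
      (‖f₀‖₊ + 1) 0 (‖f₀‖₊ + 1) 1 := by
    refine ⟨fun t ht => ?_, fun g _ => hA.clm_apply continuousOn_const, fun t ht g hg => ?_, ?_⟩
    · refine ((A t).lipschitz.weaken ?_).lipschitzOnWith
      have := hb t ht
      rw [← NNReal.coe_le_coe, coe_nnnorm]
      norm_num
      linarith
    · have h1 : ‖g‖ ≤ ‖f₀‖ + (‖f₀‖ + 1) := by
        have := norm_le_norm_add_norm_sub' g f₀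
        rw [Metric.mem_closedBall, dist_eq_norm] at hg
        have h3 : (((‖f₀‖₊ + 1 : NNReal)) : ℝ) = ‖f₀‖ + 1 := by simp
        rw [h3] at hg
        linarith
      have h2 := (A t).le_opNorm g
      have h3 : ‖A t‖ * ‖g‖ ≤ 1 / 2 * ‖g‖ := by gcongr; exact hb t ht
      have h4 : (((‖f₀‖₊ + 1 : NNReal)) : ℝ) = ‖f₀‖ + 1 := by simp
      rw [h4]
      linarith [norm_nonneg f₀]
    · simp
  exact hP.exists_eq_forall_mem_Icc_hasDerivWithinAt₀

/-- The right-hand side of the equation along the ray to a neighbouring point, minus the derivative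
of the approximate solution `f + t B(h) f`; flatness `hfl` cancels the terms of first order in
`h`. -/
theorem flat_error_identity {B₀ B₁ R : E →L[ℝ] G →L[ℝ] G} {D : E →L[ℝ] E →L[ℝ] G →L[ℝ] G}
    {w h : E} {f g : G} {t : ℝ} (hB : B₁ = B₀ + t • D h + R)
    (hfl : D w h f + B₀ h (B₀ w f) = D h w f + B₀ w (B₀ h f)) :
    B₁ (w + h) g - (B₀ w f + (t • (B₀ h (B₀ w f) + D w h f) + (1 : ℝ) • B₀ h f))
      = B₁ (w + h) (g - (f + t • B₀ h f))
        + (t • (D h h f + B₀ h (B₀ h f)) + (t * t) • D h (w + h) (B₀ h f)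
          + R (w + h) (f + t • B₀ h f)) := by
  have h5 : B₀ h (B₀ w f) + D w h f = D h w f + B₀ w (B₀ h f) := by rw [← hfl, add_comm]
  have h6 : B₁ (w + h) (f + t • B₀ h f) = B₀ (w + h) (f + t • B₀ h f)
      + t • D h (w + h) (f + t • B₀ h f) + R (w + h) (f + t • B₀ h f) := by
    rw [hB]; rfl
  rw [map_sub (B₁ (w + h)), h6, h5]
  simp only [add_apply, map_add, map_smul, smul_add, one_smul, mul_smul]
  abel

/-- The terms of `flat_error_identity` without the unknown are of second order in `h`. -/
theorem norm_flat_error_le {B₀ R : E →L[ℝ] G →L[ℝ] G} {D : E →L[ℝ] E →L[ℝ] G →L[ℝ] G}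
    {w h : E} {f : G} {t K D₀ C M r : ℝ} (ht : t ∈ Icc (0 : ℝ) 1) (hK : 0 ≤ K) (hD₀ : 0 ≤ D₀)
    (hC : 0 ≤ C) (hM : 0 ≤ M) (hBp : ‖B₀‖ ≤ K) (hDp : ‖D‖ ≤ D₀) (hR : ‖R‖ ≤ C * ‖h‖ ^ 2)
    (hf : ‖f‖ ≤ M) (hwh : ‖w + h‖ ≤ r) (hhr : ‖h‖ ≤ r) :
    ‖t • (D h h f + B₀ h (B₀ h f)) + (t * t) • D h (w + h) (B₀ h f)
          + R (w + h) (f + t • B₀ h f)‖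
      ≤ ((D₀ + K * K) * M + D₀ * r * K * M + C * r * (M + K * r * M)) * ‖h‖ ^ 2 := by
  have ht0 := ht.1
  have ht1 := ht.2
  have hr : 0 ≤ r := (norm_nonneg _).trans hhr
  have nB : ∀ v : E, ∀ z : G, ‖B₀ v z‖ ≤ K * ‖v‖ * ‖z‖ := fun v z =>
    ((B₀).le_opNorm₂ v z).trans (by gcongr)
  have nD : ∀ u v : E, ∀ z : G, ‖D u v z‖ ≤ D₀ * ‖u‖ * ‖v‖ * ‖z‖ :=
    fun u v z => ((D u).le_opNorm₂ v z).trans (by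
      gcongr; exact ((D).le_opNorm u).trans (by gcongr))
  have nR : ∀ v : E, ∀ z : G, ‖R v z‖ ≤ C * ‖h‖ ^ 2 * ‖v‖ * ‖z‖ := fun v z =>
    (R.le_opNorm₂ v z).trans (by gcongr)
  have e0 : ‖B₀ h f‖ ≤ K * ‖h‖ * M := (nB h f).trans (by gcongr)
  have e1 : ‖D h h f‖ ≤ D₀ * ‖h‖ * ‖h‖ * M := (nD h h f).trans (by gcongr)
  have e2 : ‖B₀ h (B₀ h f)‖ ≤ K * ‖h‖ * (K * ‖h‖ * M) := (nB _ _).trans (by gcongr)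
  have e3 : ‖D h (w + h) (B₀ h f)‖ ≤ D₀ * ‖h‖ * r * (K * ‖h‖ * M) :=
    (nD _ _ _).trans (by gcongr)
  have e4 : ‖f + t • B₀ h f‖ ≤ M + K * r * M := by
    refine (norm_add_le _ _).trans (add_le_add hf ?_)
    rw [norm_smul, Real.norm_of_nonneg ht0]
    refine (mul_le_of_le_one_left (norm_nonneg _) ht1).trans (e0.trans ?_)
    gcongr
  have e5 : ‖R (w + h) (f + t • B₀ h f)‖ ≤ C * ‖h‖ ^ 2 * r * (M + K * r * M) :=
    (nR _ _).trans (by gcongr)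
  have e6 : ‖t • (D h h f + B₀ h (B₀ h f))‖
      ≤ D₀ * ‖h‖ * ‖h‖ * M + K * ‖h‖ * (K * ‖h‖ * M) := by
    rw [norm_smul, Real.norm_of_nonneg ht0]
    exact (mul_le_of_le_one_left (norm_nonneg _) ht1).trans
      ((norm_add_le _ _).trans (add_le_add e1 e2))
  have e7 : ‖(t * t) • D h (w + h) (B₀ h f)‖
      ≤ D₀ * ‖h‖ * r * (K * ‖h‖ * M) := by
    rw [norm_smul, Real.norm_of_nonneg (by positivity)]
    exact (mul_le_of_le_one_left (norm_nonneg _) (by nlinarith)).trans e3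
  refine (norm_add₃_le.trans (add_le_add (add_le_add e6 e7) e5)).trans (le_of_eq ?_)
  ring

/-- The Frobenius theorem for linear systems: if the `End(G)`-valued 1-form `B` is flat, then
`Df = B f` has a solution near `x₀` with any prescribed value at `x₀`. It is obtained by solving
the equation along the rays from `x₀`; flatness makes it a solution in all directions. -/
theorem exists_hasFDerivAt_of_flat [CompleteSpace G] {B : E → E →L[ℝ] G →L[ℝ] G} {x₀ : E}
    (hB : ContDiffAt ℝ 2 B x₀)
    (hflat : ∀ᶠ y in 𝓝 x₀, ∀ h k : E,
      fderiv ℝ B y h k + B y k ∘L B y h = fderiv ℝ B y k h + B y h ∘L B y k) (f₀ : G) :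
    ∃ f : E → G, f x₀ = f₀ ∧ ∀ᶠ y in 𝓝 x₀, HasFDerivAt f ((B y).flip (f y)) y := by
  obtain ⟨C, s, hs, hLip⟩ := (hB.fderiv_right (m := 1) (by norm_num)).exists_lipschitzOnWith
  have hK0 : ∀ᶠ y in 𝓝 x₀, ‖B y‖ < ‖B x₀‖ + 1 :=
    hB.continuousAt.norm.eventually_lt continuousAt_const (lt_add_one _)
  have hD0 : ∀ᶠ y in 𝓝 x₀, ‖fderiv ℝ B y‖ < ‖fderiv ℝ B x₀‖ + 1 :=
    (hB.fderiv_right (m := 1) (by norm_num)).continuousAt.norm.eventually_lt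
      continuousAt_const (lt_add_one _)
  have hDiff : ∀ᶠ y in 𝓝 x₀, DifferentiableAt ℝ B y :=
    (hB.eventually (by decide)).mono fun y hy => hy.differentiableAt (by simp)
  obtain ⟨r₀, hr₀, hball₀⟩ := Metric.eventually_nhds_iff_ball.1
    (hK0.and (hDiff.and (hflat.and (hD0.and hs))))
  set K := ‖B x₀‖ + 1 with hKdef
  set D := ‖fderiv ℝ B x₀‖ + 1 with hDdef
  have hDpos : 0 < D := by positivity
  have hKpos : 0 < K := by positivity
  obtain ⟨r, hr, hrr₀, hrK⟩ : ∃ r > 0, r ≤ r₀ ∧ K * r ≤ 1 / 2 :=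
    ⟨min r₀ (1 / (2 * K)), by positivity, min_le_left _ _,
      (mul_le_mul_of_nonneg_left (min_le_right _ _) hKpos.le).trans
        (le_of_eq (by field_simp))⟩
  have hball : ∀ y ∈ Metric.ball x₀ r, ‖B y‖ ≤ K ∧ HasFDerivAt B (fderiv ℝ B y) y ∧
      (∀ h k : E, fderiv ℝ B y h k + B y k ∘L B y h = fderiv ℝ B y k h + B y h ∘L B y k) ∧
      ‖fderiv ℝ B y‖ ≤ D ∧ y ∈ s := fun y hy => by
    obtain ⟨h1, h2, h3, h4, h5⟩ := hball₀ y (Metric.ball_subset_ball hrr₀ hy)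
    exact ⟨h1.le, h2.hasFDerivAt, h3, h4.le, h5⟩
  have hseg : ∀ y ∈ Metric.ball x₀ r, ∀ t ∈ Icc (0 : ℝ) 1,
      x₀ + t • (y - x₀) ∈ Metric.ball x₀ r := by
    intro y hy t ht
    rw [Metric.mem_ball, dist_eq_norm] at hy ⊢
    rw [add_sub_cancel_left, norm_smul, Real.norm_of_nonneg ht.1]
    exact (mul_le_of_le_one_left (norm_nonneg _) ht.2).trans_lt hy
  have hline : ∀ (y : E) (t : ℝ), HasDerivAt (fun t : ℝ => x₀ + t • (y - x₀)) (y - x₀) t := by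
    intro y t
    simpa using ((hasDerivAt_id t).smul_const (y - x₀)).const_add x₀
  have hsmall : ∀ y ∈ Metric.ball x₀ r, ∀ t ∈ Icc (0 : ℝ) 1,
      ‖B (x₀ + t • (y - x₀)) (y - x₀)‖ ≤ 1 / 2 := by
    intro y hy t ht
    have h1 := (hball _ (hseg y hy t ht)).1
    have h2 : ‖y - x₀‖ ≤ r := by rw [← dist_eq_norm]; exact (Metric.mem_ball.1 hy).le
    exact ((B _).le_opNorm _).trans ((mul_le_mul h1 h2 (norm_nonneg _) hKpos.le).trans hrK)
  have hBd : ∀ y ∈ Metric.ball x₀ r, ∀ t ∈ Icc (0 : ℝ) 1, HasDerivAt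
      (fun t : ℝ => B (x₀ + t • (y - x₀))) (fderiv ℝ B (x₀ + t • (y - x₀)) (y - x₀)) t :=
    fun y hy t ht => (hball _ (hseg y hy t ht)).2.1.comp_hasDerivAt t (hline y t)
  -- `F y` is the solution along the ray from `x₀` to `y`, so that `F y 1` is the value at `y`.
  have hex : ∀ y : E, ∃ f : ℝ → G, y ∈ Metric.ball x₀ r → f 0 = f₀ ∧
      ∀ t ∈ Icc (0 : ℝ) 1,
        HasDerivWithinAt f (B (x₀ + t • (y - x₀)) (y - x₀) (f t)) (Icc 0 1) t := by
    intro y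
    by_cases hy : y ∈ Metric.ball x₀ r
    · obtain ⟨f, hf⟩ := exists_solution_linear_ode
        (A := fun t => B (x₀ + t • (y - x₀)) (y - x₀))
        (fun t ht => ((hBd y hy t ht).continuousAt.continuousWithinAt).clm_apply
          continuousWithinAt_const) (hsmall y hy) f₀
      exact ⟨f, fun _ => hf⟩
    · exact ⟨0, fun h => absurd h hy⟩
  choose F hF using hex
  have hIci : ∀ {f : ℝ → G} {f' : G} {t : ℝ}, t ∈ Ico (0 : ℝ) 1 →
      HasDerivWithinAt f f' (Icc 0 1) t → HasDerivWithinAt f f' (Ici t) t := by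
    intro f f' t ht h
    exact h.mono_of_mem_nhdsWithin (mem_of_superset (Icc_mem_nhdsGE ht.2)
      (Icc_subset_Icc_left ht.1))
  have hM : ∀ y ∈ Metric.ball x₀ r, ∀ t ∈ Icc (0 : ℝ) 1, ‖F y t‖ ≤ ‖f₀‖ * Real.exp 1 := by
    intro y hy t ht
    have h1 := norm_le_gronwallBound_of_norm_deriv_right_le (δ := ‖f₀‖) (K := 1) (ε := 0)
      (fun t ht => ((hF y hy).2 t ht).continuousWithinAt)
      (fun t ht => hIci ht ((hF y hy).2 t (Ico_subset_Icc_self ht))) (by rw [(hF y hy).1])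
      (fun t ht => by
        have h2 := hsmall y hy t (Ico_subset_Icc_self ht)
        have h3 := (B (x₀ + t • (y - x₀)) (y - x₀)).le_opNorm (F y t)
        have h4 := norm_nonneg (F y t)
        nlinarith) t ht
    rw [gronwallBound_ε0] at h1
    refine h1.trans ?_
    gcongr
    linarith [ht.2]
  set M := ‖f₀‖ * Real.exp 1 with hMdef
  have hM0 : 0 ≤ M := by positivity
  refine ⟨fun y => F y 1, ?_, Metric.eventually_nhds_iff_ball.2 ⟨r, hr, fun y hy => ?_⟩⟩
  · have hx : x₀ ∈ Metric.ball x₀ r := Metric.mem_ball_self hr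
    have h1 : ∀ t ∈ Icc (0 : ℝ) 1, F x₀ t = F x₀ 0 := by
      refine constant_of_has_deriv_right_zero
        (fun t ht => ((hF x₀ hx).2 t ht).continuousWithinAt) fun t ht => ?_
      have := hIci ht ((hF x₀ hx).2 t (Ico_subset_Icc_self ht))
      simpa using this
    change F x₀ 1 = f₀
    rw [h1 1 (by simp), (hF x₀ hx).1]
  · -- `F y t + t B(h) F y t` solves the equation along the ray towards `y + h` up to an error
    -- of order `‖h‖²`, so Grönwall's inequality compares it with `F (y + h) t`.
    have hy' : ‖y - x₀‖ ≤ r := by rw [← dist_eq_norm]; exact (Metric.mem_ball.1 hy).le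
    set c := (D + K * K) * M + D * r * K * M + C * r * (M + K * r * M) with hc
    have hest : ∀ h : E, y + h ∈ Metric.ball x₀ r → ‖h‖ ≤ r →
        ‖F (y + h) 1 - F y 1 - B y h (F y 1)‖ ≤ c * ‖h‖ ^ 2 * (Real.exp 1 - 1) := by
      intro h hyh hhr
      have hyh' : ‖y + h - x₀‖ ≤ r := by rw [← dist_eq_norm]; exact (Metric.mem_ball.1 hyh).le
      have hg : ∀ t ∈ Icc (0 : ℝ) 1, HasDerivWithinAt
          (fun t => F y t + t • B (x₀ + t • (y - x₀)) h (F y t))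
          (B (x₀ + t • (y - x₀)) (y - x₀) (F y t)
            + (t • (B (x₀ + t • (y - x₀)) h (B (x₀ + t • (y - x₀)) (y - x₀) (F y t))
              + fderiv ℝ B (x₀ + t • (y - x₀)) (y - x₀) h (F y t))
              + (1 : ℝ) • B (x₀ + t • (y - x₀)) h (F y t))) (Icc 0 1) t := by
        intro t ht
        have h1 := (hF y hy).2 t ht
        have h2 : HasDerivWithinAt (fun t => B (x₀ + t • (y - x₀)) h)
            (fderiv ℝ B (x₀ + t • (y - x₀)) (y - x₀) h) (Icc 0 1) t := by
          simpa using (hBd y hy t ht).hasDerivWithinAt.clm_apply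
            (hasDerivWithinAt_const t (Icc (0 : ℝ) 1) h)
        have h3 := h1.add ((hasDerivWithinAt_id t (Icc (0 : ℝ) 1)).smul (h2.clm_apply h1))
        convert! h3 using 1
        simp only [id, add_comm]
      have hbound : ∀ t ∈ Icc (0 : ℝ) 1,
          ‖B (x₀ + t • (y + h - x₀)) (y + h - x₀) (F (y + h) t)
            - (B (x₀ + t • (y - x₀)) (y - x₀) (F y t)
            + (t • (B (x₀ + t • (y - x₀)) h (B (x₀ + t • (y - x₀)) (y - x₀) (F y t))
              + fderiv ℝ B (x₀ + t • (y - x₀)) (y - x₀) h (F y t))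
              + (1 : ℝ) • B (x₀ + t • (y - x₀)) h (F y t)))‖
          ≤ 1 * ‖F (y + h) t - (F y t + t • B (x₀ + t • (y - x₀)) h (F y t))‖
            + c * ‖h‖ ^ 2 := by
        intro t ht
        have hp := hseg y hy t ht
        have hp' := hseg _ hyh t ht
        have hsm := hsmall _ hyh t ht
        obtain ⟨hBp, -, hfl, hDp, hps⟩ := hball _ hp
        have hMt := hM y hy t ht
        have hpp : x₀ + t • (y + h - x₀) - (x₀ + t • (y - x₀)) = t • h := by
          rw [add_sub_add_left_eq_sub, ← smul_sub]; congr 1; abel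
        have hR : ‖B (x₀ + t • (y + h - x₀)) - B (x₀ + t • (y - x₀))
            - fderiv ℝ B (x₀ + t • (y - x₀)) (t • h)‖ ≤ C * ‖h‖ ^ 2 := by
          have hth : ‖t • h‖ ≤ ‖h‖ := by
            rw [norm_smul, Real.norm_of_nonneg ht.1]
            exact mul_le_of_le_one_left (norm_nonneg _) ht.2
          have h1 := (convex_segment (𝕜 := ℝ) (x₀ + t • (y - x₀))
            (x₀ + t • (y + h - x₀))).norm_image_sub_le_of_norm_hasFDerivWithin_le' (f := B)
            (f' := fderiv ℝ B) (φ := fderiv ℝ B (x₀ + t • (y - x₀))) (C := C * ‖h‖)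
            (fun z hz => (hball z ((convex_ball x₀ r).segment_subset hp hp' hz)).2.1.hasFDerivWithinAt)
            (fun z hz => by
              have h2 := (hball z ((convex_ball x₀ r).segment_subset hp hp' hz)).2.2.2.2
              refine (hLip.norm_sub_le h2 hps).trans ?_
              gcongr
              refine (norm_sub_le_of_mem_segment hz).trans ?_
              rwa [hpp])
            (left_mem_segment ℝ _ _) (right_mem_segment ℝ _ _)
          rw [hpp] at h1
          refine h1.trans ?_
          calc C * ‖h‖ * ‖t • h‖ ≤ C * ‖h‖ * ‖h‖ := by gcongr
            _ = _ := by ring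
        set p := x₀ + t • (y - x₀) with hpdef
        set R := B (x₀ + t • (y + h - x₀)) - B p - fderiv ℝ B p (t • h) with hRdef
        have hB' : B (x₀ + t • (y + h - x₀)) = B p + t • fderiv ℝ B p h + R := by
          rw [hRdef, map_smul]; abel
        have hfl' := congrArg (fun T : G →L[ℝ] G => T (F y t)) (hfl (y - x₀) h)
        simp only [add_apply, ContinuousLinearMap.comp_apply] at hfl'
        set w := y - x₀ with hw
        have hwh : y + h - x₀ = w + h := by rw [hw]; abel
        set f := F y t with hf
        have hkey : B (x₀ + t • (y + h - x₀)) (y + h - x₀) (F (y + h) t)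
            - (B p w f + (t • (B p h (B p w f) + fderiv ℝ B p w h f) + (1 : ℝ) • B p h f))
            = B (x₀ + t • (y + h - x₀)) (y + h - x₀) (F (y + h) t - (f + t • B p h f))
              + (t • (fderiv ℝ B p h h f + B p h (B p h f))
                + (t * t) • fderiv ℝ B p h (w + h) (B p h f)
                + R (w + h) (f + t • B p h f)) := by
          rw [hwh]
          exact flat_error_identity (by rw [← hwh]; exact hB') hfl'
        rw [hkey]
        refine (norm_add_le _ _).trans (add_le_add ?_ ?_)
        · refine ((B _ _).le_opNorm _).trans ?_
          gcongr
          linarith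
        · have ht0 := ht.1
          have ht1 := ht.2
          exact norm_flat_error_le ht hKpos.le hDpos.le (by positivity) hM0 hBp hDp hR hMt
            (by rwa [← hwh]) hhr
      have hgr := norm_le_gronwallBound_of_norm_deriv_right_le (δ := 0)
        (fun t ht => (((hF _ hyh).2 t ht).sub (hg t ht)).continuousWithinAt)
        (fun t ht => hIci ht (((hF _ hyh).2 t (Ico_subset_Icc_self ht)).sub
          (hg t (Ico_subset_Icc_self ht))))
        (by simp [(hF _ hyh).1, (hF _ hy).1])
        (fun t ht => hbound t (Ico_subset_Icc_self ht)) 1 (by simp)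
      rw [gronwallBound_of_K_ne_0 one_ne_zero] at hgr
      simpa [sub_sub] using hgr
    rw [hasFDerivAt_iff_isLittleO_nhds_zero]
    refine Asymptotics.IsBigO.trans_isLittleO (g := fun h : E => ‖h‖ ^ 2) ?_
      (Asymptotics.isLittleO_norm_pow_id one_lt_two)
    refine Asymptotics.IsBigO.of_bound (c * (Real.exp 1 - 1)) ?_
    have hn1 : ∀ᶠ h : E in 𝓝 0, y + h ∈ Metric.ball x₀ r := by
      have : Tendsto (fun h : E => y + h) (𝓝 0) (𝓝 y) := by
        simpa using (continuous_const_add y).tendsto (0 : E)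
      exact this.eventually (Metric.isOpen_ball.mem_nhds hy)
    have hn2 : ∀ᶠ h : E in 𝓝 0, ‖h‖ ≤ r := by
      filter_upwards [Metric.ball_mem_nhds (0 : E) hr] with h hh
      simpa using (mem_ball_zero_iff.1 hh).le
    filter_upwards [hn1, hn2] with h h1 h2
    rw [Real.norm_of_nonneg (by positivity : (0 : ℝ) ≤ ‖h‖ ^ 2)]
    refine (hest h h1 h2).trans (le_of_eq (by ring))

end FlatSystems

/-! ### Directional derivatives and Lie brackets of vector fields -/

section DirectionalDerivative

variable {m : ℕ} {M : Type*} [TopologicalSpace M] [ChartedSpace (EuclideanSpace ℝ (Fin m)) M]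
variable {F : Type*} [NormedAddCommGroup F] [NormedSpace ℝ F]
variable {F' : Type*} [NormedAddCommGroup F'] [NormedSpace ℝ F']

theorem dirDeriv_eq_mvfderiv (X : VField m M) (f : M → F) (x : M) :
    dirDeriv X f x = mvfderiv (𝓡 m) f x (X x) := rfl

theorem dirDeriv_congr (X : VField m M) {f g : M → F} {x : M} (h : f =ᶠ[𝓝 x] g) :
    dirDeriv X f x = dirDeriv X g x := by
  simp only [dirDeriv]
  rw [h.mfderiv_eq]
  rfl

@[simp] theorem dirDeriv_const (X : VField m M) (a : F) (x : M) :
    dirDeriv X (fun _ => a) x = 0 := by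
  rw [dirDeriv_eq_mvfderiv, mvfderiv_const]; rfl

theorem dirDeriv_add (X : VField m M) {f g : M → F} {x : M}
    (hf : MDifferentiableAt (𝓡 m) 𝓘(ℝ, F) f x) (hg : MDifferentiableAt (𝓡 m) 𝓘(ℝ, F) g x) :
    dirDeriv X (fun y => f y + g y) x = dirDeriv X f x + dirDeriv X g x := by
  have := congrArg (fun L => L (X x)) (mvfderiv_add hf hg)
  exact this

theorem dirDeriv_sub (X : VField m M) {f g : M → F} {x : M}
    (hf : MDifferentiableAt (𝓡 m) 𝓘(ℝ, F) f x) (hg : MDifferentiableAt (𝓡 m) 𝓘(ℝ, F) g x) :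
    dirDeriv X (fun y => f y - g y) x = dirDeriv X f x - dirDeriv X g x := by
  have := congrArg (fun L => L (X x)) (mvfderiv_sub hf hg)
  exact this

theorem dirDeriv_smul (X : VField m M) {a : M → ℝ} {f : M → F} {x : M}
    (ha : MDifferentiableAt (𝓡 m) 𝓘(ℝ, ℝ) a x) (hf : MDifferentiableAt (𝓡 m) 𝓘(ℝ, F) f x) :
    dirDeriv X (fun y => a y • f y) x = a x • dirDeriv X f x + dirDeriv X a x • f x := by
  have := congrArg (fun L => L (X x)) (mvfderiv_smul ha hf)
  exact this

theorem dirDeriv_clm (X : VField m M) (L : F →L[ℝ] F') {f : M → F} {x : M}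
    (hf : MDifferentiableAt (𝓡 m) 𝓘(ℝ, F) f x) :
    dirDeriv X (fun y => L (f y)) x = L (dirDeriv X f x) := by
  have h := (L.hasMFDerivAt.comp x hf.hasMFDerivAt).mfderiv
  exact congrArg (fun T => T (X x)) h

theorem mdifferentiableAt_sum {ι : Type} {s : Finset ι} {f : ι → M → F} {x : M}
    (hf : ∀ i ∈ s, MDifferentiableAt (𝓡 m) 𝓘(ℝ, F) (f i) x) :
    MDifferentiableAt (𝓡 m) 𝓘(ℝ, F) (fun y => ∑ i ∈ s, f i y) x := by
  have h := MDifferentiableAt.sum hf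
  rwa [show (∑ i ∈ s, f i) = fun y => ∑ i ∈ s, f i y from Finset.sum_fn s f] at h

theorem dirDeriv_sum (X : VField m M) {ι : Type} (s : Finset ι) {f : ι → M → F} {x : M}
    (hf : ∀ i ∈ s, MDifferentiableAt (𝓡 m) 𝓘(ℝ, F) (f i) x) :
    dirDeriv X (fun y => ∑ i ∈ s, f i y) x = ∑ i ∈ s, dirDeriv X (f i) x := by
  classical
  induction s using Finset.induction_on with
  | empty => simp
  | insert i s hi ih =>
    have h1 : MDifferentiableAt (𝓡 m) 𝓘(ℝ, F) (fun y => ∑ j ∈ s, f j y) x :=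
      mdifferentiableAt_sum fun j hj => hf j (Finset.mem_insert_of_mem hj)
    simp only [Finset.sum_insert hi]
    rw [dirDeriv_add X (hf i (Finset.mem_insert_self _ _)) h1,
      ih fun j hj => hf j (Finset.mem_insert_of_mem hj)]

theorem dirDeriv_mul {𝔸 : Type*} [NormedRing 𝔸] [NormedAlgebra ℝ 𝔸] (X : VField m M)
    {f g : M → 𝔸} {x : M}
    (hf : MDifferentiableAt (𝓡 m) 𝓘(ℝ, 𝔸) f x) (hg : MDifferentiableAt (𝓡 m) 𝓘(ℝ, 𝔸) g x) :
    dirDeriv X (fun y => f y * g y) x = f x * dirDeriv X g x + dirDeriv X f x * g x := by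
  have h := (hf.hasMFDerivAt.mul' hg.hasMFDerivAt).mfderiv
  exact congrArg (fun T => T (X x)) h

variable [IsManifold (𝓡 m) ∞ M]

/-- The derivative of a smooth function along a smooth vector field is smooth. -/
theorem contMDiffAt_dirDeriv {X : VField m M} {f : M → F} {x : M} (hX : X.SmoothAt x)
    (hf : ContMDiffAt (𝓡 m) 𝓘(ℝ, F) ∞ f x) :
    ContMDiffAt (𝓡 m) 𝓘(ℝ, F) ∞ (dirDeriv X f) x := by
  refine contMDiffAt_infty.2 fun k => ?_
  obtain ⟨u, hu, hfu⟩ := (contMDiffAt_iff_contMDiffOn_nhds (n := ((k + 1 : ℕ) : ℕ∞ω))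
    (by simp)).1 (contMDiffAt_infty.1 hf (k + 1))
  obtain ⟨v, hvu, hv, hxv⟩ := mem_nhds_iff.1 hu
  have h1 := (hfu.mono hvu).contMDiffOn_tangentMapWithin (m := (k : ℕ∞ω)) (by simp)
    hv.uniqueMDiffOn
  have h2 : ContMDiffAt (𝓡 m) (𝓡 m).tangent k
      (fun y => (⟨y, X y⟩ : TangentBundle (𝓡 m) M)) x := contMDiffAt_infty.1 hX k
  have hmem : (Bundle.TotalSpace.proj ⁻¹' v : Set (TangentBundle (𝓡 m) M)) ∈
      𝓝 (⟨x, X x⟩ : TangentBundle (𝓡 m) M) :=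
    (hv.preimage (FiberBundle.continuous_proj _ _)).mem_nhds hxv
  have h3 := (h1.contMDiffAt hmem).comp x h2
  have h4 := ((contMDiff_snd_tangentBundle_modelSpace F 𝓘(ℝ, F)).contMDiffAt
    (n := (k : ℕ∞ω))).comp x h3
  refine h4.congr_of_eventuallyEq ?_
  filter_upwards [hv.mem_nhds hxv] with y hy
  simp only [Function.comp, tangentMapWithin, dirDeriv]
  rw [mfderivWithin_of_mem_nhds (hv.mem_nhds hy)]

theorem VField.SmoothAt.mdifferentiableAt {X : VField m M} {x : M} (hX : X.SmoothAt x) :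
    MDifferentiableAt (𝓡 m) (𝓡 m).tangent (fun y => (⟨y, X y⟩ : TangentBundle (𝓡 m) M)) x :=
  ContMDiffAt.mdifferentiableAt hX (by simp)

theorem VField.SmoothAt.eventually_mdifferentiableAt {X : VField m M} {x : M}
    (hX : X.SmoothAt x) : ∀ᶠ y in 𝓝 x, MDifferentiableAt (𝓡 m) (𝓡 m).tangent
      (fun y => (⟨y, X y⟩ : TangentBundle (𝓡 m) M)) y :=
  ((contMDiffAt_iff_contMDiffAt_nhds (n := 1) (by decide)).1 (ContMDiffAt.of_le hX (by simp))).mono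
    fun _ h => h.mdifferentiableAt (by simp)

theorem eventually_mdifferentiableAt_of_contMDiffAt {f : M → F} {x : M}
    (hf : ContMDiffAt (𝓡 m) 𝓘(ℝ, F) ∞ f x) :
    ∀ᶠ y in 𝓝 x, MDifferentiableAt (𝓡 m) 𝓘(ℝ, F) f y :=
  ((contMDiffAt_iff_contMDiffAt_nhds (n := 1) (by decide)).1 (hf.of_le (by simp))).mono
    fun _ h => h.mdifferentiableAt (by simp)

theorem VField.SmoothAt.mlieBracket {X Y : VField m M} {x : M} (hX : X.SmoothAt x)
    (hY : Y.SmoothAt x) : VField.SmoothAt (VectorField.mlieBracket (𝓡 m) X Y) x :=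
  have : IsManifold (𝓡 m) (minSmoothness ℝ 2) M := IsManifold.of_le (n := ∞) (by
    simp only [minSmoothness_of_isRCLikeNormedField]; exact ENat.LEInfty.out)
  have : IsManifold (𝓡 m) ((⊤ : ℕ∞) + 1) M := by simpa using ‹IsManifold (𝓡 m) ∞ M›
  ContMDiffAt.mlieBracket_vectorField (m := ⊤) (n := ⊤) hX hY (by simp)

theorem VField.SmoothAt.smul {a : M → ℝ} {X : VField m M} {x : M}
    (ha : ContMDiffAt (𝓡 m) 𝓘(ℝ, ℝ) ∞ a x) (hX : X.SmoothAt x) :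
    VField.SmoothAt (fun y => a y • X y) x :=
  ContMDiffAt.smul_section ha hX

theorem VField.SmoothAt.add {X Y : VField m M} {x : M} (hX : X.SmoothAt x) (hY : Y.SmoothAt x) :
    VField.SmoothAt (fun y => X y + Y y) x :=
  ContMDiffAt.add_section hX hY

theorem VField.SmoothAt.sub {X Y : VField m M} {x : M} (hX : X.SmoothAt x) (hY : Y.SmoothAt x) :
    VField.SmoothAt (fun y => X y - Y y) x :=
  ContMDiffAt.sub_section hX hY

theorem VField.SmoothAt.sum {ι : Type} {s : Finset ι} {X : ι → VField m M} {x : M}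
    (hX : ∀ i ∈ s, (X i).SmoothAt x) : VField.SmoothAt (fun y => ∑ i ∈ s, X i y) x :=
  ContMDiffAt.sum_section hX

theorem VField.SmoothAt.congr {X Y : VField m M} {x : M} (hX : X.SmoothAt x)
    (h : ∀ᶠ y in 𝓝 x, Y y = X y) : Y.SmoothAt x :=
  ContMDiffAt.congr_of_eventuallyEq hX (h.mono fun y hy => by simp only [hy])

/-! ### Lie brackets -/
open VectorField

theorem mlieBracket_smul_field_right (X : VField m M) {a : M → ℝ} {Y : VField m M} {x : M}
    (ha : MDifferentiableAt (𝓡 m) 𝓘(ℝ, ℝ) a x)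
    (hY : MDifferentiableAt (𝓡 m) (𝓡 m).tangent
      (fun y => (⟨y, Y y⟩ : TangentBundle (𝓡 m) M)) x) :
    mlieBracket (𝓡 m) X (fun y => a y • Y y) x
      = dirDeriv X a x • Y x + a x • mlieBracket (𝓡 m) X Y x :=
  mlieBracket_smul_right ha hY

theorem mlieBracket_sum_field_right (X : VField m M) {ι : Type} (s : Finset ι)
    {Y : ι → VField m M} {x : M} (hY : ∀ i ∈ s, (Y i).SmoothAt x) :
    mlieBracket (𝓡 m) X (fun y => ∑ i ∈ s, Y i y) x
      = ∑ i ∈ s, mlieBracket (𝓡 m) X (Y i) x := by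
  classical
  induction s using Finset.induction_on with
  | empty =>
    simp only [Finset.sum_empty]
    exact congrFun (mlieBracket_zero_right (I := 𝓡 m) (W := X)) x
  | insert i s hi ih =>
    have h1 := VField.SmoothAt.sum fun j (hj : j ∈ s) => hY j (Finset.mem_insert_of_mem hj)
    simp only [Finset.sum_insert hi]
    rw [← ih fun j hj => hY j (Finset.mem_insert_of_mem hj)]
    exact mlieBracket_add_right (hY i (Finset.mem_insert_self _ _)).mdifferentiableAt
      h1.mdifferentiableAt

theorem mlieBracket_jacobi {X Y Z : VField m M} {x : M} (hX : X.SmoothAt x) (hY : Y.SmoothAt x)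
    (hZ : Z.SmoothAt x) :
    mlieBracket (𝓡 m) X (mlieBracket (𝓡 m) Y Z) x
      = mlieBracket (𝓡 m) (mlieBracket (𝓡 m) X Y) Z x
        + mlieBracket (𝓡 m) Y (mlieBracket (𝓡 m) X Z) x :=
  have h2 : minSmoothness ℝ 2 ≤ ∞ := by
    simp only [minSmoothness_of_isRCLikeNormedField]; exact ENat.LEInfty.out
  have : IsManifold (𝓡 m) (minSmoothness ℝ 3) M := IsManifold.of_le (n := ∞) (by
    simp only [minSmoothness_of_isRCLikeNormedField]; exact ENat.LEInfty.out)
  leibniz_identity_mlieBracket_apply (ContMDiffAt.of_le hX h2)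
    (ContMDiffAt.of_le hY h2) (ContMDiffAt.of_le hZ h2)

end DirectionalDerivative

/-! ### Frames that span a Lie algebra -/

section Frame

variable {m : ℕ} {M : Type*} [TopologicalSpace M] [ChartedSpace (EuclideanSpace ℝ (Fin m)) M]
variable {F : Type*} [NormedAddCommGroup F] [NormedSpace ℝ F]
variable [IsManifold (𝓡 m) ∞ M]

/-- A global smooth frame of `T(M)` whose brackets have constant coefficients `c`. -/
structure IsLieFrame (X : Fin m → VField m M) (c : Fin m → Fin m → Fin m → ℝ) : Prop where
  smoothAt : ∀ i x, (X i).SmoothAt x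
  linearIndependent : ∀ x, LinearIndependent ℝ (fun i => X i x)
  bracket : ∀ i j x, VectorField.mlieBracket (𝓡 m) (X i) (X j) x = ∑ k, c i j k • X k x

namespace IsLieFrame

variable {X : Fin m → VField m M} {c : Fin m → Fin m → Fin m → ℝ} (hX : IsLieFrame X c)
include hX

/-- The values of the frame at `x`, as a basis of the tangent space. -/
noncomputable def basis (x : M) : Module.Basis (Fin m) ℝ (TangentSpace (𝓡 m) x) :=
  Module.Basis.mk (hX.linearIndependent x) (by
    have : FiniteDimensional ℝ (TangentSpace (𝓡 m) x) :=
      inferInstanceAs (FiniteDimensional ℝ (EuclideanSpace ℝ (Fin m)))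
    have h : Module.finrank ℝ (TangentSpace (𝓡 m) x) = m :=
      finrank_euclideanSpace_fin (𝕜 := ℝ) (n := m)
    exact ((hX.linearIndependent x).span_eq_top_of_card_eq_finrank' (by
      rw [h, Fintype.card_fin])).ge)

/-- The coefficient functions of a vector field in the frame. -/
noncomputable def coeff (Y : VField m M) (j : Fin m) (x : M) : ℝ := (hX.basis x).repr (Y x) j

theorem basis_apply (x : M) (j : Fin m) : hX.basis x j = X j x := by simp [basis]

theorem sum_coeff (Y : VField m M) (x : M) : Y x = ∑ j, hX.coeff Y j x • X j x := by
  conv_lhs => rw [← (hX.basis x).sum_repr (Y x)]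
  simp [coeff, basis_apply]

end IsLieFrame

/-- The fields of a family read in the chart at `x₀`, assembled to a linear map sending the
`i`-th unit vector to the `i`-th field. -/
noncomputable def chartFrame (X : Fin m → VField m M) (x₀ y : M) :
    (Fin m → ℝ) →L[ℝ] EuclideanSpace ℝ (Fin m) :=
  ∑ i, (ContinuousLinearMap.proj (R := ℝ) (φ := fun _ : Fin m => ℝ) i).smulRight
    (dirDeriv (X i) (extChartAt (𝓡 m) x₀) y)

omit [IsManifold (𝓡 m) ∞ M] in
theorem chartFrame_apply (X : Fin m → VField m M) (x₀ y : M) (a : Fin m → ℝ) :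
    chartFrame X x₀ y a = ∑ i, a i • dirDeriv (X i) (extChartAt (𝓡 m) x₀) y := by
  simp [chartFrame]

namespace IsLieFrame

variable {X : Fin m → VField m M} {c : Fin m → Fin m → Fin m → ℝ} (hX : IsLieFrame X c)
include hX

theorem contMDiffAt_chartFrame (x₀ : M) {y : M} (hy : y ∈ (extChartAt (𝓡 m) x₀).source) :
    ContMDiffAt (𝓡 m) 𝓘(ℝ, (Fin m → ℝ) →L[ℝ] EuclideanSpace ℝ (Fin m)) ∞
      (chartFrame X x₀) y := by
  have h1 : ∀ i, ContMDiffAt (𝓡 m) 𝓘(ℝ, EuclideanSpace ℝ (Fin m)) ∞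
      (dirDeriv (X i) (extChartAt (𝓡 m) x₀)) y := fun i =>
    contMDiffAt_dirDeriv (hX.smoothAt i y) (contMDiffAt_extChartAt' (by simpa using hy))
  have h2 : ∀ i, ContMDiffAt (𝓡 m) 𝓘(ℝ, (Fin m → ℝ) →L[ℝ] EuclideanSpace ℝ (Fin m)) ∞
      (fun y => (ContinuousLinearMap.proj (R := ℝ) (φ := fun _ : Fin m => ℝ) i).smulRight
        (dirDeriv (X i) (extChartAt (𝓡 m) x₀) y)) y := fun i =>
    ((ContinuousLinearMap.smulRightL ℝ (Fin m → ℝ) (EuclideanSpace ℝ (Fin m))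
      (ContinuousLinearMap.proj (R := ℝ) (φ := fun _ : Fin m => ℝ) i)).contMDiff.contMDiffAt).comp y
        (h1 i)
  exact contMDiffAt_finsetSum fun i _ => h2 i

theorem chartFrame_coeff (x₀ y : M) (Y : VField m M) :
    chartFrame X x₀ y (fun i => hX.coeff Y i y) = dirDeriv Y (extChartAt (𝓡 m) x₀) y := by
  rw [chartFrame_apply, dirDeriv_eq_mvfderiv, hX.sum_coeff Y y, map_sum]
  simp only [map_smul, dirDeriv_eq_mvfderiv]

theorem isInvertible_chartFrame (x₀ : M) {y : M} (hy : y ∈ (extChartAt (𝓡 m) x₀).source) :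
    (chartFrame X x₀ y).IsInvertible := by
  have hinv := isInvertible_mfderiv_extChartAt (I := 𝓡 m) hy
  have hfun : ∀ a, chartFrame X x₀ y a
      = mfderiv (𝓡 m) 𝓘(ℝ, EuclideanSpace ℝ (Fin m)) (extChartAt (𝓡 m) x₀) y
        ((hX.basis y).equivFun.symm a) := by
    intro a
    rw [chartFrame_apply, (hX.basis y).equivFun_symm_apply, map_sum]
    simp only [map_smul, basis_apply]
    rfl
  have hbij : Function.Bijective (chartFrame X x₀ y) := by
    have : ⇑(chartFrame X x₀ y)
        = mfderiv (𝓡 m) 𝓘(ℝ, EuclideanSpace ℝ (Fin m)) (extChartAt (𝓡 m) x₀) y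
          ∘ (hX.basis y).equivFun.symm := funext hfun
    rw [this]
    exact hinv.bijective.comp (hX.basis y).equivFun.symm.bijective
  exact ⟨ContinuousLinearEquiv.ofBijective (chartFrame X x₀ y)
    (LinearMap.ker_eq_bot.2 hbij.1) (LinearMap.range_eq_top.2 hbij.2),
    ContinuousLinearEquiv.coe_ofBijective _ _ _⟩

theorem contMDiffAt_inverse_chartFrame (x₀ : M) {y : M}
    (hy : y ∈ (extChartAt (𝓡 m) x₀).source) :
    ContMDiffAt (𝓡 m) 𝓘(ℝ, EuclideanSpace ℝ (Fin m) →L[ℝ] (Fin m → ℝ)) ∞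
      (fun y => (chartFrame X x₀ y).inverse) y := by
  obtain ⟨e, he⟩ := hX.isInvertible_chartFrame x₀ hy
  have h := contDiffAt_map_inverse (n := ∞) e
  rw [he] at h
  exact h.contMDiffAt.comp y (hX.contMDiffAt_chartFrame x₀ hy)

/-- The coefficients of a smooth field are smooth: in a chart they arise from its components by the
inverse of the matrix of the frame. -/
theorem contMDiffAt_coeff {Y : VField m M} {x : M} (hY : Y.SmoothAt x) (j : Fin m) :
    ContMDiffAt (𝓡 m) 𝓘(ℝ, ℝ) ∞ (hX.coeff Y j) x := by
  have hx := mem_extChartAt_source (I := 𝓡 m) x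
  have h1 : ContMDiffAt (𝓡 m) 𝓘(ℝ, Fin m → ℝ) ∞
      (fun y => (chartFrame X x y).inverse (dirDeriv Y (extChartAt (𝓡 m) x) y)) x :=
    (hX.contMDiffAt_inverse_chartFrame x hx).clm_apply
      (contMDiffAt_dirDeriv hY contMDiffAt_extChartAt)
  have h2 : ContMDiffAt (𝓡 m) 𝓘(ℝ, Fin m → ℝ) ∞ (fun y i => hX.coeff Y i y) x := by
    refine h1.congr_of_eventuallyEq ?_
    filter_upwards [extChartAt_source_mem_nhds (I := 𝓡 m) x] with y hy
    rw [← hX.chartFrame_coeff x y Y, (hX.isInvertible_chartFrame x hy).inverse_apply_self]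
  exact contMDiffAt_pi_space.1 h2 j

end IsLieFrame
end Frame

/-! ### Commutators of frame derivations and the Jacobi identity -/

section FrameCalculus

variable {m : ℕ} {M : Type*} [TopologicalSpace M] [ChartedSpace (EuclideanSpace ℝ (Fin m)) M]
variable {F : Type*} [NormedAddCommGroup F] [NormedSpace ℝ F]
variable [IsManifold (𝓡 m) ∞ M]

open VectorField

/-- `X(Y(f)) - Y(X(f)) = [X, Y](f)` for real functions. The identity follows from the Jacobi
identity for `X`, `Y`, `f Z`, where `Z` is a field that does not vanish at the point. -/
theorem dirDeriv_commutator_real {X Y Z : VField m M} {f : M → ℝ} {x : M} (hX : X.SmoothAt x)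
    (hY : Y.SmoothAt x) (hZ : Z.SmoothAt x) (hZ0 : Z x ≠ 0)
    (hf : ContMDiffAt (𝓡 m) 𝓘(ℝ, ℝ) ∞ f x) :
    dirDeriv X (dirDeriv Y f) x - dirDeriv Y (dirDeriv X f) x
      = dirDeriv (mlieBracket (𝓡 m) X Y) f x := by
  have hfZ : VField.SmoothAt (fun y => f y • Z y) x := hZ.smul hf
  -- the bracket of a smooth field with `f Z`, near `x`
  have hev : ∀ W : VField m M, ∀ᶠ y in 𝓝 x, mlieBracket (𝓡 m) W (fun y => f y • Z y) y
      = dirDeriv W f y • Z y + f y • mlieBracket (𝓡 m) W Z y := by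
    intro W
    filter_upwards [eventually_mdifferentiableAt_of_contMDiffAt hf,
      hZ.eventually_mdifferentiableAt] with y h1 h2
    exact mlieBracket_smul_field_right W h1 h2
  have hexp : ∀ V W : VField m M, V.SmoothAt x → W.SmoothAt x →
      mlieBracket (𝓡 m) V (mlieBracket (𝓡 m) W (fun y => f y • Z y)) x
        = dirDeriv V (dirDeriv W f) x • Z x + dirDeriv W f x • mlieBracket (𝓡 m) V Z x
          + (dirDeriv V f x • mlieBracket (𝓡 m) W Z x
            + f x • mlieBracket (𝓡 m) V (mlieBracket (𝓡 m) W Z) x) := by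
    intro V W hV hW
    have h1 : mlieBracket (𝓡 m) V (mlieBracket (𝓡 m) W (fun y => f y • Z y)) x
        = mlieBracket (𝓡 m) V
            (fun y => dirDeriv W f y • Z y + f y • mlieBracket (𝓡 m) W Z y) x :=
      Filter.EventuallyEq.mlieBracket_vectorField_eq EventuallyEq.rfl (hev W)
    have hs := contMDiffAt_dirDeriv hW hf
    have hb := hW.mlieBracket hZ
    rw [h1]
    refine (mlieBracket_add_right (hZ.smul hs).mdifferentiableAt
      (hb.smul hf).mdifferentiableAt).trans ?_
    rw [mlieBracket_smul_field_right V (hs.mdifferentiableAt (by simp)) hZ.mdifferentiableAt,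
      mlieBracket_smul_field_right V (hf.mdifferentiableAt (by simp)) hb.mdifferentiableAt]
  have hJ := mlieBracket_jacobi hX hY hfZ
  have hJ0 := mlieBracket_jacobi hX hY hZ
  rw [hexp X Y hX hY, hexp Y X hY hX, (hev (mlieBracket (𝓡 m) X Y)).self_of_nhds, hJ0] at hJ
  have key : (dirDeriv X (dirDeriv Y f) x) • Z x
      = (dirDeriv (mlieBracket (𝓡 m) X Y) f x + dirDeriv Y (dirDeriv X f) x) • Z x := by
    rw [add_smul]
    have h3 := sub_eq_zero.2 hJ
    rw [← sub_eq_zero, ← h3, smul_add]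
    abel
  have := smul_left_injective ℝ hZ0 key
  linarith

namespace IsLieFrame

variable {X : Fin m → VField m M} {c : Fin m → Fin m → Fin m → ℝ} (hX : IsLieFrame X c)
include hX

theorem dirDeriv_bracket (i j : Fin m) (f : M → F) (x : M) :
    dirDeriv (mlieBracket (𝓡 m) (X i) (X j)) f x = ∑ k, c i j k • dirDeriv (X k) f x := by
  rw [dirDeriv_eq_mvfderiv, hX.bracket i j x, map_sum]
  simp only [map_smul, dirDeriv_eq_mvfderiv]

/-- The commutator of two frame derivations on functions with values in `ℝ^m`. -/
theorem dirDeriv_commutator {ι : Type} [Fintype ι] (i j : Fin m)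
    {f : M → EuclideanSpace ℝ ι} {x : M}
    (hf : ContMDiffAt (𝓡 m) 𝓘(ℝ, EuclideanSpace ℝ ι) ∞ f x) :
    dirDeriv (X i) (dirDeriv (X j) f) x - dirDeriv (X j) (dirDeriv (X i) f) x
      = ∑ k, c i j k • dirDeriv (X k) f x := by
  ext p
  have hev : ∀ k, ∀ᶠ y in 𝓝 x,
      dirDeriv (X k) (fun y => f y p) y = (dirDeriv (X k) f y) p := by
    intro k
    filter_upwards [eventually_mdifferentiableAt_of_contMDiffAt hf] with y hy
    exact dirDeriv_clm (X k) (EuclideanSpace.proj (𝕜 := ℝ) p) hy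
  have h2 : ∀ k l, (dirDeriv (X k) (dirDeriv (X l) f) x) p
      = dirDeriv (X k) (dirDeriv (X l) (fun y => f y p)) x := by
    intro k l
    rw [dirDeriv_congr (X k) (hev l)]
    exact (dirDeriv_clm (X k) (EuclideanSpace.proj (𝕜 := ℝ) p)
      ((contMDiffAt_dirDeriv (hX.smoothAt l x) hf).mdifferentiableAt (by simp))).symm
  have hfp : ContMDiffAt (𝓡 m) 𝓘(ℝ, ℝ) ∞ (fun y => f y p) x :=
    (EuclideanSpace.proj (𝕜 := ℝ) p).contMDiff.contMDiffAt.comp x hf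
  have h3 := dirDeriv_commutator_real (hX.smoothAt i x) (hX.smoothAt j x) (hX.smoothAt i x)
    ((hX.linearIndependent x).ne_zero i) hfp
  rw [hX.dirDeriv_bracket] at h3
  simp only [PiLp.sub_apply, h2, h3, WithLp.ofLp_sum, Finset.sum_apply, PiLp.smul_apply]
  exact Finset.sum_congr rfl fun k _ => by rw [(hev k).self_of_nhds]

/-- The Jacobi identity for the structure constants. -/
theorem jacobi [Nonempty M] (i j p r : Fin m) :
    ∑ q, c j p q * c i q r = ∑ q, c i j q * c q p r + ∑ q, c i p q * c j q r := by
  obtain ⟨x⟩ := ‹Nonempty M›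
  have hb : ∀ i j, mlieBracket (𝓡 m) (X i) (X j) = fun x => ∑ k, c i j k • X k x :=
    fun i j => funext fun x => hX.bracket i j x
  have hconst : ∀ (Z : VField m M) (a : Fin m → ℝ),
      mlieBracket (𝓡 m) Z (fun x => ∑ k, a k • X k x) x
        = ∑ k, a k • mlieBracket (𝓡 m) Z (X k) x := by
    intro Z a
    rw [mlieBracket_sum_field_right Z Finset.univ
      (Y := fun k y => a k • X k y) fun k _ => (hX.smoothAt k x).smul contMDiffAt_const]
    refine Finset.sum_congr rfl fun k _ => ?_
    rw [mlieBracket_smul_field_right Z (a := fun _ => a k) mdifferentiableAt_const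
      (hX.smoothAt k x).mdifferentiableAt]
    simp
  have hJ := mlieBracket_jacobi (hX.smoothAt i x) (hX.smoothAt j x) (hX.smoothAt p x)
  rw [hb j p, hb i j, hb i p, hconst, hconst, mlieBracket_swap_apply, hconst, ← Finset.sum_neg_distrib] at hJ
  simp only [← smul_neg, ← mlieBracket_swap_apply] at hJ
  simp only [hX.bracket, Finset.smul_sum, smul_smul] at hJ
  rw [Finset.sum_comm, Finset.sum_comm (γ := Fin m) (f := fun q r => (c i j q * c q p r) • X r x),
    Finset.sum_comm (γ := Fin m) (f := fun q r => (c i p q * c j q r) • X r x),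
    ← Finset.sum_add_distrib] at hJ
  simp only [← Finset.sum_smul, ← add_smul] at hJ
  have h := (Fintype.linearIndependent_iff.1 (hX.linearIndependent x))
    (fun r => (∑ q, c j p q * c i q r)
      - (∑ q, c i j q * c q p r + ∑ q, c i p q * c j q r))
    (by simp only [sub_smul, Finset.sum_sub_distrib]; rw [hJ, sub_self]) r
  linarith

end IsLieFrame
end FrameCalculus

/-! ### Homogeneous linear systems along a frame -/

section LocalSystems

variable {m : ℕ} {M : Type*} [TopologicalSpace M] [ChartedSpace (EuclideanSpace ℝ (Fin m)) M]
variable {F : Type*} [NormedAddCommGroup F] [NormedSpace ℝ F]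
variable [IsManifold (𝓡 m) ∞ M]

open VectorField

theorem dirDeriv_comp_extChartAt (X : VField m M) {x₀ y : M}
    (hy : y ∈ (extChartAt (𝓡 m) x₀).source) {g : EuclideanSpace ℝ (Fin m) → F}
    (hg : DifferentiableAt ℝ g (extChartAt (𝓡 m) x₀ y)) :
    dirDeriv X (fun y => g (extChartAt (𝓡 m) x₀ y)) y
      = fderiv ℝ g (extChartAt (𝓡 m) x₀ y) (dirDeriv X (extChartAt (𝓡 m) x₀) y) := by
  have h1 := (mdifferentiableAt_extChartAt (I := 𝓡 m) (x := x₀) (y := y)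
    (by simpa using hy)).hasMFDerivAt
  have h2 := (hg.hasFDerivAt.hasMFDerivAt.comp y h1).mfderiv
  exact congrArg (fun T => T (X y)) h2

namespace IsLieFrame

variable {X : Fin m → VField m M} {c : Fin m → Fin m → Fin m → ℝ} (hX : IsLieFrame X c)
include hX

theorem contDiffAt_inverse_chartFrame (x₀ : M) {z : EuclideanSpace ℝ (Fin m)}
    (hz : z ∈ (extChartAt (𝓡 m) x₀).target) :
    ContDiffAt ℝ ∞ (fun z => (chartFrame X x₀ ((extChartAt (𝓡 m) x₀).symm z)).inverse) z := by
  have h1 : ContMDiffAt 𝓘(ℝ, EuclideanSpace ℝ (Fin m)) (𝓡 m) ∞ (extChartAt (𝓡 m) x₀).symm z :=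
    (contMDiffOn_extChartAt_symm x₀).contMDiffAt
      ((isOpen_extChartAt_target x₀).mem_nhds hz)
  exact ((hX.contMDiffAt_inverse_chartFrame x₀
    ((extChartAt (𝓡 m) x₀).map_target hz)).comp z h1).contDiffAt

theorem contDiffAt_dirDeriv_chart (i : Fin m) (x₀ : M) {z : EuclideanSpace ℝ (Fin m)}
    (hz : z ∈ (extChartAt (𝓡 m) x₀).target) :
    ContDiffAt ℝ ∞ (fun z => dirDeriv (X i) (extChartAt (𝓡 m) x₀)
      ((extChartAt (𝓡 m) x₀).symm z)) z := by
  have h1 : ContMDiffAt 𝓘(ℝ, EuclideanSpace ℝ (Fin m)) (𝓡 m) ∞ (extChartAt (𝓡 m) x₀).symm z :=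
    (contMDiffOn_extChartAt_symm x₀).contMDiffAt
      ((isOpen_extChartAt_target x₀).mem_nhds hz)
  have h2 := (extChartAt (𝓡 m) x₀).map_target hz
  exact ((contMDiffAt_dirDeriv (hX.smoothAt i _) (contMDiffAt_extChartAt'
    (by simpa using h2))).comp z h1).contDiffAt

/-- A function `g` with `|X_i(g)| ≤ K |g|` for all fields of the frame vanishes near each of its
zeros. -/
theorem eventually_eq_zero {g : M → F} {x₀ : M} {K : ℝ} (hK : 0 ≤ K)
    (hg : ∀ᶠ y in 𝓝 x₀, MDifferentiableAt (𝓡 m) 𝓘(ℝ, F) g y)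
    (hle : ∀ᶠ y in 𝓝 x₀, ∀ i, ‖dirDeriv (X i) g y‖ ≤ K * ‖g y‖) (h0 : g x₀ = 0) :
    ∀ᶠ y in 𝓝 x₀, g y = 0 := by
  set e := extChartAt (𝓡 m) x₀ with he
  have hx : x₀ ∈ e.source := mem_extChartAt_source x₀
  have htgt : e.target ∈ 𝓝 (e x₀) := extChartAt_target_mem_nhds x₀
  have hsymm : Tendsto e.symm (𝓝 (e x₀)) (𝓝 x₀) := by
    have := (continuousAt_extChartAt_symm (I := 𝓡 m) x₀).tendsto
    rwa [extChartAt_to_inv] at this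
  set N := ‖(chartFrame X x₀ x₀).inverse‖ + 1 with hN
  have hNb : ∀ᶠ z in 𝓝 (e x₀), ‖(chartFrame X x₀ (e.symm z)).inverse‖ < N := by
    have h1 := (hX.contDiffAt_inverse_chartFrame x₀
      (e.map_source hx)).continuousAt.norm
    refine h1.eventually_lt continuousAt_const ?_
    rw [extChartAt_to_inv]
    exact lt_add_one _
  have hmain : ∀ᶠ z in 𝓝 (e x₀), DifferentiableAt ℝ (g ∘ e.symm) z ∧
      ‖fderiv ℝ (g ∘ e.symm) z‖ ≤ (m * (N * K)) * ‖(g ∘ e.symm) z‖ := by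
    filter_upwards [htgt, hNb, hsymm.eventually hg, hsymm.eventually hle] with z hz hzN hd hl
    have hys : e.symm z ∈ e.source := e.map_target hz
    have hzz : e (e.symm z) = z := e.right_inv hz
    have hdz : DifferentiableAt ℝ (g ∘ e.symm) z := by
      have h1 : MDifferentiableAt 𝓘(ℝ, EuclideanSpace ℝ (Fin m)) (𝓡 m) e.symm z :=
        ((contMDiffOn_extChartAt_symm (n := ∞) x₀).contMDiffAt
          ((isOpen_extChartAt_target x₀).mem_nhds hz)).mdifferentiableAt (by simp)
      exact (MDifferentiableAt.comp z hd h1).differentiableAt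
    refine ⟨hdz, ContinuousLinearMap.opNorm_le_bound _ (by positivity) fun h => ?_⟩
    set a := (chartFrame X x₀ (e.symm z)).inverse h with ha
    have hLa : chartFrame X x₀ (e.symm z) a = h :=
      (hX.isInvertible_chartFrame x₀ hys).self_apply_inverse h
    have hderiv : ∀ i, fderiv ℝ (g ∘ e.symm) z (dirDeriv (X i) e (e.symm z))
        = dirDeriv (X i) g (e.symm z) := by
      intro i
      have h1 := dirDeriv_comp_extChartAt (X i) hys (g := g ∘ e.symm) (by rwa [← he, hzz])
      rw [← he, hzz] at h1
      rw [← h1]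
      refine dirDeriv_congr (X i) ?_
      filter_upwards [(isOpen_extChartAt_source (I := 𝓡 m) x₀).mem_nhds hys] with y hy
      simp only [Function.comp]
      rw [e.left_inv hy]
    rw [← hLa, chartFrame_apply, map_sum]
    simp only [map_smul, ← he, hderiv]
    refine (norm_sum_le _ _).trans ?_
    have hterm : ∀ i ∈ Finset.univ, ‖a i • dirDeriv (X i) g (e.symm z)‖
        ≤ (N * ‖h‖) * (K * ‖g (e.symm z)‖) := by
      intro i _
      rw [norm_smul]
      have h2 : ‖a i‖ ≤ N * ‖h‖ := (norm_le_pi_norm a i).trans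
        ((ContinuousLinearMap.le_opNorm _ h).trans (by gcongr))
      exact mul_le_mul h2 (hl i) (norm_nonneg _) (by positivity)
    refine (Finset.sum_le_sum hterm).trans (le_of_eq ?_)
    rw [← chartFrame_apply, hLa]
    simp only [Finset.sum_const, Finset.card_univ, Fintype.card_fin, nsmul_eq_mul, Function.comp]
    ring
  have hz := eventually_eq_zero_of_norm_fderiv_le (hmain.mono fun z h => h.1.hasFDerivAt)
    (hmain.mono fun z h => h.2) (by simp [he, h0])
  have hcont : Tendsto e (𝓝 x₀) (𝓝 (e x₀)) := continuousAt_extChartAt x₀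
  filter_upwards [hcont.eventually hz, extChartAt_source_mem_nhds (I := 𝓡 m) x₀] with y h1 h2
  simpa [e.left_inv h2] using h1

end IsLieFrame

/-- The action of the structure constants on the components of a complex 1-form. -/
noncomputable def structureMap (c : Fin m → Fin m → Fin m → ℝ) (i : Fin m) :
    (Fin m → ℂ) →L[ℝ] (Fin m → ℂ) :=
  ContinuousLinearMap.pi fun j => ∑ k, c i j k • ContinuousLinearMap.proj k

theorem structureMap_apply (c : Fin m → Fin m → Fin m → ℝ) (i : Fin m) (f : Fin m → ℂ)
    (j : Fin m) : structureMap c i f j = ∑ k, c i j k • f k := by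
  simp [structureMap]

namespace IsLieFrame

variable {X : Fin m → VField m M} {c : Fin m → Fin m → Fin m → ℝ} (hX : IsLieFrame X c)
include hX

theorem structureMap_commutator [Nonempty M] (i j : Fin m) :
    structureMap c j ∘L structureMap c i - structureMap c i ∘L structureMap c j
      = ∑ k, c i j k • structureMap c k := by
  ext f p
  simp only [sub_apply, ContinuousLinearMap.comp_apply, Pi.sub_apply, structureMap_apply,
    sum_apply, smul_apply, Finset.sum_apply, Pi.smul_apply, Finset.smul_sum, smul_smul]
  have h : ∀ a : Fin m → Fin m → ℝ, ∑ q, ∑ r, (a q r) • f r = ∑ r, (∑ q, a q r) • f r := by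
    intro a
    rw [Finset.sum_comm]
    simp only [Finset.sum_smul]
  rw [h, h, h, ← Finset.sum_sub_distrib]
  refine Finset.sum_congr rfl fun r _ => ?_
  rw [← sub_smul, hX.jacobi i j p r, add_sub_cancel_right]

/-- The 1-forms invariant under the frame can be prescribed at a point: their components
solve a flat linear system. -/
theorem exists_invariant_components (x₀ : M) (f₀ : Fin m → ℂ) :
    ∃ f : M → Fin m → ℂ, f x₀ = f₀ ∧ ∀ᶠ y in 𝓝 x₀,
      ContMDiffAt (𝓡 m) 𝓘(ℝ, Fin m → ℂ) ∞ f y ∧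
      ∀ i, dirDeriv (X i) f y = structureMap c i (f y) := by
  have : Nonempty M := ⟨x₀⟩
  set e := extChartAt (𝓡 m) x₀ with he
  have hx : x₀ ∈ e.source := mem_extChartAt_source x₀
  have htgt : e.target ∈ 𝓝 (e x₀) := extChartAt_target_mem_nhds x₀
  -- The system `X_i f = structureMap c i f` reads `Df = B f` in the chart, where `B` is determined
  -- by `B(ξ_i) = structureMap c i` on the frame `ξ_i` read in the chart.
  let Φ : (Fin m → ℝ) →L[ℝ] (Fin m → ℂ) →L[ℝ] (Fin m → ℂ) :=
    ∑ i, (ContinuousLinearMap.proj (R := ℝ) (φ := fun _ : Fin m => ℝ) i).smulRight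
      (structureMap c i)
  have hΦ : ∀ a, Φ a = ∑ i, a i • structureMap c i := fun a => by
    simp [Φ]
  let B : EuclideanSpace ℝ (Fin m) → EuclideanSpace ℝ (Fin m) →L[ℝ] (Fin m → ℂ) →L[ℝ] (Fin m → ℂ)
    := fun z => Φ ∘L (chartFrame X x₀ (e.symm z)).inverse
  let ξ : Fin m → EuclideanSpace ℝ (Fin m) → EuclideanSpace ℝ (Fin m) :=
    fun i z => dirDeriv (X i) e (e.symm z)
  have hBs : ∀ z ∈ e.target, ContDiffAt ℝ ∞ B z := fun z hz =>
    contDiffAt_const.clm_comp (hX.contDiffAt_inverse_chartFrame x₀ hz)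
  have hξs : ∀ i, ∀ z ∈ e.target, ContDiffAt ℝ ∞ (ξ i) z := fun i z hz =>
    hX.contDiffAt_dirDeriv_chart i x₀ hz
  have hLξ : ∀ i z, chartFrame X x₀ (e.symm z) (Pi.single i 1) = ξ i z := by
    intro i z
    rw [chartFrame_apply, Finset.sum_eq_single i]
    · rw [Pi.single_eq_same, one_smul]
    · intro j _ hj
      simp [hj]
    · simp
  have hBξ : ∀ i, ∀ z ∈ e.target, B z (ξ i z) = structureMap c i := by
    intro i z hz
    simp only [B, ContinuousLinearMap.comp_apply]
    rw [← hLξ i z, (hX.isInvertible_chartFrame x₀ (e.map_target hz)).inverse_apply_self, hΦ,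
      Finset.sum_eq_single i]
    · simp
    · intro j _ hj
      simp [hj]
    · simp
  have hξd : ∀ i j, ∀ z ∈ e.target, fderiv ℝ (ξ i) z (ξ j z)
      = dirDeriv (X j) (dirDeriv (X i) e) (e.symm z) := by
    intro i j z hz
    have hys := e.map_target hz
    have h1 := dirDeriv_comp_extChartAt (X j) hys (g := ξ i)
      (by rw [← he, e.right_inv hz]; exact (hξs i z hz).differentiableAt (by simp))
    rw [← he, e.right_inv hz] at h1
    rw [← h1]
    refine dirDeriv_congr (X j) ?_
    filter_upwards [(isOpen_extChartAt_source (I := 𝓡 m) x₀).mem_nhds hys] with y hy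
    simp only [ξ]
    rw [e.left_inv hy]
  have hDB : ∀ i j, ∀ z ∈ e.target, fderiv ℝ B z (ξ j z) (ξ i z)
      = - B z (dirDeriv (X j) (dirDeriv (X i) e) (e.symm z)) := by
    intro i j z hz
    have h1 := ((hBs z hz).differentiableAt (by simp)).hasFDerivAt.clm_apply
      ((hξs i z hz).differentiableAt (by simp)).hasFDerivAt
    have h2 : HasFDerivAt (fun z => B z (ξ i z))
        (0 : EuclideanSpace ℝ (Fin m) →L[ℝ] (Fin m → ℂ) →L[ℝ] (Fin m → ℂ)) z := by
      refine (hasFDerivAt_const (structureMap c i) z).congr_of_eventuallyEq ?_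
      filter_upwards [(isOpen_extChartAt_target (I := 𝓡 m) x₀).mem_nhds hz] with w hw
      exact hBξ i w hw
    have h3 := congrArg (fun T => T (ξ j z)) (h1.unique h2)
    simp only [add_apply, ContinuousLinearMap.comp_apply, ContinuousLinearMap.flip_apply,
      zero_apply] at h3
    rw [hξd i j z hz] at h3
    rw [eq_neg_iff_add_eq_zero, add_comm]
    exact h3
  have hflat : ∀ z ∈ e.target, ∀ h k, fderiv ℝ B z h k + B z k ∘L B z h
      = fderiv ℝ B z k h + B z h ∘L B z k := by
    intro z hz
    obtain ⟨L, hL⟩ := hX.isInvertible_chartFrame x₀ (e.map_target hz)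
    let b : Module.Basis (Fin m) ℝ (EuclideanSpace ℝ (Fin m)) :=
      (Pi.basisFun ℝ (Fin m)).map L.toLinearEquiv
    have hb : ∀ i, b i = ξ i z := fun i => by
      rw [← hLξ i z, ← hL]
      simp [b]
    -- Flatness is an identity of bilinear maps in `h`, `k`; on the frame it says that the
    -- `structureMap c i` represent the brackets.
    let T₁ : EuclideanSpace ℝ (Fin m) →ₗ[ℝ] EuclideanSpace ℝ (Fin m) →ₗ[ℝ]
        ((Fin m → ℂ) →L[ℝ] (Fin m → ℂ)) :=
      LinearMap.mk₂ ℝ (fun h k => fderiv ℝ B z h k + B z k ∘L B z h)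
        (fun _ _ _ => by simp only [map_add, add_apply, ContinuousLinearMap.comp_add]; abel)
        (fun _ _ _ => by simp only [map_smul, smul_apply, ContinuousLinearMap.comp_smul, smul_add])
        (fun _ _ _ => by simp only [map_add, ContinuousLinearMap.add_comp]; abel)
        (fun _ _ _ => by simp only [map_smul, ContinuousLinearMap.smul_comp, smul_add])
    have hT : T₁ = T₁.flip := by
      refine LinearMap.ext_basis b b fun i j => ?_
      simp only [LinearMap.flip_apply, T₁, LinearMap.mk₂_apply, hb]
      rw [hDB _ _ z hz, hDB _ _ z hz, hBξ _ z hz, hBξ _ z hz]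
      have h1 := hX.dirDeriv_commutator i j
        (contMDiffAt_extChartAt' (I := 𝓡 m) (n := ∞) (x := x₀) (x' := e.symm z)
          (by simpa [he] using e.map_target hz))
      have h2 := congrArg (B z) h1
      rw [map_sub, map_sum] at h2
      have h3 : ∑ k, B z (c i j k • dirDeriv (X k) (extChartAt (𝓡 m) x₀) (e.symm z))
          = ∑ k, c i j k • structureMap c k :=
        Finset.sum_congr rfl fun k _ => by rw [map_smul]; congr 1; exact hBξ k z hz
      rw [h3, ← hX.structureMap_commutator i j] at h2
      rw [neg_add_eq_sub, neg_add_eq_sub, sub_eq_sub_iff_add_eq_add]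
      rw [sub_eq_sub_iff_add_eq_add] at h2
      rw [← he] at h2
      exact h2.symm.trans (add_comm _ _)
    intro h k
    exact congrArg (fun T => T h k) hT
  obtain ⟨f, hf0, hf⟩ := exists_hasFDerivAt_of_flat
    ((hBs _ (e.map_source hx)).of_le (by exact ENat.LEInfty.out))
    (mem_of_superset htgt hflat) f₀
  have hfs : ∀ᶠ z in 𝓝 (e x₀), ContDiffAt ℝ ∞ f z ∧ HasFDerivAt f ((B z).flip (f z)) z := by
    filter_upwards [htgt, hf.eventually_nhds] with z hz hz2
    exact ⟨contDiffAt_of_hasFDerivAt_flip (hBs z hz) hz2, hz2.self_of_nhds⟩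
  refine ⟨fun y => f (e y), hf0, ?_⟩
  have hcont : Tendsto e (𝓝 x₀) (𝓝 (e x₀)) := continuousAt_extChartAt x₀
  filter_upwards [hcont.eventually hfs, extChartAt_source_mem_nhds (I := 𝓡 m) x₀] with y h1 hy
  refine ⟨h1.1.contMDiffAt.comp y (contMDiffAt_extChartAt' (by simpa using hy)), fun i => ?_⟩
  have h2 := dirDeriv_comp_extChartAt (X i) hy (g := f) h1.2.differentiableAt
  refine h2.trans ?_
  rw [h1.2.fderiv]
  have h3 := hBξ i (e y) (e.map_source hy)
  simp only [ξ, e.left_inv hy] at h3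
  rw [ContinuousLinearMap.flip_apply, h3]

end IsLieFrame
end LocalSystems

/-! ### Lie and exterior derivatives in terms of a frame -/

section Tensoriality

variable {m : ℕ} {M : Type*} [TopologicalSpace M] [ChartedSpace (EuclideanSpace ℝ (Fin m)) M]
variable {F : Type*} [NormedAddCommGroup F] [NormedSpace ℝ F]

open VectorField

theorem extD_eq_lieDeriv_sub (φ : OneForm m M F) (Z Y : VField m M) (x : M) :
    extD φ Z Y x = lieDeriv Z φ Y x - dirDeriv Y (fun y => φ y (Z y)) x := by
  simp only [extD, lieDeriv]
  abel

theorem extD_swap (φ : OneForm m M F) (Z Y : VField m M) (x : M) :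
    extD φ Z Y x = -extD φ Y Z x := by
  simp only [extD]
  rw [mlieBracket_swap_apply, map_neg]
  abel

theorem lieDeriv_congr {φ ψ : OneForm m M F} {x : M} (h : ∀ᶠ y in 𝓝 x, φ y = ψ y)
    (Z Y : VField m M) : lieDeriv Z φ Y x = lieDeriv Z ψ Y x := by
  simp only [lieDeriv, h.self_of_nhds]
  rw [dirDeriv_congr Z (g := fun y => ψ y (Y y)) (h.mono fun y hy => by simp only [hy])]

theorem lieDeriv_smul {a : M → ℝ} {φ : OneForm m M F} {Z Y : VField m M} {x : M}
    (ha : MDifferentiableAt (𝓡 m) 𝓘(ℝ, ℝ) a x)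
    (hφ : MDifferentiableAt (𝓡 m) 𝓘(ℝ, F) (fun y => φ y (Y y)) x) :
    lieDeriv Z (fun y => a y • φ y) Y x
      = a x • lieDeriv Z φ Y x + dirDeriv Z a x • φ x (Y x) := by
  have h := dirDeriv_smul Z ha hφ
  simp only [lieDeriv, smul_apply, h, smul_sub]
  abel

theorem extD_toComplex {φ : OneForm m M ℝ} {Z Y : VField m M} {x : M}
    (hZ : MDifferentiableAt (𝓡 m) 𝓘(ℝ, ℝ) (fun y => φ y (Z y)) x)
    (hY : MDifferentiableAt (𝓡 m) 𝓘(ℝ, ℝ) (fun y => φ y (Y y)) x) :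
    extD φ.toComplex Z Y x = ((extD φ Z Y x : ℝ) : ℂ) := by
  have h1 := dirDeriv_clm Y Complex.ofRealCLM hZ
  have h2 := dirDeriv_clm Z Complex.ofRealCLM hY
  simp only [extD, Complex.ofReal_sub]
  exact congrArg₂ (· - ·) (congrArg₂ (· - ·) h2 h1) rfl

variable [IsManifold (𝓡 m) ∞ M]

namespace IsLieFrame

variable {X : Fin m → VField m M} {c : Fin m → Fin m → Fin m → ℝ} (hX : IsLieFrame X c)
include hX

theorem apply_eq_sum (φ : OneForm m M F) (Y : VField m M) (x : M) :
    φ x (Y x) = ∑ j, hX.coeff Y j x • φ x (X j x) := by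
  conv_lhs => rw [hX.sum_coeff Y x]
  simp only [map_sum, map_smul]

theorem dirDeriv_eq_sum (f : M → F) (Y : VField m M) (x : M) :
    dirDeriv Y f x = ∑ j, hX.coeff Y j x • dirDeriv (X j) f x := by
  rw [dirDeriv_eq_mvfderiv, hX.sum_coeff Y x, map_sum]
  simp only [map_smul, dirDeriv_eq_mvfderiv]

theorem contMDiffAt_apply {φ : OneForm m M F} {x : M}
    (hφ : ∀ j, ContMDiffAt (𝓡 m) 𝓘(ℝ, F) ∞ (fun y => φ y (X j y)) x) {Y : VField m M}
    (hY : Y.SmoothAt x) : ContMDiffAt (𝓡 m) 𝓘(ℝ, F) ∞ (fun y => φ y (Y y)) x := by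
  have : (fun y => φ y (Y y)) = fun y => ∑ j, hX.coeff Y j y • φ y (X j y) :=
    funext fun y => hX.apply_eq_sum φ Y y
  rw [this]
  exact contMDiffAt_finsetSum fun j _ => (hX.contMDiffAt_coeff hY j).smul (hφ j)

/-- `L_Z φ` is tensorial. -/
theorem lieDeriv_eq_sum {φ : OneForm m M F} {x : M}
    (hφ : ∀ j, ContMDiffAt (𝓡 m) 𝓘(ℝ, F) ∞ (fun y => φ y (X j y)) x) (Z : VField m M)
    {Y : VField m M} (hY : Y.SmoothAt x) :
    lieDeriv Z φ Y x = ∑ j, hX.coeff Y j x • lieDeriv Z φ (X j) x := by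
  have h1 : (fun y => φ y (Y y)) = fun y => ∑ j, hX.coeff Y j y • φ y (X j y) :=
    funext fun y => hX.apply_eq_sum φ Y y
  have h2 : Y = fun y => ∑ j, hX.coeff Y j y • X j y := funext fun y => hX.sum_coeff Y y
  have hc : ∀ j, MDifferentiableAt (𝓡 m) 𝓘(ℝ, ℝ) (hX.coeff Y j) x := fun j =>
    (hX.contMDiffAt_coeff hY j).mdifferentiableAt (by simp)
  have hd : ∀ j, MDifferentiableAt (𝓡 m) 𝓘(ℝ, F) (fun y => φ y (X j y)) x := fun j =>
    (hφ j).mdifferentiableAt (by simp)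
  have h3 : mlieBracket (𝓡 m) Z Y x = ∑ j, (dirDeriv Z (hX.coeff Y j) x • X j x
      + hX.coeff Y j x • mlieBracket (𝓡 m) Z (X j) x) := by
    conv_lhs => rw [h2]
    rw [mlieBracket_sum_field_right Z Finset.univ (Y := fun j y => hX.coeff Y j y • X j y)
      fun j _ => (hX.smoothAt j x).smul (hX.contMDiffAt_coeff hY j)]
    exact Finset.sum_congr rfl fun j _ =>
      mlieBracket_smul_field_right Z (hc j) (hX.smoothAt j x).mdifferentiableAt
  simp only [lieDeriv]
  rw [h1, h3, dirDeriv_sum Z Finset.univ (f := fun j y => hX.coeff Y j y • φ y (X j y))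
    fun j _ => (hc j).smul (hd j), map_sum, ← Finset.sum_sub_distrib]
  refine Finset.sum_congr rfl fun j _ => ?_
  rw [dirDeriv_smul Z (hc j) (hd j), map_add, map_smul, map_smul, smul_sub]
  abel

theorem extD_eq_sum_right {φ : OneForm m M F} {x : M}
    (hφ : ∀ j, ContMDiffAt (𝓡 m) 𝓘(ℝ, F) ∞ (fun y => φ y (X j y)) x) (Z : VField m M)
    {Y : VField m M} (hY : Y.SmoothAt x) :
    extD φ Z Y x = ∑ j, hX.coeff Y j x • extD φ Z (X j) x := by
  simp only [extD_eq_lieDeriv_sub, smul_sub, Finset.sum_sub_distrib]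
  rw [← hX.lieDeriv_eq_sum hφ Z hY, ← hX.dirDeriv_eq_sum]

/-- `dφ` is tensorial. -/
theorem extD_eq_sum {φ : OneForm m M F} {x : M}
    (hφ : ∀ j, ContMDiffAt (𝓡 m) 𝓘(ℝ, F) ∞ (fun y => φ y (X j y)) x)
    {Z Y : VField m M} (hZ : Z.SmoothAt x) (hY : Y.SmoothAt x) :
    extD φ Z Y x
      = ∑ i, ∑ j, hX.coeff Z i x • hX.coeff Y j x • extD φ (X i) (X j) x := by
  rw [extD_swap, hX.extD_eq_sum_right hφ Y hZ, ← Finset.sum_neg_distrib]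
  refine Finset.sum_congr rfl fun i _ => ?_
  rw [← smul_neg, ← extD_swap, hX.extD_eq_sum_right hφ (X i) hY, Finset.smul_sum]

/-- The Lie derivative along a frame field in terms of components. -/
theorem lieDeriv_frame (φ : OneForm m M F) (i j : Fin m) (x : M) :
    lieDeriv (X i) φ (X j) x
      = dirDeriv (X i) (fun y => φ y (X j y)) x - ∑ k, c i j k • φ x (X k x) := by
  simp only [lieDeriv, hX.bracket, map_sum, map_smul]

/-- The 1-form with prescribed components on the frame. -/
noncomputable def form (f : M → Fin m → F) : OneForm m M F := fun x =>
  letI : FiniteDimensional ℝ (TangentSpace (𝓡 m) x) :=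
    inferInstanceAs (FiniteDimensional ℝ (EuclideanSpace ℝ (Fin m)))
  letI : T2Space (TangentSpace (𝓡 m) x) := inferInstanceAs (T2Space (EuclideanSpace ℝ (Fin m)))
  LinearMap.toContinuousLinearMap ((hX.basis x).constr ℝ (f x))

theorem form_apply (f : M → Fin m → F) (x : M) (j : Fin m) : hX.form f x (X j x) = f x j := by
  have h := (hX.basis x).constr_basis ℝ (f x) j
  rw [hX.basis_apply] at h
  exact h

theorem form_ext {x : M} {p q : TangentSpace (𝓡 m) x →L[ℝ] F}
    (h : ∀ j, p (X j x) = q (X j x)) : p = q := by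
  have h1 : (p : TangentSpace (𝓡 m) x →ₗ[ℝ] F) = q :=
    (hX.basis x).ext fun j => by rw [hX.basis_apply]; exact h j
  exact ContinuousLinearMap.coe_injective h1

/-- Every covector extends to a smooth local 1-form that is invariant under the frame. -/
theorem exists_invariant_form (x₀ : M) (p : TangentSpace (𝓡 m) x₀ →L[ℝ] ℂ) :
    ∃ φ : OneForm m M ℂ, φ x₀ = p ∧ ∃ W : Set M, IsOpen W ∧ x₀ ∈ W ∧ φ.SmoothOn W ∧
      ∀ i, LieDerivEqOn (X i) φ 0 W := by
  obtain ⟨f, hf0, hf⟩ := hX.exists_invariant_components x₀ fun j => p (X j x₀)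
  obtain ⟨W, hW, hWo, hxW⟩ := mem_nhds_iff.1 hf
  have hs : ∀ y ∈ W, ∀ j, ContMDiffAt (𝓡 m) 𝓘(ℝ, ℂ) ∞ (fun y => hX.form f y (X j y)) y := by
    intro y hy j
    simp only [hX.form_apply]
    exact contMDiffAt_pi_space.1 (hW hy).1 j
  refine ⟨hX.form f, hX.form_ext fun j => ?_, W, hWo, hxW, fun y hy Y hY =>
    hX.contMDiffAt_apply (hs y hy) hY, fun i y hy Y hY => ?_⟩
  · rw [hX.form_apply, hf0]
  · rw [hX.lieDeriv_eq_sum (hs y hy) _ hY]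
    refine Finset.sum_eq_zero fun j _ => ?_
    rw [hX.lieDeriv_frame]
    simp only [hX.form_apply]
    have h1 := dirDeriv_clm (X i) (ContinuousLinearMap.proj (R := ℝ) (φ := fun _ : Fin m => ℂ) j)
      ((hW hy).1.mdifferentiableAt (by simp))
    rw [(hW hy).2 i] at h1
    simp only [ContinuousLinearMap.proj_apply, structureMap_apply] at h1
    rw [h1, sub_self, smul_zero]

/-- If `H¹(M; ℝ) = 0`, then functions `τ_j` satisfying the closedness condition are the
derivatives of a smooth function along the frame. -/
theorem exists_potential (hH : Subsingleton (DeRhamH1 m M)) {τ : Fin m → M → ℝ}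
    (hτ : ∀ j, ContMDiff (𝓡 m) 𝓘(ℝ, ℝ) ∞ (τ j))
    (hcl : ∀ i j x, dirDeriv (X i) (τ j) x - dirDeriv (X j) (τ i) x = ∑ k, c i j k * τ k x) :
    ∃ u : M → ℝ, ContMDiff (𝓡 m) 𝓘(ℝ, ℝ) ∞ u ∧ ∀ j x, dirDeriv (X j) u x = τ j x := by
  set φ : OneForm m M ℝ := hX.form fun x j => τ j x with hφ
  have hφa : ∀ j, (fun y => φ y (X j y)) = τ j := fun j => funext fun y => hX.form_apply _ y j
  have hs : ∀ x j, ContMDiffAt (𝓡 m) 𝓘(ℝ, ℝ) ∞ (fun y => φ y (X j y)) x := by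
    intro x j
    rw [hφa]
    exact hτ j x
  have hmem : φ ∈ closedForms m M := by
    refine ⟨fun x _ Y hY => hX.contMDiffAt_apply (hs x) hY, fun x Y Z hY hZ => ?_⟩
    rw [hX.extD_eq_sum (hs x) hY hZ]
    refine Finset.sum_eq_zero fun i _ => Finset.sum_eq_zero fun j _ => ?_
    have : extD φ (X i) (X j) x = 0 := by
      rw [extD_eq_lieDeriv_sub, hX.lieDeriv_frame, hφa, hφa]
      have h1 : ∀ k, φ x (X k x) = τ k x := fun k => hX.form_apply _ x k
      simp only [h1, smul_eq_mul]
      linarith [hcl i j x]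
    rw [this, smul_zero, smul_zero]
  have hex : (⟨φ, hmem⟩ : closedForms m M) ∈
      (exactForms m M).comap (closedForms m M).subtype :=
    (Submodule.Quotient.mk_eq_zero _).1 (Subsingleton.elim _ _)
  obtain ⟨u, hu, hu2⟩ := hex
  refine ⟨u, hu, fun j x => ?_⟩
  rw [← hφa j]
  exact congrArg (fun T => T (X j x)) (hu2 x).symm

end IsLieFrame
end Tensoriality

/-! ### Complexified vectors and adapted coframes -/

section ComplexifiedVectors

variable {V : Type*} [AddCommGroup V] [Module ℝ V]

@[simp] theorem rePart_tmul (a : ℂ) (v : V) : rePart (a ⊗ₜ[ℝ] v) = a.re • v := rfl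

@[simp] theorem imPart_tmul (a : ℂ) (v : V) : imPart (a ⊗ₜ[ℝ] v) = a.im • v := rfl

@[simp] theorem conjVec_tmul (a : ℂ) (v : V) :
    conjVec (a ⊗ₜ[ℝ] v) = (starRingEnd ℂ a) ⊗ₜ[ℝ] v := rfl

@[simp] theorem rePart_mkVec (a b : V) : rePart (mkVec a b) = a := by simp [mkVec]

@[simp] theorem imPart_mkVec (a b : V) : imPart (mkVec a b) = b := by simp [mkVec]

theorem mkVec_rePart_imPart (z : ℂ ⊗[ℝ] V) : mkVec (rePart z) (imPart z) = z := by
  induction z using TensorProduct.induction_on with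
  | zero => simp [mkVec]
  | tmul a v =>
    simp only [mkVec, rePart_tmul, imPart_tmul, TensorProduct.tmul_smul]
    rw [TensorProduct.smul_tmul', TensorProduct.smul_tmul', ← TensorProduct.add_tmul]
    congr 1
    simp [Complex.re_add_im]
  | add z w hz hw =>
    conv_rhs => rw [← hz, ← hw]
    simp only [mkVec, map_add, TensorProduct.tmul_add]
    abel

theorem complexified_ext {z w : ℂ ⊗[ℝ] V} (h1 : rePart z = rePart w)
    (h2 : imPart z = imPart w) : z = w := by
  rw [← mkVec_rePart_imPart z, ← mkVec_rePart_imPart w, h1, h2]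

@[simp] theorem rePart_conjVec (z : ℂ ⊗[ℝ] V) : rePart (conjVec z) = rePart z := by
  induction z using TensorProduct.induction_on with
  | zero => simp
  | tmul a v => simp
  | add z w hz hw => rw [map_add, map_add, hz, hw, map_add]

@[simp] theorem imPart_conjVec (z : ℂ ⊗[ℝ] V) : imPart (conjVec z) = -imPart z := by
  induction z using TensorProduct.induction_on with
  | zero => simp
  | tmul a v => simp
  | add z w hz hw => rw [map_add, map_add, hz, hw, map_add, neg_add]

theorem rePart_smul (a : ℂ) (z : ℂ ⊗[ℝ] V) :
    rePart (a • z) = a.re • rePart z - a.im • imPart z := by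
  induction z using TensorProduct.induction_on with
  | zero => simp
  | tmul b v => simp [TensorProduct.smul_tmul', sub_smul, mul_smul]
  | add z w hz hw => simp only [smul_add, map_add, hz, hw]; abel

theorem imPart_smul (a : ℂ) (z : ℂ ⊗[ℝ] V) :
    imPart (a • z) = a.re • imPart z + a.im • rePart z := by
  induction z using TensorProduct.induction_on with
  | zero => simp
  | tmul b v => simp [TensorProduct.smul_tmul', add_smul, mul_smul]
  | add z w hz hw => simp only [smul_add, map_add, hz, hw]; abel

theorem imPart_eq_rePart_smul (z : ℂ ⊗[ℝ] V) : imPart z = rePart (-Complex.I • z) := by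
  simp [rePart_smul]

end ComplexifiedVectors

section AdaptedFrames

variable {V : Type*} [AddCommGroup V] [Module ℝ V] {n : ℕ}

/-- The duality relations between a coframe `θ, ϑ^α` and a frame `T, Z_α` at one point. The complex
linear extension of `ϑ^α` and its value on conjugate vectors are written out in real and imaginary
parts. -/
structure IsAdaptedFrame (θ : V →ₗ[ℝ] ℝ) (ϑ : Fin n → V →ₗ[ℝ] ℂ) (Z : Fin n → ℂ ⊗[ℝ] V)
    (T : V) : Prop where
  theta_re : ∀ α, θ (rePart (Z α)) = 0
  theta_im : ∀ α, θ (imPart (Z α)) = 0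
  theta_char : θ T = 1
  coframe_char : ∀ α, ϑ α T = 0
  coframe : ∀ α β, ϑ α (rePart (Z β)) + Complex.I * ϑ α (imPart (Z β)) = if α = β then 1 else 0
  coframe_conj : ∀ α β, ϑ α (rePart (Z β)) - Complex.I * ϑ α (imPart (Z β)) = 0

namespace IsAdaptedFrame

variable {θ : V →ₗ[ℝ] ℝ} {ϑ : Fin n → V →ₗ[ℝ] ℂ} {Z : Fin n → ℂ ⊗[ℝ] V} {T : V}
  (h : IsAdaptedFrame θ ϑ Z T)
include h

theorem coframe_re (α β : Fin n) : ϑ α (rePart (Z β)) = if α = β then 1 / 2 else 0 := by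
  have h1 := h.coframe α β
  have h2 := h.coframe_conj α β
  have h3 : ϑ α (rePart (Z β)) = (if α = β then 1 else 0) / 2 := by
    linear_combination (h1 + h2) / 2
  rw [h3]
  split_ifs <;> simp

theorem coframe_im (α β : Fin n) :
    ϑ α (imPart (Z β)) = if α = β then -Complex.I / 2 else 0 := by
  have h1 := h.coframe α β
  have h2 := h.coframe_conj α β
  have h3 : ϑ α (imPart (Z β)) = -Complex.I * (if α = β then 1 else 0) / 2 := by
    linear_combination -Complex.I * (h1 - h2) / 2 + ϑ α (imPart (Z β)) * Complex.I_sq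
  rw [h3]
  split_ifs <;> simp

theorem theta_re_smul (a : ℂ) (β : Fin n) : θ (rePart (a • Z β)) = 0 := by
  simp [rePart_smul, h.theta_re, h.theta_im]

theorem coframe_re_smul (a : ℂ) (α β : Fin n) :
    ϑ α (rePart (a • Z β)) = if α = β then a / 2 else 0 := by
  rw [rePart_smul, map_sub, map_smul, map_smul, h.coframe_re, h.coframe_im]
  split_ifs with hab
  · simp only [Complex.real_smul]
    conv_rhs => rw [← Complex.re_add_im a]
    ring
  · simp

theorem theta_combination (t : ℝ) (a : Fin n → ℂ) :
    θ (t • T + (2 : ℝ) • rePart (∑ α, a α • Z α)) = t := by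
  simp [h.theta_re_smul, h.theta_char]

theorem coframe_combination (t : ℝ) (a : Fin n → ℂ) (β : Fin n) :
    ϑ β (t • T + (2 : ℝ) • rePart (∑ α, a α • Z α)) = a β := by
  rw [map_add, map_smul, map_smul, h.coframe_char, map_sum, map_sum]
  simp only [h.coframe_re_smul, Finset.sum_ite_eq, Finset.mem_univ, if_true, smul_zero, zero_add,
    Complex.real_smul]
  push_cast
  ring

/-- A real vector is `v = θ(v) T + 2 Re ∑ ϑ^α(v) Z_α`. -/
theorem decomposition (hV : Module.finrank ℝ V = 2 * n + 1) (v : V) :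
    v = θ v • T + (2 : ℝ) • rePart (∑ α, ϑ α v • Z α) := by
  have : FiniteDimensional ℝ V := Module.finite_of_finrank_pos (by omega)
  let Λ : (ℝ × (Fin n → ℂ)) →ₗ[ℝ] V :=
    { toFun := fun p => p.1 • T + (2 : ℝ) • rePart (∑ α, p.2 α • Z α)
      map_add' := fun p q => by
        simp only [Prod.fst_add, Prod.snd_add, Pi.add_apply, add_smul, Finset.sum_add_distrib,
          map_add, smul_add]
        abel
      map_smul' := fun r p => by
        simp only [Prod.smul_fst, Prod.smul_snd, Pi.smul_apply, smul_assoc, ← Finset.smul_sum,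
          map_smul, smul_add, RingHom.id_apply]
        rw [smul_comm r (2 : ℝ)] }
  have hinj : Function.Injective Λ := by
    intro p q hpq
    have h1 := congrArg θ hpq
    have h2 := fun β => congrArg (ϑ β) hpq
    simp only [Λ, LinearMap.coe_mk, AddHom.coe_mk, h.theta_combination,
      h.coframe_combination] at h1 h2
    exact Prod.ext h1 (funext h2)
  have hdim : Module.finrank ℝ (ℝ × (Fin n → ℂ)) = Module.finrank ℝ V := by
    rw [hV, Module.finrank_prod, Module.finrank_pi_fintype]
    simp [Complex.finrank_real_complex]
    ring
  obtain ⟨p, hp⟩ := (LinearMap.injective_iff_surjective_of_finrank_eq_finrank hdim).1 hinj v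
  have h1 := congrArg θ hp
  have h2 := fun β => congrArg (ϑ β) hp
  simp only [Λ, LinearMap.coe_mk, AddHom.coe_mk, h.theta_combination,
    h.coframe_combination] at h1 h2
  rw [← h1]
  simp only [← h2]
  exact hp.symm

/-- The complex vectors killed by `θ` and by the conjugates of the `ϑ^α` are the combinations of
the `Z_α`. -/
theorem eq_sum_of_conj_eq_zero (hV : Module.finrank ℝ V = 2 * n + 1) {z : ℂ ⊗[ℝ] V}
    (h1 : θ (rePart z) = 0) (h2 : θ (imPart z) = 0)
    (h3 : ∀ α, ϑ α (rePart z) - Complex.I * ϑ α (imPart z) = 0) :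
    z = ∑ α, (ϑ α (rePart z) + Complex.I * ϑ α (imPart z)) • Z α := by
  set a : Fin n → ℂ := fun α => ϑ α (rePart z) + Complex.I * ϑ α (imPart z) with ha
  have ha' : ∀ α, a α = 2 * ϑ α (rePart z) := fun α => by
    simp only [ha]
    linear_combination -(h3 α)
  have ha'' : ∀ α, -Complex.I * a α = 2 * ϑ α (imPart z) := fun α => by
    simp only [ha]
    linear_combination -Complex.I * (h3 α) - 2 * ϑ α (imPart z) * Complex.I_sq
  have hre : ∀ (w : V) (b : Fin n → ℂ), θ w = 0 → (∀ α, b α = 2 * ϑ α w) →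
      rePart (∑ α, b α • Z α) = w := by
    intro w b hw hb
    have h4 := h.decomposition hV w
    have h5 : ∑ α, b α • Z α = (2 : ℝ) • ∑ α, ϑ α w • Z α := by
      rw [Finset.smul_sum]
      refine Finset.sum_congr rfl fun α _ => ?_
      rw [hb α, ← smul_assoc, Complex.real_smul]
      push_cast
      rfl
    rw [h5, map_smul]
    conv_rhs => rw [h4, hw, zero_smul, zero_add]
  refine complexified_ext (hre _ a h1 ha').symm ?_
  rw [imPart_eq_rePart_smul (∑ α, a α • Z α), Finset.smul_sum]
  simp only [smul_smul]
  exact (hre _ _ h2 ha'').symm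

end IsAdaptedFrame
end AdaptedFrames

section Admissible

variable {n : ℕ} {M : Type*} [TopologicalSpace M]
  [ChartedSpace (EuclideanSpace ℝ (Fin (2 * n + 1))) M] [IsManifold (𝓡 (2 * n + 1)) ∞ M]
  {S : CRStructure n M}

omit [IsManifold (𝓡 (2 * n + 1)) ∞ M] in
theorem finrank_tangentSpace (x : M) :
    Module.finrank ℝ (TangentSpace (𝓡 (2 * n + 1)) x) = 2 * n + 1 :=
  finrank_euclideanSpace_fin (𝕜 := ℝ) (n := 2 * n + 1)

theorem CRStructure.rePart_mem_levi {x : M} {z : ℂ ⊗[ℝ] TangentSpace (𝓡 (2 * n + 1)) x}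
    (hz : z ∈ S.T10 x) : rePart z ∈ S.levi x :=
  ⟨z, hz, rfl⟩

theorem CRStructure.imPart_mem_levi {x : M} {z : ℂ ⊗[ℝ] TangentSpace (𝓡 (2 * n + 1)) x}
    (hz : z ∈ S.T10 x) : imPart z ∈ S.levi x := by
  rw [imPart_eq_rePart_smul]
  exact S.rePart_mem_levi ((S.T10 x).smul_mem _ hz)

/-- An admissible coframe comes with a dual frame. -/
theorem CRStructure.IsAdmissibleCoframe.exists_adapted {θ : OneForm (2 * n + 1) M ℝ}
    {V : Set M} {ϑ : Fin n → OneForm (2 * n + 1) M ℂ} (h : S.IsAdmissibleCoframe θ V ϑ)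
    (hθ : S.IsPseudohermitian θ) :
    ∃ (Z : Fin n → CField (2 * n + 1) M) (T : VField (2 * n + 1) M), S.IsFrameOn V Z ∧
      CRStructure.IsCharacteristicOn θ V T ∧
      ∀ x ∈ V, IsAdaptedFrame (θ x).toLinearMap (fun α => (ϑ α x).toLinearMap)
        (fun α => Z α x) (T x) := by
  obtain ⟨Z, hZ, hdual⟩ := h.exists_frame
  obtain ⟨T, hT, hTϑ⟩ := h.exists_char
  refine ⟨Z, T, hZ, hT, fun x hx => ⟨fun α => ?_, fun α => ?_, hT.eval x hx, hTϑ x hx,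
    fun α β => (hdual x hx α β).1, fun α β => ?_⟩⟩
  · exact hθ.levi_le x _ (S.rePart_mem_levi (hZ.isSection α x hx).2)
  · exact hθ.levi_le x _ (S.imPart_mem_levi (hZ.isSection α x hx).2)
  · have h2 := (hdual x hx α β).2
    simp only [OneForm.evalC, rePart_conjVec, imPart_conjVec, map_neg] at h2
    rw [sub_eq_add_neg, ← mul_neg]
    exact h2

end Admissible

/-! ### Symmetries and the invariant pseudohermitian structure -/

section Symmetries

open VectorField

variable {n : ℕ} {M : Type*} [TopologicalSpace M]
  [ChartedSpace (EuclideanSpace ℝ (Fin (2 * n + 1))) M] [IsManifold (𝓡 (2 * n + 1)) ∞ M]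
  {S : CRStructure n M}

/-- The conjugates of an adapted coframe vanish on the span of the `Z_α`. -/
theorem IsAdaptedFrame.coframe_conj_eq_zero {V : Type*} [AddCommGroup V] [Module ℝ V]
    {θ : V →ₗ[ℝ] ℝ} {ϑ : Fin n → V →ₗ[ℝ] ℂ} {Z : Fin n → ℂ ⊗[ℝ] V} {T : V}
    (h : IsAdaptedFrame θ ϑ Z T) {z : ℂ ⊗[ℝ] V} (hz : z ∈ Submodule.span ℂ (Set.range Z))
    (α : Fin n) : ϑ α (rePart z) - Complex.I * ϑ α (imPart z) = 0 := by
  induction hz using Submodule.span_induction with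
  | mem z hz =>
    obtain ⟨β, rfl⟩ := hz
    exact h.coframe_conj α β
  | zero => simp
  | add z w _ _ hz hw =>
    simp only [map_add]
    linear_combination hz + hw
  | smul a z _ hz =>
    simp only [rePart_smul, imPart_smul, map_sub, map_add, map_smul, Complex.real_smul]
    linear_combination ((a.re : ℂ) - Complex.I * a.im) * hz
      - (a.im : ℂ) * ϑ α (imPart z) * Complex.I_sq

/-- Two pseudohermitian structures are proportional at each point. -/
theorem CRStructure.IsPseudohermitian.eq_mul {θ θ' : OneForm (2 * n + 1) M ℝ}
    (hθ : S.IsPseudohermitian θ) {x : M}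
    {ϑ : Fin n → TangentSpace (𝓡 (2 * n + 1)) x →ₗ[ℝ] ℂ}
    {Z : Fin n → ℂ ⊗[ℝ] TangentSpace (𝓡 (2 * n + 1)) x} {T : TangentSpace (𝓡 (2 * n + 1)) x}
    (h : IsAdaptedFrame (θ' x).toLinearMap ϑ Z T) (hZ : ∀ α, Z α ∈ S.T10 x)
    (v : TangentSpace (𝓡 (2 * n + 1)) x) : θ x v = θ' x v * θ x T := by
  have h1 := h.decomposition (finrank_tangentSpace x) v
  conv_lhs => rw [h1]
  rw [map_add, map_smul, map_smul, hθ.levi_le x _ (S.rePart_mem_levi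
    ((S.T10 x).sum_mem fun α _ => (S.T10 x).smul_mem _ (hZ α)))]
  simp

theorem CRStructure.IsPseudohermitian.eq_zero_iff {θ θ' : OneForm (2 * n + 1) M ℝ}
    (hθ : S.IsPseudohermitian θ) {x : M}
    {ϑ : Fin n → TangentSpace (𝓡 (2 * n + 1)) x →ₗ[ℝ] ℂ}
    {Z : Fin n → ℂ ⊗[ℝ] TangentSpace (𝓡 (2 * n + 1)) x} {T : TangentSpace (𝓡 (2 * n + 1)) x}
    (h : IsAdaptedFrame (θ' x).toLinearMap ϑ Z T) (hZ : ∀ α, Z α ∈ S.T10 x)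
    (v : TangentSpace (𝓡 (2 * n + 1)) x) : θ x v = 0 ↔ θ' x v = 0 := by
  have hT : θ x T ≠ 0 := by
    intro h0
    refine hθ.ne_zero x (ContinuousLinearMap.ext fun w => ?_)
    rw [hθ.eq_mul h hZ w, h0, mul_zero, zero_apply]
  rw [hθ.eq_mul h hZ v]
  simp [hT]

/-- A symmetry preserves the kernel of every pseudohermitian structure. -/
theorem CRStructure.IsSymmetry.apply_mlieBracket_eq_zero {X : VField (2 * n + 1) M}
    (hX : S.IsSymmetry X) {θ : OneForm (2 * n + 1) M ℝ} (hθ : S.IsPseudohermitian θ)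
    {Y : VField (2 * n + 1) M} {x : M} (hY : Y.SmoothAt x) (h0 : ∀ᶠ y in 𝓝 x, θ y (Y y) = 0) :
    θ x (mlieBracket (𝓡 (2 * n + 1)) X Y x) = 0 := by
  obtain ⟨-, θ', hθ', ⟨t, ht⟩, hco⟩ := hX
  have hiff : ∀ y v, θ y v = 0 ↔ θ' y v = 0 := by
    intro y v
    obtain ⟨V, hyV, ϑ, hϑ, -⟩ := hco y
    obtain ⟨Z, T, hZ, -, had⟩ := hϑ.exists_adapted hθ'
    exact hθ.eq_zero_iff (had y hyV) (fun α => (hZ.isSection α y hyV).2) v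
  have h0' : (fun y => θ' y (Y y)) =ᶠ[𝓝 x] fun _ => 0 := h0.mono fun y hy => (hiff y _).1 hy
  have h1 := ht x trivial Y hY
  rw [lieDeriv, dirDeriv_congr X h0', dirDeriv_const, smul_apply,
    show θ' x (Y x) = 0 from h0'.self_of_nhds, smul_zero,
    zero_sub, neg_eq_zero] at h1
  exact (hiff x _).2 h1

/-- A symmetry maps sections of `T_{1,0}(M)` to sections of `T_{1,0}(M)`. -/
theorem CRStructure.IsSymmetry.mkVec_mlieBracket_mem {X : VField (2 * n + 1) M}
    (hX : S.IsSymmetry X) {Z : CField (2 * n + 1) M} {x : M} (hZ : Z.SmoothAt x)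
    (hmem : ∀ᶠ y in 𝓝 x, Z y ∈ S.T10 y) :
    mkVec (mlieBracket (𝓡 (2 * n + 1)) X (fun y => rePart (Z y)) x)
      (mlieBracket (𝓡 (2 * n + 1)) X (fun y => imPart (Z y)) x) ∈ S.T10 x := by
  have hX' := hX
  obtain ⟨-, θ', hθ', -, hco⟩ := hX
  obtain ⟨V, hxV, ϑ, hϑ, w, ℓ, hw⟩ := hco x
  obtain ⟨Z', T, hZ', -, had⟩ := hϑ.exists_adapted hθ'
  have hre := hX'.apply_mlieBracket_eq_zero hθ' hZ.1
    (hmem.mono fun y hy => hθ'.levi_le y _ (S.rePart_mem_levi hy))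
  have him := hX'.apply_mlieBracket_eq_zero hθ' hZ.2
    (hmem.mono fun y hy => hθ'.levi_le y _ (S.imPart_mem_levi hy))
  have hzero : ∀ α, ∀ᶠ y in 𝓝 x,
      ϑ α y (rePart (Z y)) - Complex.I * ϑ α y (imPart (Z y)) = 0 := by
    intro α
    filter_upwards [hmem, hϑ.isOpen.mem_nhds hxV] with y hy hyV
    refine (had y hyV).coframe_conj_eq_zero ?_ α
    rwa [hZ'.span_eq y hyV]
  have hbr : ∀ α, ϑ α x (mlieBracket (𝓡 (2 * n + 1)) X (fun y => rePart (Z y)) x)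
      - Complex.I * ϑ α x (mlieBracket (𝓡 (2 * n + 1)) X (fun y => imPart (Z y)) x) = 0 := by
    intro α
    have h1 := hw α x hxV _ hZ.1
    have h2 := hw α x hxV _ hZ.2
    have hd1 := (hϑ.smooth α x hxV _ hZ.1).mdifferentiableAt (n := ∞) (by simp)
    have hd2 := (hϑ.smooth α x hxV _ hZ.2).mdifferentiableAt (n := ∞) (by simp)
    have hd3 : MDifferentiableAt (𝓡 (2 * n + 1)) 𝓘(ℝ, ℂ)
        (fun y => Complex.I • ϑ α y (imPart (Z y))) x :=
      ((Complex.I • ContinuousLinearMap.id ℝ ℂ).contMDiff.contMDiffAt.comp x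
        (hϑ.smooth α x hxV _ hZ.2)).mdifferentiableAt (n := ∞) (by simp)
    have hI := dirDeriv_clm X (Complex.I • ContinuousLinearMap.id ℝ ℂ) hd2
    simp only [smul_apply, ContinuousLinearMap.id_apply] at hI
    have h3 := dirDeriv_congr X (f := fun y => ϑ α y (rePart (Z y))
      - Complex.I • ϑ α y (imPart (Z y))) (g := fun _ => 0) (hzero α)
    rw [dirDeriv_const, dirDeriv_sub X hd1 hd3,
      hI] at h3
    simp only [lieDeriv, CRStructure.changeCoframe, add_apply, sum_apply, smul_apply,
      smul_eq_mul] at h1 h2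
    have h4 : ∑ β, w x α β * ϑ β x (rePart (Z x)) - Complex.I * ∑ β, w x α β * ϑ β x (imPart (Z x))
        = 0 := by
      rw [Finset.mul_sum, ← Finset.sum_sub_distrib]
      refine Finset.sum_eq_zero fun β _ => ?_
      linear_combination w x α β * (hzero β).self_of_nhds
    have h5 : θ'.toComplex x (rePart (Z x)) = 0 := congrArg Complex.ofReal
      (hθ'.levi_le x _ (S.rePart_mem_levi hmem.self_of_nhds))
    have h6 : θ'.toComplex x (imPart (Z x)) = 0 := congrArg Complex.ofReal
      (hθ'.levi_le x _ (S.imPart_mem_levi hmem.self_of_nhds))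
    rw [h5] at h1
    rw [h6] at h2
    simp only [smul_eq_mul] at h3
    linear_combination h3 - h1 + Complex.I * h2 - h4
  have hsum := (had x hxV).eq_sum_of_conj_eq_zero
    (z := mkVec (mlieBracket (𝓡 (2 * n + 1)) X (fun y => rePart (Z y)) x)
      (mlieBracket (𝓡 (2 * n + 1)) X (fun y => imPart (Z y)) x)) (finrank_tangentSpace x) (by rw [rePart_mkVec]; exact hre)
    (by rw [imPart_mkVec]; exact him)
    (fun α => by rw [rePart_mkVec, imPart_mkVec]; exact hbr α)
  rw [hsum]
  exact (S.T10 x).sum_mem fun α _ => (S.T10 x).smul_mem _ (hZ'.isSection α x hxV).2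

/-- A frame of symmetries acts on a pseudohermitian structure by multiplication by smooth
functions. -/
theorem exists_smooth_multiplier {X : Fin (2 * n + 1) → VField (2 * n + 1) M}
    {c : Fin (2 * n + 1) → Fin (2 * n + 1) → Fin (2 * n + 1) → ℝ} (hX : IsLieFrame X c)
    (hsym : ∀ i, S.IsSymmetry (X i)) {θ : OneForm (2 * n + 1) M ℝ}
    (hθ : S.IsPseudohermitian θ) :
    ∃ t : Fin (2 * n + 1) → M → ℝ, (∀ i, ContMDiff (𝓡 (2 * n + 1)) 𝓘(ℝ, ℝ) ∞ (t i)) ∧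
      ∀ i j x, lieDeriv (X i) θ (X j) x = t i x * θ x (X j x) := by
  have hs : ∀ j x, ContMDiffAt (𝓡 (2 * n + 1)) 𝓘(ℝ, ℝ) ∞ (fun y => θ y (X j y)) x :=
    fun j x => hθ.smooth x trivial _ (hX.smoothAt j x)
  have hL : ∀ i j x, ContMDiffAt (𝓡 (2 * n + 1)) 𝓘(ℝ, ℝ) ∞ (lieDeriv (X i) θ (X j)) x :=
    fun i j x => (contMDiffAt_dirDeriv (hX.smoothAt i x) (hs j x)).sub
      (hθ.smooth x trivial _ ((hX.smoothAt i x).mlieBracket (hX.smoothAt j x)))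
  have hpos : ∀ x, ∑ k, θ x (X k x) * θ x (X k x) ≠ 0 := by
    intro x h0
    rw [Finset.sum_eq_zero_iff_of_nonneg fun k _ => mul_self_nonneg _] at h0
    refine hθ.ne_zero x (hX.form_ext fun j => ?_)
    simpa using h0 j (Finset.mem_univ j)
  -- `L_X θ` vanishes on the kernel of `θ`, in particular on `θ(X_k) X_j - θ(X_j) X_k`
  have hcross : ∀ i j k x, lieDeriv (X i) θ (X j) x * θ x (X k x)
      = lieDeriv (X i) θ (X k) x * θ x (X j x) := by
    intro i j k x
    set Y : VField (2 * n + 1) M := fun y => θ y (X k y) • X j y - θ y (X j y) • X k y with hY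
    have hYs : Y.SmoothAt x :=
      ((hX.smoothAt j x).smul (hs k x)).sub ((hX.smoothAt k x).smul (hs j x))
    have hY0 : ∀ y, θ y (Y y) = 0 := fun y => by
      simp only [hY, map_sub, map_smul, smul_eq_mul]
      ring
    have h1 := (hsym i).apply_mlieBracket_eq_zero hθ hYs (Eventually.of_forall hY0)
    have h2 : lieDeriv (X i) θ Y x = 0 := by
      rw [lieDeriv, h1]
      simp only [hY0, dirDeriv_const, sub_zero]
    have h3 := hX.lieDeriv_eq_sum (fun j => hs j x) (X i) hYs
    have h4 := hX.apply_eq_sum (hX.form fun x j => lieDeriv (X i) θ (X j) x) Y x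
    simp only [hX.form_apply] at h4
    rw [← h3, h2] at h4
    simp only [hY, map_sub, map_smul, hX.form_apply, smul_eq_mul] at h4
    linarith
  -- `L_X θ = t θ` determines `t` as the component of `L_X θ` along `θ` in the dual of the frame.
  refine ⟨fun i x => (∑ k, lieDeriv (X i) θ (X k) x * θ x (X k x))
    / ∑ k, θ x (X k x) * θ x (X k x), fun i x => ?_, fun i j x => ?_⟩
  · exact (contMDiffAt_finsetSum fun k _ => (hL i k x).mul (hs k x)).div₀
      (contMDiffAt_finsetSum fun k _ => (hs k x).mul (hs k x)) (hpos x)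
  · rw [div_mul_eq_mul_div, eq_div_iff (hpos x), Finset.mul_sum, Finset.sum_mul]
    refine Finset.sum_congr rfl fun k _ => ?_
    linear_combination θ x (X k x) * hcross i j k x

/-- The multipliers form a 1-cocycle, because `[L_X, L_Y] = L_{[X, Y]}`. -/
theorem multiplier_cocycle {X : Fin (2 * n + 1) → VField (2 * n + 1) M}
    {c : Fin (2 * n + 1) → Fin (2 * n + 1) → Fin (2 * n + 1) → ℝ} (hX : IsLieFrame X c)
    {θ : OneForm (2 * n + 1) M ℝ} (hθ : S.IsPseudohermitian θ)
    {t : Fin (2 * n + 1) → M → ℝ} (hts : ∀ i, ContMDiff (𝓡 (2 * n + 1)) 𝓘(ℝ, ℝ) ∞ (t i))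
    (ht : ∀ i j x, lieDeriv (X i) θ (X j) x = t i x * θ x (X j x)) (i j : Fin (2 * n + 1))
    (x : M) :
    dirDeriv (X i) (t j) x - dirDeriv (X j) (t i) x = ∑ k, c i j k * t k x := by
  have : Nonempty M := ⟨x⟩
  have hs : ∀ j x, ContMDiffAt (𝓡 (2 * n + 1)) 𝓘(ℝ, ℝ) ∞ (fun y => θ y (X j y)) x :=
    fun j x => hθ.smooth x trivial _ (hX.smoothAt j x)
  have hd : ∀ i p x, dirDeriv (X i) (fun y => θ y (X p y)) x
      = t i x * θ x (X p x) + ∑ q, c i p q * θ x (X q x) := by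
    intro i p x
    have h1 := ht i p x
    rw [hX.lieDeriv_frame] at h1
    simp only [smul_eq_mul] at h1
    linarith
  have hdd : ∀ i j p, dirDeriv (X i) (dirDeriv (X j) (fun y => θ y (X p y))) x
      = dirDeriv (X i) (t j) x * θ x (X p x) + t j x * t i x * θ x (X p x)
        + t j x * ∑ q, c i p q * θ x (X q x) + t i x * ∑ q, c j p q * θ x (X q x)
        + ∑ r, (∑ q, c j p q * c i q r) * θ x (X r x) := by
    intro i j p
    have hm : ∀ p, MDifferentiableAt (𝓡 (2 * n + 1)) 𝓘(ℝ, ℝ) (fun y => θ y (X p y)) x :=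
      fun p => (hs p x).mdifferentiableAt (by simp)
    have hmt := (hts j x).mdifferentiableAt (by simp)
    rw [show dirDeriv (X j) (fun y => θ y (X p y))
        = fun y => t j y • θ y (X p y) + ∑ q, c j p q • θ y (X q y) from funext fun y => hd j p y,
      dirDeriv_add (X i) (f := fun y => t j y • θ y (X p y))
        (g := fun y => ∑ q, c j p q • θ y (X q y)) (hmt.smul (hm p)) (mdifferentiableAt_sum fun q _ => (hm q).const_smul _),
      dirDeriv_smul (X i) hmt (hm p), dirDeriv_sum (X i) Finset.univ
        (f := fun q y => c j p q • θ y (X q y)) fun q _ => (hm q).const_smul _]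
    have h2 : ∀ q, dirDeriv (X i) (fun y => c j p q • θ y (X q y)) x
        = c j p q * (t i x * θ x (X q x) + ∑ r, c i q r * θ x (X r x)) := by
      intro q
      rw [dirDeriv_smul (X i) (a := fun _ => c j p q) mdifferentiableAt_const (hm q), hd i q x]
      simp
    rw [Finset.sum_congr rfl fun q _ => h2 q]
    simp only [hd i p x, mul_add, Finset.sum_add_distrib, smul_eq_mul, Finset.mul_sum,
      Finset.sum_mul]
    rw [Finset.sum_comm (f := fun r q => c j p q * c i q r * θ x (X r x))]
    simp only [mul_assoc, mul_left_comm (c j p _) (t i x)]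
    ring
  obtain ⟨p, hp⟩ : ∃ p, θ x (X p x) ≠ 0 := by
    by_contra! h0
    exact hθ.ne_zero x (hX.form_ext fun j => by simpa using h0 j)
  have h1 := dirDeriv_commutator_real (hX.smoothAt i x) (hX.smoothAt j x) (hX.smoothAt i x)
    ((hX.linearIndependent x).ne_zero i) (hs p x)
  rw [hX.dirDeriv_bracket, hdd i j p, hdd j i p] at h1
  have h2 : ∑ k, c i j k • dirDeriv (X k) (fun y => θ y (X p y)) x
      = (∑ k, c i j k * t k x) * θ x (X p x)
        + ∑ r, (∑ k, c i j k * c k p r) * θ x (X r x) := by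
    simp only [hd, smul_eq_mul, mul_add, Finset.sum_add_distrib, Finset.sum_mul, Finset.mul_sum]
    rw [Finset.sum_comm (f := fun r q => c i j q * c q p r * θ x (X r x))]
    simp only [mul_assoc]
  have h3 : ∑ r, (∑ q, c j p q * c i q r) * θ x (X r x)
      = ∑ r, (∑ k, c i j k * c k p r) * θ x (X r x)
        + ∑ r, (∑ q, c i p q * c j q r) * θ x (X r x) := by
    rw [← Finset.sum_add_distrib]
    exact Finset.sum_congr rfl fun r _ => by rw [hX.jacobi i j p r, add_mul]
  rw [h2] at h1
  refine mul_right_cancel₀ hp ?_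
  linear_combination h1 - h3

theorem dirDeriv_exp {m : ℕ} {M : Type*} [TopologicalSpace M]
    [ChartedSpace (EuclideanSpace ℝ (Fin m)) M] (X : VField m M) {u : M → ℝ} {x : M}
    (hu : MDifferentiableAt (𝓡 m) 𝓘(ℝ, ℝ) u x) :
    dirDeriv X (fun y => Real.exp (u y)) x = Real.exp (u x) * dirDeriv X u x := by
  have h := ((Real.hasDerivAt_exp (u x)).hasFDerivAt.hasMFDerivAt.comp x hu.hasMFDerivAt).mfderiv
  refine (congrArg (fun T => T (X x)) h).trans ?_
  change dirDeriv X u x * Real.exp (u x) = _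
  ring

/-- If `H¹(M; ℝ) = 0`, then every pseudohermitian structure can be rescaled to one that is
invariant under the frame of symmetries. -/
theorem exists_invariant_pseudohermitian {X : Fin (2 * n + 1) → VField (2 * n + 1) M}
    {c : Fin (2 * n + 1) → Fin (2 * n + 1) → Fin (2 * n + 1) → ℝ} (hX : IsLieFrame X c)
    (hsym : ∀ i, S.IsSymmetry (X i)) (hH : Subsingleton (DeRhamH1 (2 * n + 1) M))
    {θ : OneForm (2 * n + 1) M ℝ} (hθ : S.IsPseudohermitian θ) :
    ∃ u : M → ℝ, ContMDiff (𝓡 (2 * n + 1)) 𝓘(ℝ, ℝ) ∞ u ∧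
      ∀ i, LieDerivEqOn (X i) (fun x => Real.exp (u x) • θ x) 0 Set.univ := by
  obtain ⟨t, hts, ht⟩ := exists_smooth_multiplier hX hsym hθ
  obtain ⟨u, hu, hut⟩ := hX.exists_potential hH (τ := fun j x => -t j x)
    (fun j => (hts j).neg) (fun i j x => by
      have h1 := multiplier_cocycle hX hθ hts ht i j x
      have hneg : ∀ i j, dirDeriv (X i) (fun y => -t j y) x = -dirDeriv (X i) (t j) x := by
        intro i j
        exact dirDeriv_clm (X i) (-ContinuousLinearMap.id ℝ ℝ)
          ((hts j x).mdifferentiableAt (by simp))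
      simp only [hneg, mul_neg, Finset.sum_neg_distrib]
      linarith)
  have hs : ∀ j x, ContMDiffAt (𝓡 (2 * n + 1)) 𝓘(ℝ, ℝ) ∞ (fun y => θ y (X j y)) x :=
    fun j x => hθ.smooth x trivial _ (hX.smoothAt j x)
  have hexp : ∀ x, ContMDiffAt (𝓡 (2 * n + 1)) 𝓘(ℝ, ℝ) ∞ (fun y => Real.exp (u y)) x :=
    fun x => Real.contDiff_exp.contMDiff.contMDiffAt.comp x (hu x)
  refine ⟨u, hu, fun i x _ Y hY => ?_⟩
  rw [hX.lieDeriv_eq_sum (φ := fun x => Real.exp (u x) • θ x)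
    (fun j => (hexp x).smul (hs j x)) (X i) hY]
  refine Finset.sum_eq_zero fun j _ => ?_
  rw [lieDeriv_smul ((hexp x).mdifferentiableAt (by simp))
    ((hs j x).mdifferentiableAt (by simp)), dirDeriv_exp _ ((hu x).mdifferentiableAt (by simp)),
    hut, ht]
  simp only [smul_eq_mul]
  ring

end Symmetries

/-! ### Hermitian normal form of an alternating form -/

section HermitianForms

open scoped ComplexOrder MatrixOrder Matrix Matrix.Norms.L2Operator

variable {n : ℕ}

theorem sum_re_im_single (a : Fin n → ℂ) :
    a = ∑ α, ((a α).re • (Pi.single α 1 : Fin n → ℂ)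
      + (a α).im • (Pi.single α Complex.I : Fin n → ℂ)) := by
  ext β
  simp only [Finset.sum_apply, Pi.add_apply, Pi.smul_apply, Pi.single_apply]
  rw [Finset.sum_eq_single β (fun α _ h => by simp [h.symm]) (by simp)]
  simp [Complex.re_add_im]

/-- A real linear form on `ℂ^n` is the imaginary part of a complex linear one. -/
theorem real_linear_eq_im (ℓ : (Fin n → ℂ) →ₗ[ℝ] ℝ) (a : Fin n → ℂ) :
    ℓ a = (∑ α, a α * (ℓ (Pi.single α Complex.I) + Complex.I * ℓ (Pi.single α 1))).im := by
  conv_lhs => rw [sum_re_im_single a]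
  rw [map_sum, Complex.im_sum]
  refine Finset.sum_congr rfl fun α _ => ?_
  simp only [map_add, map_smul, smul_eq_mul, Complex.mul_im, Complex.add_re, Complex.add_im,
    Complex.mul_re, Complex.I_re, Complex.I_im, Complex.ofReal_re, Complex.ofReal_im]
  ring

/-- A positive definite Hermitian matrix is `UᴴU` with `U` invertible. -/
theorem exists_eq_conjTranspose_mul_self {N : Matrix (Fin n) (Fin n) ℂ} (hN : N.PosDef) :
    ∃ U : Matrix (Fin n) (Fin n) ℂ, IsUnit U ∧ N = Uᴴ * U := by
  obtain ⟨U, hU⟩ := CStarAlgebra.nonneg_iff_eq_star_mul_self.mp hN.posSemidef.nonneg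
  refine ⟨U, ?_, hU⟩
  have h1 := hN.isUnit
  rw [hU, Matrix.isUnit_iff_isUnit_det, Matrix.det_mul] at h1
  exact (Matrix.isUnit_iff_isUnit_det U).2 (isUnit_of_mul_isUnit_right h1)

/-- A real alternating form on `ℂ^n` that is invariant under `i` and tamed by `i` is, up to a
factor, the imaginary part of a positive definite Hermitian form, which is diagonalized by a
complex linear change of coordinates. -/
theorem exists_diagonalization (B : (Fin n → ℂ) →ₗ[ℝ] (Fin n → ℂ) →ₗ[ℝ] ℝ)
    (hskew : ∀ a b, B a b = -B b a)
    (hJ : ∀ a b, B (Complex.I • a) (Complex.I • b) = B a b)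
    (hpos : ∀ a, a ≠ 0 → 0 < B a (Complex.I • a)) :
    ∃ U : Matrix (Fin n) (Fin n) ℂ, IsUnit U ∧ ∀ a b,
      B a b = -4 * (∑ γ, (U *ᵥ a) γ * starRingEnd ℂ ((U *ᵥ b) γ)).im := by
  have hI : ∀ α : Fin n, Complex.I • (Pi.single α (1 : ℂ) : Fin n → ℂ)
      = Pi.single α Complex.I := by
    intro α
    rw [← Pi.single_smul, smul_eq_mul, mul_one]
  have hII : ∀ α : Fin n, Complex.I • (Pi.single α Complex.I : Fin n → ℂ)
      = -Pi.single α 1 := by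
    intro α
    rw [← Pi.single_smul, smul_eq_mul, Complex.I_mul_I, Pi.single_neg]
  have hJ1 : ∀ α β : Fin n, B (Pi.single α Complex.I) (Pi.single β Complex.I)
      = B (Pi.single α 1) (Pi.single β 1) := by
    intro α β
    rw [← hI, ← hI, hJ]
  have hJ2 : ∀ α β : Fin n, B (Pi.single α Complex.I) (Pi.single β 1)
      = -B (Pi.single α 1) (Pi.single β Complex.I) := by
    intro α β
    rw [← hJ, hII, hI, map_neg, LinearMap.neg_apply]
  -- `N` is the matrix of the Hermitian form `(B(a, i b) - i B(a, b)) / 4`.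
  set N : Matrix (Fin n) (Fin n) ℂ := fun β α =>
    (B (Pi.single α 1) (Pi.single β Complex.I) - Complex.I * B (Pi.single α 1) (Pi.single β 1)) / 4
    with hN
  have key : ∀ a b, B a b = -4 * (star b ⬝ᵥ (N *ᵥ a)).im := by
    intro a b
    conv_lhs => rw [sum_re_im_single a, sum_re_im_single b]
    simp only [map_sum, map_add, map_smul, LinearMap.sum_apply, LinearMap.add_apply,
      LinearMap.smul_apply, hJ1, hJ2, dotProduct, Matrix.mulVec, Finset.mul_sum, Complex.im_sum,
      Finset.smul_sum, ← Finset.sum_add_distrib]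
    refine Finset.sum_congr rfl fun β _ => Finset.sum_congr rfl fun α _ => ?_
    simp only [hN, Pi.star_apply, Complex.star_def, smul_eq_mul]
    have h4 : ∀ z : ℂ, -4 * ((starRingEnd ℂ) (b β) * (z / 4 * a α)).im
        = -((starRingEnd ℂ) (b β) * (z * a α)).im := by
      intro z
      have : (starRingEnd ℂ) (b β) * (z / 4 * a α)
          = ((1 / 4 : ℝ) : ℂ) * ((starRingEnd ℂ) (b β) * (z * a α)) := by
        push_cast
        ring
      rw [this, Complex.im_ofReal_mul]
      ring
    rw [h4]
    simp only [Complex.mul_im, Complex.mul_re, Complex.sub_re, Complex.sub_im, Complex.conj_re,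
      Complex.conj_im, Complex.I_re, Complex.I_im, Complex.ofReal_re, Complex.ofReal_im]
    ring
  have hherm : N.IsHermitian := by
    ext β α
    have h1 : B (Pi.single β 1) (Pi.single α Complex.I)
        = B (Pi.single α 1) (Pi.single β Complex.I) := by rw [hskew, hJ2, neg_neg]
    have h2 := hskew (Pi.single β 1) (Pi.single α 1)
    change starRingEnd ℂ (N α β) = N β α
    simp only [hN, h1, h2, map_neg, map_div₀, map_sub,
      map_mul, Complex.conj_ofReal, Complex.conj_I, map_ofNat, Complex.ofReal_neg]
    ring
  have hNpos : N.PosDef := by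
    refine Matrix.PosDef.of_dotProduct_mulVec_pos hherm fun a ha => ?_
    have h1 := key a (Complex.I • a)
    have h2 : (star (Complex.I • a) ⬝ᵥ (N *ᵥ a)).im = -(star a ⬝ᵥ (N *ᵥ a)).re := by
      rw [star_smul, smul_dotProduct]
      simp
    have h3 := key a a
    have h4 : B a a = 0 := by linarith [hskew a a]
    have h5 := hpos a ha
    rw [Complex.pos_iff]
    constructor <;> linarith
  obtain ⟨U, hU, hUN⟩ := exists_eq_conjTranspose_mul_self hNpos
  refine ⟨U, hU, fun a b => ?_⟩
  rw [key, hUN, ← Matrix.mulVec_mulVec, Matrix.dotProduct_mulVec, ← Matrix.star_mulVec]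
  simp only [dotProduct, Pi.star_apply, Complex.star_def, mul_comm]

/-- In the coordinates `U a` every real linear form on `ℂ^n` is the imaginary part of a Hermitian
product with a fixed vector. -/
theorem exists_dual_vector {U : Matrix (Fin n) (Fin n) ℂ} (hU : IsUnit U)
    (ℓ : (Fin n → ℂ) →ₗ[ℝ] ℝ) :
    ∃ v : Fin n → ℂ, ∀ a, ℓ a = -4 * (∑ γ, (U *ᵥ a) γ * starRingEnd ℂ (v γ)).im := by
  set Λ : Fin n → ℂ := fun α => ℓ (Pi.single α Complex.I) + Complex.I * ℓ (Pi.single α 1) with hΛ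
  have hUdet : IsUnit U.det := (Matrix.isUnit_iff_isUnit_det U).1 hU
  refine ⟨star ((-1 / 4 : ℂ) • (Λ ᵥ* U⁻¹)), fun a => ?_⟩
  have h1 : ∑ γ, (U *ᵥ a) γ * starRingEnd ℂ (star ((-1 / 4 : ℂ) • (Λ ᵥ* U⁻¹)) γ)
      = ((-1 / 4 : ℝ) : ℂ) * ∑ α, a α * Λ α := by
    have h2 : (Λ ᵥ* U⁻¹) ⬝ᵥ (U *ᵥ a) = Λ ⬝ᵥ a := by
      rw [Matrix.dotProduct_mulVec, Matrix.vecMul_vecMul, Matrix.nonsing_inv_mul U hUdet,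
        Matrix.vecMul_one]
    simp only [dotProduct] at h2
    simp only [mul_comm (a _)]
    rw [← h2, Finset.mul_sum]
    refine Finset.sum_congr rfl fun γ _ => ?_
    simp only [Pi.star_apply, Complex.star_def, Complex.conj_conj, Pi.smul_apply, smul_eq_mul]
    push_cast
    ring
  rw [h1, Complex.im_ofReal_mul, real_linear_eq_im ℓ a]
  ring

/-- An alternating form that is of type `(1,1)` and positive on the span of the `Z_α` is brought
to normal form by a change of the adapted coframe. -/
theorem IsAdaptedFrame.exists_normal_form {V : Type*} [AddCommGroup V] [Module ℝ V]
    {θ : V →ₗ[ℝ] ℝ} {ϑ : Fin n → V →ₗ[ℝ] ℂ} {Z : Fin n → ℂ ⊗[ℝ] V} {T : V}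
    (h : IsAdaptedFrame θ ϑ Z T) (hV : Module.finrank ℝ V = 2 * n + 1)
    (B : V →ₗ[ℝ] V →ₗ[ℝ] ℝ) (hskew : ∀ v w, B v w = -B w v)
    (hJ : ∀ z ∈ Submodule.span ℂ (Set.range Z), ∀ w ∈ Submodule.span ℂ (Set.range Z),
      B (rePart z) (rePart w) = B (imPart z) (imPart w))
    (hpos : ∀ z ∈ Submodule.span ℂ (Set.range Z), z ≠ 0 → B (rePart z) (imPart z) < 0) :
    ∃ (U : Matrix (Fin n) (Fin n) ℂ) (v : Fin n → ℂ), IsUnit U ∧ ∀ y z,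
      B y z = -4 * (∑ γ, (∑ β, U γ β * ϑ β y + v γ * θ y)
        * starRingEnd ℂ (∑ β, U γ β * ϑ β z + v γ * θ z)).im := by
  let P : (Fin n → ℂ) →ₗ[ℝ] V :=
    { toFun := fun a => (2 : ℝ) • rePart (∑ α, a α • Z α)
      map_add' := fun a b => by
        simp only [Pi.add_apply, add_smul, Finset.sum_add_distrib, map_add, smul_add]
      map_smul' := fun r a => by
        simp only [Pi.smul_apply, smul_assoc, ← Finset.smul_sum, map_smul, RingHom.id_apply]
        rw [smul_comm r (2 : ℝ)] }
  have hP : ∀ a, P a = (2 : ℝ) • rePart (∑ α, a α • Z α) := fun _ => rfl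
  have hspan : ∀ a : Fin n → ℂ, ∑ α, a α • Z α ∈ Submodule.span ℂ (Set.range Z) := fun a =>
    Submodule.sum_mem _ fun α _ => Submodule.smul_mem _ _ (Submodule.subset_span ⟨α, rfl⟩)
  have hPI : ∀ a, P (Complex.I • a) = -((2 : ℝ) • imPart (∑ α, a α • Z α)) := by
    intro a
    have : ∑ α, (Complex.I • a) α • Z α = Complex.I • ∑ α, a α • Z α := by
      simp only [Finset.smul_sum, Pi.smul_apply, smul_assoc]
    rw [hP, this, rePart_smul]
    simp
  obtain ⟨U, hU, hB⟩ := exists_diagonalization (B.compl₁₂ P P)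
    (fun a b => hskew _ _)
    (fun a b => by
      simp only [LinearMap.compl₁₂_apply, hPI]
      simp only [hP, map_neg, map_smul, LinearMap.neg_apply, LinearMap.smul_apply, smul_neg,
        neg_neg, hJ _ (hspan a) _ (hspan b)])
    (fun a ha => by
      simp only [LinearMap.compl₁₂_apply, hPI]
      simp only [hP, map_neg, map_smul, LinearMap.smul_apply, smul_eq_mul]
      have hz : ∑ α, a α • Z α ≠ 0 := by
        intro h0
        refine ha (funext fun β => ?_)
        have h1 := h.coframe_combination 0 a β
        rw [h0] at h1
        simpa using h1.symm
      have := hpos _ (hspan a) hz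
      linarith)
  obtain ⟨v, hv⟩ := exists_dual_vector hU ((B.flip T).comp P)
  refine ⟨U, v, hU, fun y z => ?_⟩
  have hdec : ∀ y, y = θ y • T + P fun α => ϑ α y := fun y => h.decomposition hV y
  have hcomp : ∀ y γ, ∑ β, U γ β * ϑ β y = (U.mulVec fun α => ϑ α y) γ := fun y γ => rfl
  simp only [hcomp]
  set a : Fin n → ℂ := fun α => ϑ α y
  set b : Fin n → ℂ := fun α => ϑ α z
  have h1 : B y z = θ y * θ z * B T T + θ y * B T (P b) + θ z * B (P a) T + B (P a) (P b) := by
    conv_lhs => rw [hdec y, hdec z]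
    simp only [map_add, map_smul, LinearMap.add_apply, LinearMap.smul_apply, smul_eq_mul]
    ring
  have h2 : B T T = 0 := by linarith [hskew T T]
  have h3 : B (P a) T = _ := hv a
  have h4 : B (P b) T = _ := hv b
  have h5 : B (P a) (P b) = _ := hB a b
  rw [h1, h2, hskew T (P b), h3, h4, h5]
  simp only [Complex.im_sum, Finset.mul_sum, map_add, map_mul, Complex.conj_ofReal]
  rw [mul_zero, zero_add, ← Finset.sum_neg_distrib, Finset.mul_sum, ← Finset.sum_add_distrib,
    ← Finset.sum_add_distrib]
  refine Finset.sum_congr rfl fun γ _ => ?_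
  simp only [Complex.mul_im, Complex.mul_re, Complex.add_re, Complex.add_im, Complex.conj_re,
    Complex.conj_im, Complex.ofReal_re, Complex.ofReal_im]
  ring

end HermitianForms

/-! ### Propagation of invariant identities -/

section InvariantFamilies

variable {m : ℕ} {M : Type*} [TopologicalSpace M] [ChartedSpace (EuclideanSpace ℝ (Fin m)) M]
variable {F : Type*} [NormedAddCommGroup F] [NormedSpace ℝ F]

theorem contMDiffAt_const_smul (a : ℝ) {f : M → F} {x : M}
    (hf : ContMDiffAt (𝓡 m) 𝓘(ℝ, F) ∞ f x) :
    ContMDiffAt (𝓡 m) 𝓘(ℝ, F) ∞ (fun y => a • f y) x :=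
  (a • ContinuousLinearMap.id ℝ F).contMDiff.contMDiffAt.comp x hf

theorem contMDiffAt_complex_mul {f g : M → ℂ} {x : M}
    (hf : ContMDiffAt (𝓡 m) 𝓘(ℝ, ℂ) ∞ f x) (hg : ContMDiffAt (𝓡 m) 𝓘(ℝ, ℂ) ∞ g x) :
    ContMDiffAt (𝓡 m) 𝓘(ℝ, ℂ) ∞ (fun y => f y * g y) x :=
  (contDiff_mul (𝕜 := ℝ) (𝔸 := ℂ)).contMDiff.contMDiffAt.comp x (hf.prodMk_space hg)

theorem dirDeriv_neg (X : VField m M) {f : M → F} {x : M}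
    (hf : MDifferentiableAt (𝓡 m) 𝓘(ℝ, F) f x) :
    dirDeriv X (fun y => -f y) x = -dirDeriv X f x :=
  dirDeriv_clm X (-ContinuousLinearMap.id ℝ F) hf

variable [IsManifold (𝓡 m) ∞ M]
variable {X : Fin m → VField m M} {c : Fin m → Fin m → Fin m → ℝ}

/-- A finite family of functions that satisfies a homogeneous linear system along the frame
vanishes near each common zero. -/
theorem IsLieFrame.eventually_family_eq_zero (hX : IsLieFrame X c) {κ : Type} [Fintype κ]
    {g : κ → M → F} {x : M} (A : Fin m → κ → M → ℝ) (hA : ∀ i a, ContinuousAt (A i a) x)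
    (hg : ∀ a, ContMDiffAt (𝓡 m) 𝓘(ℝ, F) ∞ (g a) x)
    (hle : ∀ᶠ y in 𝓝 x, ∀ i a, ‖dirDeriv (X i) (g a) y‖ ≤ A i a y * ‖fun b => g b y‖)
    (h0 : ∀ a, g a x = 0) : ∀ᶠ y in 𝓝 x, ∀ a, g a y = 0 := by
  have hG : ContMDiffAt (𝓡 m) 𝓘(ℝ, κ → F) ∞ (fun y b => g b y) x := contMDiffAt_pi_space.2 hg
  have hAle : ∀ᶠ y in 𝓝 x, ∀ i a, A i a y ≤ |A i a x| + 1 := by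
    refine eventually_all.2 fun i => eventually_all.2 fun a => ?_
    exact ((hA i a).eventually_lt_const (lt_of_le_of_lt (le_abs_self _) (lt_add_one _))).mono
      fun y hy => hy.le
  have hev := hX.eventually_eq_zero (g := fun y b => g b y) (x₀ := x)
    (K := ∑ i, ∑ a, (|A i a x| + 1)) (by positivity)
    (eventually_mdifferentiableAt_of_contMDiffAt hG) (by
      filter_upwards [hle, hAle, eventually_mdifferentiableAt_of_contMDiffAt hG] with y h1 h2 h3 i
      refine (pi_norm_le_iff_of_nonneg (by positivity)).2 fun a => ?_
      have h4 := dirDeriv_clm (X i) (ContinuousLinearMap.proj (R := ℝ) (φ := fun _ : κ => F) a) h3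
      simp only [ContinuousLinearMap.proj_apply] at h4
      rw [← h4]
      refine (h1 i a).trans (mul_le_mul_of_nonneg_right ((h2 i a).trans ?_) (norm_nonneg _))
      refine le_trans ?_ (Finset.single_le_sum (f := fun i => ∑ a, (|A i a x| + 1))
        (fun i _ => by positivity) (Finset.mem_univ i))
      exact Finset.single_le_sum (f := fun a => |A i a x| + 1)
        (fun a _ => by positivity) (Finset.mem_univ a)) (funext h0)
  exact hev.mono fun y hy a => congrFun hy a

end InvariantFamilies

section StructureEquation

variable {m : ℕ} {M : Type*} [TopologicalSpace M] [ChartedSpace (EuclideanSpace ℝ (Fin m)) M]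
  [IsManifold (𝓡 m) ∞ M]
variable {X : Fin m → VField m M} {c : Fin m → Fin m → Fin m → ℝ}

namespace IsLieFrame

variable (hX : IsLieFrame X c)
include hX

/-- The bilinear form `dφ` at a point. -/
noncomputable def extDForm (φ : OneForm m M ℝ) (x : M) :
    TangentSpace (𝓡 m) x →ₗ[ℝ] TangentSpace (𝓡 m) x →ₗ[ℝ] ℝ :=
  Matrix.toBilin (hX.basis x) (Matrix.of fun i j => extD φ (X i) (X j) x)

theorem extDForm_apply {φ : OneForm m M ℝ} {x : M}
    (hφ : ∀ j, ContMDiffAt (𝓡 m) 𝓘(ℝ, ℝ) ∞ (fun y => φ y (X j y)) x)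
    {Y Z : VField m M} (hY : Y.SmoothAt x) (hZ : Z.SmoothAt x) :
    hX.extDForm φ x (Y x) (Z x) = extD φ Y Z x := by
  rw [hX.extD_eq_sum hφ hY hZ, extDForm, Matrix.toBilin_apply]
  refine Finset.sum_congr rfl fun i _ => Finset.sum_congr rfl fun j _ => ?_
  simp only [coeff, smul_eq_mul, Matrix.of_apply]
  ring

theorem extDForm_skew (φ : OneForm m M ℝ) (x : M) (v w : TangentSpace (𝓡 m) x) :
    hX.extDForm φ x v w = -hX.extDForm φ x w v := by
  rw [extDForm, Matrix.toBilin_apply, Matrix.toBilin_apply, Finset.sum_comm,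
    ← Finset.sum_neg_distrib]
  refine Finset.sum_congr rfl fun i _ => ?_
  rw [← Finset.sum_neg_distrib]
  refine Finset.sum_congr rfl fun j _ => ?_
  rw [Matrix.of_apply, Matrix.of_apply, extD_swap]
  ring

theorem dirDeriv_of_invariant {F : Type*} [NormedAddCommGroup F] [NormedSpace ℝ F]
    {φ : OneForm m M F} {W : Set M} (i : Fin m) (hφ : LieDerivEqOn (X i) φ 0 W) (j : Fin m)
    {y : M} (hy : y ∈ W) :
    dirDeriv (X i) (fun y => φ y (X j y)) y = ∑ k, c i j k • φ y (X k y) := by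
  have h := hφ y hy _ (hX.smoothAt j y)
  rw [hX.lieDeriv_frame] at h
  exact sub_eq_zero.1 h

theorem extD_of_invariant {φ : OneForm m M ℝ} {W : Set M}
    (hφ : ∀ i, LieDerivEqOn (X i) φ 0 W) (i j : Fin m) {y : M} (hy : y ∈ W) :
    extD φ (X i) (X j) y = -∑ k, c j i k * φ y (X k y) := by
  rw [extD_eq_lieDeriv_sub, hφ i y hy _ (hX.smoothAt j y),
    hX.dirDeriv_of_invariant j (hφ j) i hy]
  simp

/-- For invariant forms the structure equation `dΩ = 2i ∑ φ^α ∧ φ̄^α` propagates from one point to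
a neighbourhood, both sides being invariant. -/
theorem eventually_extD_eq {n : ℕ} {W : Set M} (hW : IsOpen W) {x : M} (hx : x ∈ W)
    {Ω : OneForm m M ℝ} (hΩs : Ω.SmoothOn W) (hΩ : ∀ i, LieDerivEqOn (X i) Ω 0 W)
    {φ : Fin n → OneForm m M ℂ} (hφs : ∀ α, (φ α).SmoothOn W)
    (hφ : ∀ α i, LieDerivEqOn (X i) (φ α) 0 W)
    (h0 : ∀ i j, extD Ω (X i) (X j) x
      = -4 * (∑ α, φ α x (X i x) * starRingEnd ℂ (φ α x (X j x))).im) :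
    ∀ᶠ y in 𝓝 x, ∀ i j, extD Ω (X i) (X j) y
      = -4 * (∑ α, φ α y (X i y) * starRingEnd ℂ (φ α y (X j y))).im := by
  have : Nonempty M := ⟨x⟩
  -- `e` and `q` are the components of `dΩ` and of `∑ φ^α ⊗ φ̄^α`; both satisfy the linear system that
  -- expresses invariance of a bilinear form.
  set e : Fin m → Fin m → M → ℝ := fun i j y => -∑ k, c j i k • Ω y (X k y) with he
  set q : Fin m → Fin m → M → ℂ := fun i j y => ∑ α, φ α y (X i y)
    * starRingEnd ℂ (φ α y (X j y)) with hq
  have hfs : ∀ y ∈ W, ∀ k, ContMDiffAt (𝓡 m) 𝓘(ℝ, ℝ) ∞ (fun y => Ω y (X k y)) y :=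
    fun y hy k => hΩs y hy _ (hX.smoothAt k y)
  have hFs : ∀ y ∈ W, ∀ α k, ContMDiffAt (𝓡 m) 𝓘(ℝ, ℂ) ∞ (fun y => φ α y (X k y)) y :=
    fun y hy α k => hφs α y hy _ (hX.smoothAt k y)
  have hFcs : ∀ y ∈ W, ∀ α k, ContMDiffAt (𝓡 m) 𝓘(ℝ, ℂ) ∞
      (fun y => starRingEnd ℂ (φ α y (X k y))) y := fun y hy α k =>
    Complex.conjCLE.toContinuousLinearMap.contMDiff.contMDiffAt.comp y (hFs y hy α k)
  have hes : ∀ y ∈ W, ∀ i j, ContMDiffAt (𝓡 m) 𝓘(ℝ, ℝ) ∞ (e i j) y := fun y hy i j =>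
    ContMDiffAt.neg (f := fun y => ∑ k, c j i k • Ω y (X k y))
      (contMDiffAt_finsetSum fun k _ =>
        contMDiffAt_const_smul (c j i k) (hfs y hy k))
  have hqs : ∀ y ∈ W, ∀ i j, ContMDiffAt (𝓡 m) 𝓘(ℝ, ℂ) ∞ (q i j) y := fun y hy i j =>
    contMDiffAt_finsetSum fun α _ => contMDiffAt_complex_mul (hFs y hy α i) (hFcs y hy α j)
  have hed : ∀ y ∈ W, ∀ l i j, dirDeriv (X l) (e i j) y
      = ∑ p, (c l i p * e p j y + c l j p * e i p y) := by
    intro y hy l i j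
    have h1 : dirDeriv (X l) (e i j) y
        = -∑ k, c j i k * ∑ r, c l k r * Ω y (X r y) := by
      have hm : ∀ k, MDifferentiableAt (𝓡 m) 𝓘(ℝ, ℝ) (fun y => Ω y (X k y)) y :=
        fun k => (hfs y hy k).mdifferentiableAt (by simp)
      have h2 := dirDeriv_neg (X l)
        (mdifferentiableAt_sum (s := Finset.univ) (f := fun k y => c j i k • Ω y (X k y))
          fun k _ => (hm k).const_smul (c j i k))
      refine h2.trans ?_
      rw [dirDeriv_sum (X l) Finset.univ (f := fun k y => c j i k • Ω y (X k y))
        fun k _ => (hm k).const_smul (c j i k)]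
      refine congrArg Neg.neg (Finset.sum_congr rfl fun k _ => ?_)
      rw [dirDeriv_smul (X l) (a := fun _ => c j i k) mdifferentiableAt_const (hm k),
        hX.dirDeriv_of_invariant l (hΩ l) k hy]
      simp
    rw [h1]
    have h3 : ∑ k, c j i k * ∑ r, c l k r * Ω y (X r y)
        = ∑ r, (∑ k, c j i k * c l k r) * Ω y (X r y) := by
      simp only [Finset.mul_sum, Finset.sum_mul]
      rw [Finset.sum_comm]
      simp only [mul_assoc]
    rw [h3]
    simp only [hX.jacobi l j i, he, mul_neg, smul_eq_mul, add_mul, Finset.sum_add_distrib,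
      Finset.sum_neg_distrib, Finset.mul_sum, Finset.sum_mul, neg_add]
    rw [Finset.sum_comm, Finset.sum_comm (f := fun r k => c l i k * c j k r * Ω y (X r y))]
    simp only [mul_assoc]
    ring
  have hqd : ∀ y ∈ W, ∀ l i j, dirDeriv (X l) (q i j) y
      = ∑ p, (c l i p * q p j y + c l j p * q i p y) := by
    intro y hy l i j
    have hm : ∀ α k, MDifferentiableAt (𝓡 m) 𝓘(ℝ, ℂ) (fun y => φ α y (X k y)) y :=
      fun α k => (hFs y hy α k).mdifferentiableAt (by simp)
    have hmc : ∀ α k, MDifferentiableAt (𝓡 m) 𝓘(ℝ, ℂ)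
        (fun y => starRingEnd ℂ (φ α y (X k y))) y :=
      fun α k => (hFcs y hy α k).mdifferentiableAt (by simp)
    rw [hq, dirDeriv_sum (X l) Finset.univ
      (f := fun α y => φ α y (X i y) * starRingEnd ℂ (φ α y (X j y)))
      fun α _ => ((contMDiffAt_complex_mul (hFs y hy α i) (hFcs y hy α j)).mdifferentiableAt (by simp))]
    simp only [Finset.mul_sum, ← Finset.sum_add_distrib]
    rw [Finset.sum_comm]
    refine Finset.sum_congr rfl fun α _ => ?_
    have hconj : dirDeriv (X l) (fun y => starRingEnd ℂ (φ α y (X j y))) y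
        = starRingEnd ℂ (dirDeriv (X l) (fun y => φ α y (X j y)) y) :=
      dirDeriv_clm (X l) Complex.conjCLE.toContinuousLinearMap (hm α j)
    rw [dirDeriv_mul (X l) (hm α i) (hmc α j), hconj, hX.dirDeriv_of_invariant l (hφ α l) i hy,
      hX.dirDeriv_of_invariant l (hφ α l) j hy]
    simp only [map_sum, Complex.real_smul, map_mul, Complex.conj_ofReal, Finset.mul_sum,
      Finset.sum_mul]
    rw [← Finset.sum_add_distrib]
    refine Finset.sum_congr rfl fun p _ => ?_
    ring
  have hee : ∀ y ∈ W, ∀ i j, extD Ω (X i) (X j) y = e i j y := fun y hy i j =>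
    hX.extD_of_invariant hΩ i j hy
  have himq : ∀ y ∈ W, ∀ i j, ContMDiffAt (𝓡 m) 𝓘(ℝ, ℝ) ∞ (fun y => (q i j y).im) y :=
    fun y hy i j => Complex.imCLM.contMDiff.contMDiffAt.comp y (hqs y hy i j)
  have hzero := hX.eventually_family_eq_zero (κ := Fin m × Fin m) (x := x)
    (g := fun ij y => e ij.1 ij.2 y + (4 : ℝ) • (q ij.1 ij.2 y).im)
    (fun l ij _ => ∑ p, (|c l ij.1 p| + |c l ij.2 p|)) (fun l ij => continuousAt_const)
    (fun ij => (hes x hx _ _).add (contMDiffAt_const_smul 4 (himq x hx _ _)))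
    (by
      filter_upwards [hW.mem_nhds hx] with y hy l ij
      obtain ⟨i, j⟩ := ij
      have hm := (himq y hy i j).mdifferentiableAt (n := ∞) (by simp)
      have him : dirDeriv (X l) (fun y => (q i j y).im) y = (dirDeriv (X l) (q i j) y).im :=
        dirDeriv_clm (X l) Complex.imCLM ((hqs y hy i j).mdifferentiableAt (by simp))
      have hder : dirDeriv (X l) (fun y => e i j y + (4 : ℝ) • (q i j y).im) y
          = ∑ p, (c l i p * (e p j y + 4 * (q p j y).im)
            + c l j p * (e i p y + 4 * (q i p y).im)) := by
        rw [dirDeriv_add (X l) (g := fun y => (4 : ℝ) • (q i j y).im)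
          ((hes y hy i j).mdifferentiableAt (by simp)) (hm.const_smul (4 : ℝ)),
          dirDeriv_smul (X l) (a := fun _ => (4 : ℝ)) mdifferentiableAt_const hm, him,
          hed y hy, hqd y hy, Complex.im_sum]
        simp only [dirDeriv_const, zero_mul, add_zero, smul_eq_mul, Finset.mul_sum,
          ← Finset.sum_add_distrib]
        refine Finset.sum_congr rfl fun p _ => ?_
        simp only [Complex.add_im, Complex.im_ofReal_mul]
        ring
      rw [hder, Finset.sum_mul]
      refine (norm_sum_le _ _).trans (Finset.sum_le_sum fun p _ => ?_)
      rw [add_mul]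
      refine (norm_add_le _ _).trans (add_le_add ?_ ?_)
      · rw [norm_mul, Real.norm_eq_abs]
        exact mul_le_mul_of_nonneg_left (norm_le_pi_norm
          (fun b : Fin m × Fin m => e b.1 b.2 y + (4 : ℝ) • (q b.1 b.2 y).im) (p, j))
          (abs_nonneg _)
      · rw [norm_mul, Real.norm_eq_abs]
        exact mul_le_mul_of_nonneg_left (norm_le_pi_norm
          (fun b : Fin m × Fin m => e b.1 b.2 y + (4 : ℝ) • (q b.1 b.2 y).im) (i, p))
          (abs_nonneg _))
    (fun ij => by
      rw [← hee x hx, h0, smul_eq_mul]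
      ring)
  filter_upwards [hzero, hW.mem_nhds hx] with y hy hyW i j
  have h5 := hy (i, j)
  rw [← hee y hyW, smul_eq_mul] at h5
  linarith

end IsLieFrame
end StructureEquation

/-! ### The Levi form and invariant coframes -/

section LeviForms

open VectorField

variable {n : ℕ} {M : Type*} [TopologicalSpace M]
  [ChartedSpace (EuclideanSpace ℝ (Fin (2 * n + 1))) M] [IsManifold (𝓡 (2 * n + 1)) ∞ M]
  {S : CRStructure n M}

/-- Every vector of `T_{1,0}(M)` extends to a smooth local section. -/
theorem CRStructure.IsFrameOn.exists_section {V : Set M} {Z : Fin n → CField (2 * n + 1) M}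
    (hZ : S.IsFrameOn V Z) {x : M} (hx : x ∈ V) {z : ℂ ⊗[ℝ] TangentSpace (𝓡 (2 * n + 1)) x}
    (hz : z ∈ S.T10 x) : ∃ Y : CField (2 * n + 1) M, S.IsSectionOn V Y ∧ Y x = z := by
  rw [← hZ.span_eq x hx, Submodule.mem_span_range_iff_exists_fun] at hz
  obtain ⟨a, rfl⟩ := hz
  refine ⟨fun y => ∑ α, a α • Z α y, fun y hy => ⟨⟨?_, ?_⟩, ?_⟩, rfl⟩
  · simp only [map_sum, rePart_smul]
    exact VField.SmoothAt.sum fun α _ =>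
      (((hZ.isSection α y hy).1.1).smul contMDiffAt_const).sub
        (((hZ.isSection α y hy).1.2).smul contMDiffAt_const)
  · simp only [map_sum, imPart_smul]
    exact VField.SmoothAt.sum fun α _ =>
      (((hZ.isSection α y hy).1.2).smul contMDiffAt_const).add
        (((hZ.isSection α y hy).1.1).smul contMDiffAt_const)
  · exact (S.T10 y).sum_mem fun α _ => (S.T10 y).smul_mem _ (hZ.isSection α y hy).2

theorem extD_eq_neg_apply_mlieBracket {m : ℕ} {M : Type*} [TopologicalSpace M]
    [ChartedSpace (EuclideanSpace ℝ (Fin m)) M] {F : Type*} [NormedAddCommGroup F]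
    [NormedSpace ℝ F] {φ : OneForm m M F} {Y Z : VField m M} {x : M}
    (hY : ∀ᶠ y in 𝓝 x, φ y (Y y) = 0) (hZ : ∀ᶠ y in 𝓝 x, φ y (Z y) = 0) :
    extD φ Y Z x = -φ x (mlieBracket (𝓡 m) Y Z x) := by
  rw [extD, dirDeriv_congr Y (g := fun _ => 0) hZ, dirDeriv_congr Z (g := fun _ => 0) hY]
  simp

variable {X : Fin (2 * n + 1) → VField (2 * n + 1) M}
  {c : Fin (2 * n + 1) → Fin (2 * n + 1) → Fin (2 * n + 1) → ℝ}

/-- `dΩ` is of type `(1,1)` on the Levi distribution: this is the integrability of `T_{1,0}(M)`. -/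
theorem extDForm_rePart_eq (hX : IsLieFrame X c) {Ω : OneForm (2 * n + 1) M ℝ}
    (hΩ : Ω.SmoothOn univ) (hlevi : ∀ x, ∀ v ∈ S.levi x, Ω x v = 0) {V : Set M} (hV : IsOpen V)
    {Z W : CField (2 * n + 1) M} (hZ : S.IsSectionOn V Z) (hW : S.IsSectionOn V W) {x : M}
    (hx : x ∈ V) :
    hX.extDForm Ω x (rePart (Z x)) (rePart (W x))
      = hX.extDForm Ω x (imPart (Z x)) (imPart (W x)) := by
  have hs : ∀ j, ContMDiffAt (𝓡 (2 * n + 1)) 𝓘(ℝ, ℝ) ∞ (fun y => Ω y (X j y)) x :=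
    fun j => hΩ x trivial _ (hX.smoothAt j x)
  have hre : ∀ {Z : CField (2 * n + 1) M}, S.IsSectionOn V Z →
      ∀ᶠ y in 𝓝 x, Ω y (rePart (Z y)) = 0 := fun hZ => by
    filter_upwards [hV.mem_nhds hx] with y hy
    exact hlevi y _ (S.rePart_mem_levi (hZ y hy).2)
  have him : ∀ {Z : CField (2 * n + 1) M}, S.IsSectionOn V Z →
      ∀ᶠ y in 𝓝 x, Ω y (imPart (Z y)) = 0 := fun hZ => by
    filter_upwards [hV.mem_nhds hx] with y hy
    exact hlevi y _ (S.imPart_mem_levi (hZ y hy).2)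
  have h1 := hX.extDForm_apply hs (hZ x hx).1.1 (hW x hx).1.1
  have h2 := hX.extDForm_apply hs (hZ x hx).1.2 (hW x hx).1.2
  rw [extD_eq_neg_apply_mlieBracket (hre hZ) (hre hW)] at h1
  rw [extD_eq_neg_apply_mlieBracket (him hZ) (him hW)] at h2
  have h3 := hlevi x _ (S.rePart_mem_levi (S.bracket_mem V hV Z W hZ hW x hx))
  rw [bracketC, rePart_mkVec, map_sub] at h3
  rw [h1, h2]
  linarith

/-- Positivity of the Levi form, expressed by the real 2-form `dθ`. -/
theorem extDForm_rePart_imPart_neg (hX : IsLieFrame X c) {θ : OneForm (2 * n + 1) M ℝ}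
    (hθ : θ.SmoothOn univ) (hpos : S.LeviPositive θ) {V : Set M} (hV : IsOpen V)
    {Z : CField (2 * n + 1) M} (hZ : S.IsSectionOn V Z) {x : M} (hx : x ∈ V) (hZ0 : Z x ≠ 0) :
    hX.extDForm θ x (rePart (Z x)) (imPart (Z x)) < 0 := by
  have hs : ∀ j, ContMDiffAt (𝓡 (2 * n + 1)) 𝓘(ℝ, ℝ) ∞ (fun y => θ y (X j y)) x :=
    fun j => hθ x trivial _ (hX.smoothAt j x)
  have hD : ∀ Y W : VField (2 * n + 1) M, Y.SmoothAt x → W.SmoothAt x →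
      extD θ.toComplex Y W x = (hX.extDForm θ x (Y x) (W x) : ℂ) := by
    intro Y W hY hW
    rw [hX.extDForm_apply hs hY hW]
    exact extD_toComplex ((hθ x trivial _ hY).mdifferentiableAt (n := ∞) (by simp))
      ((hθ x trivial _ hW).mdifferentiableAt (n := ∞) (by simp))
  have hre := (hZ x hx).1.1
  have him := (hZ x hx).1.2
  have hneg : VField.SmoothAt (fun y => -imPart (Z y)) x := by
    have := him.smul (contMDiffAt_const (c := (-1 : ℝ)))
    simpa only [neg_one_smul] using this
  have h1 := hpos V hV Z hZ x hx hZ0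
  simp only [CRStructure.leviForm, extDC, rePart_conjVec, imPart_conjVec] at h1
  rw [hD _ _ hre hre, hD _ _ him hneg, hD _ _ hre hneg, hD _ _ him hre] at h1
  have hskew := hX.extDForm_skew θ x (imPart (Z x)) (rePart (Z x))
  simp only [map_neg, hskew] at h1
  simp only [Complex.mul_re, Complex.add_re, Complex.sub_re, Complex.add_im, Complex.sub_im,
    Complex.mul_im, Complex.neg_re, Complex.neg_im, Complex.I_re, Complex.I_im,
    Complex.ofReal_re, Complex.ofReal_im, Complex.ofReal_neg] at h1
  linarith

/-- On the Levi distribution the 2-form of a rescaled contact form is the rescaled 2-form. -/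
theorem extDForm_smul_apply (hX : IsLieFrame X c) {θ : OneForm (2 * n + 1) M ℝ}
    (hθ : S.IsPseudohermitian θ) {a : M → ℝ}
    (hΩ : OneForm.SmoothOn (fun x => a x • θ x) univ) {V : Set M} (hV : IsOpen V)
    {Z : CField (2 * n + 1) M} (hZ : S.IsSectionOn V Z) {x : M} (hx : x ∈ V) :
    hX.extDForm (fun x => a x • θ x) x (rePart (Z x)) (imPart (Z x))
      = a x * hX.extDForm θ x (rePart (Z x)) (imPart (Z x)) := by
  have hre : ∀ᶠ y in 𝓝 x, θ y (rePart (Z y)) = 0 := by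
    filter_upwards [hV.mem_nhds hx] with y hy
    exact hθ.levi_le y _ (S.rePart_mem_levi (hZ y hy).2)
  have him : ∀ᶠ y in 𝓝 x, θ y (imPart (Z y)) = 0 := by
    filter_upwards [hV.mem_nhds hx] with y hy
    exact hθ.levi_le y _ (S.imPart_mem_levi (hZ y hy).2)
  have h1 := hX.extDForm_apply (fun j => hΩ x trivial _ (hX.smoothAt j x))
    (hZ x hx).1.1 (hZ x hx).1.2
  have h2 := hX.extDForm_apply (fun j => hθ.smooth x trivial _ (hX.smoothAt j x))
    (hZ x hx).1.1 (hZ x hx).1.2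
  rw [extD_eq_neg_apply_mlieBracket
    (hre.mono fun y hy => by rw [smul_apply, hy, smul_zero])
    (him.mono fun y hy => by rw [smul_apply, hy, smul_zero])] at h1
  rw [extD_eq_neg_apply_mlieBracket hre him] at h2
  rw [h1, h2, smul_apply, smul_eq_mul, mul_neg]

/-- At each point a positive Levi form is diagonalized by a suitable coframe, which can be chosen
to absorb the terms of `dΩ` containing `θ`. -/
theorem exists_normal_form_at (hX : IsLieFrame X c) {θ : OneForm (2 * n + 1) M ℝ}
    (hθ : S.IsPseudohermitian θ) (hpos : S.LeviPositive θ) {a : M → ℝ} (ha : ∀ x, 0 < a x)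
    (hΩ : OneForm.SmoothOn (fun x => a x • θ x) univ) {V : Set M}
    {ϑ : Fin n → OneForm (2 * n + 1) M ℂ} (hϑ : S.IsAdmissibleCoframe θ V ϑ) {x : M}
    (hx : x ∈ V) :
    ∃ (U : Matrix (Fin n) (Fin n) ℂ) (v : Fin n → ℂ), IsUnit U ∧
      ∀ y z : TangentSpace (𝓡 (2 * n + 1)) x, hX.extDForm (fun x => a x • θ x) x y z
        = -4 * (∑ γ, (∑ β, U γ β * ϑ β x y + v γ * θ x y)
          * starRingEnd ℂ (∑ β, U γ β * ϑ β x z + v γ * θ x z)).im := by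
  obtain ⟨Z, T, hZ, -, had⟩ := hϑ.exists_adapted hθ
  have hlevi : ∀ x, ∀ v ∈ S.levi x, (a x • θ x) v = 0 := fun x v hv => by
    rw [smul_apply, hθ.levi_le x v hv, smul_zero]
  refine (had x hx).exists_normal_form (finrank_tangentSpace x) _ (hX.extDForm_skew _ x)
    (fun z hz w hw => ?_) (fun z hz hz0 => ?_)
  · rw [hZ.span_eq x hx] at hz hw
    obtain ⟨Y, hY, rfl⟩ := hZ.exists_section hx hz
    obtain ⟨W, hW, rfl⟩ := hZ.exists_section hx hw
    exact extDForm_rePart_eq hX hΩ hlevi hϑ.isOpen hY hW hx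
  · rw [hZ.span_eq x hx] at hz
    obtain ⟨Y, hY, rfl⟩ := hZ.exists_section hx hz
    rw [extDForm_smul_apply hX hθ hΩ hϑ.isOpen hY hx]
    exact mul_neg_of_pos_of_neg (ha x)
      (extDForm_rePart_imPart_neg hX hθ.smooth hpos hϑ.isOpen hY hx hz0)

end LeviForms

section InvariantCoframes

open VectorField

section Pointwise

variable {V : Type*} [AddCommGroup V] [Module ℝ V] {n : ℕ}

/-- `z ↦ φ(z̄)` is conjugate linear, for the complex linear extension of `φ`. -/
theorem sum_conj_eval (φ : V →ₗ[ℝ] ℂ) (a : Fin n → ℂ) (Z : Fin n → ℂ ⊗[ℝ] V) :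
    φ (rePart (∑ α, a α • Z α)) - Complex.I * φ (imPart (∑ α, a α • Z α))
      = ∑ α, starRingEnd ℂ (a α) * (φ (rePart (Z α)) - Complex.I * φ (imPart (Z α))) := by
  simp only [map_sum, Finset.mul_sum, ← Finset.sum_sub_distrib]
  refine Finset.sum_congr rfl fun α _ => ?_
  simp only [rePart_smul, imPart_smul, map_sub, map_add, map_smul, Complex.real_smul]
  have h : starRingEnd ℂ (a α) = (a α).re - (a α).im * Complex.I := by
    apply Complex.ext <;> simp
  rw [h]
  linear_combination -((a α).im : ℂ) * φ (imPart (Z α)) * Complex.I_sq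

/-- The extension of `φ` to complex vectors is complex linear. -/
theorem sum_eval (φ : V →ₗ[ℝ] ℂ) (a : Fin n → ℂ) (Z : Fin n → ℂ ⊗[ℝ] V) :
    φ (rePart (∑ α, a α • Z α)) + Complex.I * φ (imPart (∑ α, a α • Z α))
      = ∑ α, a α * (φ (rePart (Z α)) + Complex.I * φ (imPart (Z α))) := by
  simp only [map_sum, Finset.mul_sum, ← Finset.sum_add_distrib]
  refine Finset.sum_congr rfl fun α _ => ?_
  simp only [rePart_smul, imPart_smul, map_sub, map_add, map_smul, Complex.real_smul]
  conv_rhs => rw [← Complex.re_add_im (a α)]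
  linear_combination -((a α).im : ℂ) * φ (imPart (Z α)) * Complex.I_sq

variable {θ : V →ₗ[ℝ] ℝ} {ϑ : Fin n → V →ₗ[ℝ] ℂ} {Z : Fin n → ℂ ⊗[ℝ] V} {T : V}

theorem IsAdaptedFrame.eq_sum_of_mem_span (h : IsAdaptedFrame θ ϑ Z T) {z : ℂ ⊗[ℝ] V}
    (hz : z ∈ Submodule.span ℂ (Set.range Z)) :
    z = ∑ α, (ϑ α (rePart z) + Complex.I * ϑ α (imPart z)) • Z α := by
  rw [Submodule.mem_span_range_iff_exists_fun] at hz
  obtain ⟨a, rfl⟩ := hz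
  refine Finset.sum_congr rfl fun α _ => ?_
  rw [sum_eval]
  simp [h.coframe]

/-- A complex form whose conjugate kills the `Z_α` is a combination of the adapted coframe. -/
theorem IsAdaptedFrame.apply_eq (h : IsAdaptedFrame θ ϑ Z T)
    (hV : Module.finrank ℝ V = 2 * n + 1) (φ : V →ₗ[ℝ] ℂ)
    (hφ : ∀ α, φ (rePart (Z α)) - Complex.I * φ (imPart (Z α)) = 0) (w : V) :
    φ w = ∑ β, (φ (rePart (Z β)) + Complex.I * φ (imPart (Z β))) * ϑ β w + φ T * θ w := by
  have h1 := congrArg φ (h.decomposition hV w)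
  have h2 := sum_conj_eval φ (fun α => ϑ α w) Z
  have h3 := sum_eval φ (fun α => ϑ α w) Z
  simp only [hφ, mul_zero, Finset.sum_const_zero] at h2
  rw [h1, map_add, map_smul, map_smul]
  simp only [Complex.real_smul, mul_comm _ (ϑ _ w)]
  push_cast
  linear_combination h2 + h3

end Pointwise

variable {n : ℕ} {M : Type*} [TopologicalSpace M]
  [ChartedSpace (EuclideanSpace ℝ (Fin (2 * n + 1))) M] [IsManifold (𝓡 (2 * n + 1)) ∞ M]
  {S : CRStructure n M} {X : Fin (2 * n + 1) → VField (2 * n + 1) M}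
  {c : Fin (2 * n + 1) → Fin (2 * n + 1) → Fin (2 * n + 1) → ℝ}

/-- An invariant form that kills `T_{0,1}(M)` at one point does so near this point, because
`T_{0,1}(M)` is preserved by the symmetries. -/
theorem eventually_conj_eval_eq_zero (hX : IsLieFrame X c) (hsym : ∀ i, S.IsSymmetry (X i))
    {V : Set M} (hV : IsOpen V) {θ : OneForm (2 * n + 1) M ℝ}
    {ϑ : Fin n → OneForm (2 * n + 1) M ℂ} {Z : Fin n → CField (2 * n + 1) M}
    {T : VField (2 * n + 1) M} (hϑ : ∀ α, (ϑ α).SmoothOn V) (hZ : S.IsFrameOn V Z)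
    (had : ∀ x ∈ V, IsAdaptedFrame (θ x).toLinearMap (fun α => (ϑ α x).toLinearMap)
      (fun α => Z α x) (T x)) {x : M} (hx : x ∈ V) {φ : OneForm (2 * n + 1) M ℂ} {W : Set M}
    (hW : IsOpen W) (hxW : x ∈ W) (hφs : φ.SmoothOn W) (hφ : ∀ i, LieDerivEqOn (X i) φ 0 W)
    (h0 : ∀ β, φ x (rePart (Z β x)) - Complex.I * φ x (imPart (Z β x)) = 0) :
    ∀ᶠ y in 𝓝 x, ∀ β, φ y (rePart (Z β y)) - Complex.I * φ y (imPart (Z β y)) = 0 := by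
  set re : Fin n → VField (2 * n + 1) M := fun β y => rePart (Z β y) with hre
  set im : Fin n → VField (2 * n + 1) M := fun β y => imPart (Z β y) with him
  have hres : ∀ β, ∀ y ∈ V, (re β).SmoothAt y := fun β y hy => (hZ.isSection β y hy).1.1
  have hims : ∀ β, ∀ y ∈ V, (im β).SmoothAt y := fun β y hy => (hZ.isSection β y hy).1.2
  -- `A i β` are the components of `[X_i, Z_β]`, a section of `T_{1,0}(M)`.
  set A : Fin (2 * n + 1) → Fin n → Fin n → M → ℂ := fun i β γ y =>
    ϑ γ y (mlieBracket (𝓡 (2 * n + 1)) (X i) (re β) y)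
      + Complex.I * ϑ γ y (mlieBracket (𝓡 (2 * n + 1)) (X i) (im β) y) with hA
  have hAc : ∀ i β γ, ContinuousAt (A i β γ) x := fun i β γ =>
    (hϑ γ x hx _ ((hX.smoothAt i x).mlieBracket (hres β x hx))).continuousAt.add
      (continuousAt_const.mul
        (hϑ γ x hx _ ((hX.smoothAt i x).mlieBracket (hims β x hx))).continuousAt)
  have hIs : ∀ β, ∀ y ∈ V ∩ W, ContMDiffAt (𝓡 (2 * n + 1)) 𝓘(ℝ, ℂ) ∞
      (fun y => Complex.I * φ y (im β y)) y := fun β y hy =>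
    contMDiffAt_complex_mul contMDiffAt_const (hφs y hy.2 _ (hims β y hy.1))
  have hgs : ∀ β, ∀ y ∈ V ∩ W, ContMDiffAt (𝓡 (2 * n + 1)) 𝓘(ℝ, ℂ) ∞
      (fun y => φ y (re β y) - Complex.I * φ y (im β y)) y := fun β y hy =>
    (hφs y hy.2 _ (hres β y hy.1)).sub (hIs β y hy)
  refine hX.eventually_family_eq_zero (g := fun β y => φ y (re β y) - Complex.I * φ y (im β y))
    (fun i β y => ∑ γ, ‖A i β γ y‖)
    (fun i β => tendsto_finsetSum _ fun γ _ => (hAc i β γ).norm)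
    (fun β => hgs β x ⟨hx, hxW⟩) ?_ h0
  filter_upwards [(hV.inter hW).mem_nhds ⟨hx, hxW⟩] with y hy i β
  have hd1 := (hφs y hy.2 _ (hres β y hy.1)).mdifferentiableAt (n := ∞) (by simp)
  have hd2 := (hφs y hy.2 _ (hims β y hy.1)).mdifferentiableAt (n := ∞) (by simp)
  have hl1 := hφ i y hy.2 _ (hres β y hy.1)
  have hl2 := hφ i y hy.2 _ (hims β y hy.1)
  have hder : dirDeriv (X i) (fun y => φ y (re β y) - Complex.I * φ y (im β y)) y
      = φ y (mlieBracket (𝓡 (2 * n + 1)) (X i) (re β) y)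
        - Complex.I * φ y (mlieBracket (𝓡 (2 * n + 1)) (X i) (im β) y) := by
    rw [dirDeriv_sub (X i) hd1 ((hIs β y hy).mdifferentiableAt (n := ∞) (by simp)),
      dirDeriv_mul (X i) (f := fun _ => Complex.I) mdifferentiableAt_const hd2, dirDeriv_const]
    rw [lieDeriv, sub_eq_iff_eq_add] at hl1 hl2
    rw [hl1, hl2]
    simp
  have hspan : mkVec (mlieBracket (𝓡 (2 * n + 1)) (X i) (re β) y)
      (mlieBracket (𝓡 (2 * n + 1)) (X i) (im β) y)
        ∈ Submodule.span ℂ (Set.range fun γ => Z γ y) := by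
    rw [hZ.span_eq y hy.1]
    exact (hsym i).mkVec_mlieBracket_mem (hZ.isSection β y hy.1).1
      (by filter_upwards [hV.mem_nhds hy.1] with z hz using (hZ.isSection β z hz).2)
  have hsum := (had y hy.1).eq_sum_of_mem_span hspan
  have hconj := sum_conj_eval (φ y).toLinearMap (fun γ => A i β γ y) (fun γ => Z γ y)
  rw [rePart_mkVec, imPart_mkVec] at hsum
  have hsum' : mkVec (mlieBracket (𝓡 (2 * n + 1)) (X i) (re β) y)
      (mlieBracket (𝓡 (2 * n + 1)) (X i) (im β) y) = ∑ γ, A i β γ y • Z γ y := hsum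
  rw [← hsum', rePart_mkVec, imPart_mkVec] at hconj
  rw [hder]
  refine (congrArg norm hconj).trans_le ((norm_sum_le _ _).trans ?_)
  rw [Finset.sum_mul]
  refine Finset.sum_le_sum fun γ _ => ?_
  rw [norm_mul, RCLike.norm_conj]
  exact mul_le_mul_of_nonneg_left (norm_le_pi_norm
    (fun γ => φ y (re γ y) - Complex.I * φ y (im γ y)) γ) (norm_nonneg _)

/-- A coframe prescribed at one point by `U₀, v₀` extends to an invariant one. -/
theorem exists_invariant_coframe (hX : IsLieFrame X c) (hsym : ∀ i, S.IsSymmetry (X i))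
    {θ : OneForm (2 * n + 1) M ℝ} (hθ : S.IsPseudohermitian θ) {V : Set M}
    {ϑ : Fin n → OneForm (2 * n + 1) M ℂ} (hϑ : S.IsAdmissibleCoframe θ V ϑ) {x : M}
    (hx : x ∈ V) {U₀ : Matrix (Fin n) (Fin n) ℂ} (hU₀ : IsUnit U₀) (v₀ : Fin n → ℂ) :
    ∃ W : Set M, IsOpen W ∧ x ∈ W ∧ W ⊆ V ∧
      ∃ (U : M → Matrix (Fin n) (Fin n) ℂ) (v : M → Fin n → ℂ), U x = U₀ ∧ v x = v₀ ∧
        (∀ α β, ContMDiffOn (𝓡 (2 * n + 1)) 𝓘(ℝ, ℂ) ∞ (fun y => U y α β) W) ∧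
        (∀ y ∈ W, IsUnit (U y)) ∧
        (∀ α, ContMDiffOn (𝓡 (2 * n + 1)) 𝓘(ℝ, ℂ) ∞ (fun y => v y α) W) ∧
        (∀ α, (CRStructure.changeCoframe θ ϑ U v α).SmoothOn W) ∧
        ∀ α i, LieDerivEqOn (X i) (CRStructure.changeCoframe θ ϑ U v α) 0 W := by
  obtain ⟨Z, T, hZ, hT, had⟩ := hϑ.exists_adapted hθ
  choose φ hφx W₀ hW₀ hxW₀ hφs hφ using fun α => hX.exists_invariant_form x
    (∑ β, U₀ α β • ϑ β x + v₀ α • θ.toComplex x)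
  have hφx' : ∀ α w, φ α x w = ∑ β, U₀ α β * ϑ β x w + v₀ α * (θ x w : ℂ) := by
    intro α w
    rw [hφx]
    simp only [add_apply, sum_apply, smul_apply, smul_eq_mul]
    rfl
  have hzero : ∀ α, ∀ᶠ y in 𝓝 x, ∀ β,
      φ α y (rePart (Z β y)) - Complex.I * φ α y (imPart (Z β y)) = 0 := by
    intro α
    refine eventually_conj_eval_eq_zero hX hsym hϑ.isOpen hϑ.smooth hZ had hx (hW₀ α) (hxW₀ α)
      (hφs α) (hφ α) fun β => ?_
    have h1 : θ x (rePart (Z β x)) = 0 := (had x hx).theta_re β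
    have h2 : θ x (imPart (Z β x)) = 0 := (had x hx).theta_im β
    rw [hφx', hφx', h1, h2]
    simp only [Complex.ofReal_zero, mul_zero, add_zero, Finset.mul_sum, ← Finset.sum_sub_distrib]
    refine Finset.sum_eq_zero fun γ _ => ?_
    have h3 : ϑ γ x (rePart (Z β x)) - Complex.I * ϑ γ x (imPart (Z β x)) = 0 :=
      (had x hx).coframe_conj γ β
    linear_combination U₀ α γ * h3
  set U : M → Matrix (Fin n) (Fin n) ℂ := fun y => Matrix.of fun α β =>
    φ α y (rePart (Z β y)) + Complex.I * φ α y (imPart (Z β y)) with hU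
  set v : M → Fin n → ℂ := fun y α => φ α y (T y) with hv
  have hUx : U x = U₀ := by
    ext α β
    have h1 : θ x (rePart (Z β x)) = 0 := (had x hx).theta_re β
    have h2 : θ x (imPart (Z β x)) = 0 := (had x hx).theta_im β
    simp only [hU, Matrix.of_apply]
    rw [hφx', hφx', h1, h2]
    simp only [Complex.ofReal_zero, mul_zero, add_zero, Finset.mul_sum, ← Finset.sum_add_distrib]
    have h3 : ∀ γ, U₀ α γ * ϑ γ x (rePart (Z β x)) + Complex.I * (U₀ α γ * ϑ γ x (imPart (Z β x)))
        = U₀ α γ * if γ = β then 1 else 0 := by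
      intro γ
      have h4 : ϑ γ x (rePart (Z β x)) + Complex.I * ϑ γ x (imPart (Z β x))
          = if γ = β then 1 else 0 := (had x hx).coframe γ β
      rw [← h4]
      ring
    simp [h3]
  have hvx : v x = v₀ := by
    ext α
    have h1 : θ x (T x) = 1 := (had x hx).theta_char
    have h2 : ∀ γ, ϑ γ x (T x) = 0 := (had x hx).coframe_char
    simp only [hv]
    rw [hφx', h1]
    simp [h2]
  have hUs : ∀ α β, ∀ y ∈ V, y ∈ W₀ α →
      ContMDiffAt (𝓡 (2 * n + 1)) 𝓘(ℝ, ℂ) ∞ (fun y => U y α β) y := fun α β y hy hyW =>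
    (hφs α y hyW _ (hZ.isSection β y hy).1.1).add
      (contMDiffAt_complex_mul contMDiffAt_const (hφs α y hyW _ (hZ.isSection β y hy).1.2))
  have hdet : ∀ᶠ y in 𝓝 x, (U y).det ≠ 0 := by
    have hc : ContinuousAt U x := continuousAt_pi.2 fun α => continuousAt_pi.2 fun β =>
      (hUs α β x hx (hxW₀ α)).continuousAt
    refine ((continuous_id.matrix_det).continuousAt.comp hc).eventually_ne ?_
    simp only [Function.comp, id, hUx]
    exact ((Matrix.isUnit_iff_isUnit_det U₀).1 hU₀).ne_zero
  have hall : ∀ᶠ y in 𝓝 x, y ∈ V ∧ (∀ α, y ∈ W₀ α) ∧ (U y).det ≠ 0 ∧ ∀ α β,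
      φ α y (rePart (Z β y)) - Complex.I * φ α y (imPart (Z β y)) = 0 := by
    filter_upwards [hϑ.isOpen.mem_nhds hx, eventually_all.2 fun α => (hW₀ α).mem_nhds (hxW₀ α),
      hdet, eventually_all.2 hzero] with y h1 h2 h3 h4
    exact ⟨h1, h2, h3, h4⟩
  obtain ⟨W, hWsub, hW, hxW⟩ := mem_nhds_iff.1 hall
  have heq : ∀ α, ∀ y ∈ W, CRStructure.changeCoframe θ ϑ U v α y = φ α y := by
    intro α y hy
    ext w
    have h1 := (had y (hWsub hy).1).apply_eq (finrank_tangentSpace y) (φ α y).toLinearMap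
      ((hWsub hy).2.2.2 α) w
    simp only [CRStructure.changeCoframe, add_apply, sum_apply, smul_apply, smul_eq_mul]
    exact h1.symm
  have hev : ∀ α, ∀ y ∈ W, ∀ᶠ z in 𝓝 y, CRStructure.changeCoframe θ ϑ U v α z = φ α z :=
    fun α y hy => by filter_upwards [hW.mem_nhds hy] with z hz using heq α z hz
  refine ⟨W, hW, hxW, fun y hy => (hWsub hy).1, U, v, hUx, hvx, fun α β y hy => ?_, fun y hy => ?_,
    fun α y hy => ?_, fun α y hy Y hY => ?_, fun α i y hy Y hY => ?_⟩
  · exact (hUs α β y (hWsub hy).1 ((hWsub hy).2.1 α)).contMDiffWithinAt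
  · exact (Matrix.isUnit_iff_isUnit_det _).2 (isUnit_iff_ne_zero.2 (hWsub hy).2.2.1)
  · exact (hφs α y ((hWsub hy).2.1 α) _ (hT.smooth y (hWsub hy).1)).contMDiffWithinAt
  · exact (hφs α y ((hWsub hy).2.1 α) Y hY).congr_of_eventuallyEq
      ((hev α y hy).mono fun z hz => by simp only [hz])
  · rw [lieDeriv_congr (hev α y hy)]
    exact hφ α i y ((hWsub hy).2.1 α) Y hY

end InvariantCoframes

/-! ### The structure equation -/

section StructureEquation

variable {m : ℕ} {M : Type*} [TopologicalSpace M] [ChartedSpace (EuclideanSpace ℝ (Fin m)) M]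
variable {X : Fin m → VField m M} {c : Fin m → Fin m → Fin m → ℝ}

/-- The 2-form `2i ∑ φ^α ∧ φ̄^α` is real, equal to `-4 Im ∑ φ^α ⊗ φ̄^α`. -/
theorem two_I_mul_sum_wedge {n : ℕ} (φ : Fin n → OneForm m M ℂ) (Y Z : VField m M) (y : M) :
    2 * Complex.I * ∑ α, wedge (φ α) (φ α).conj Y Z y
      = ((-4 * (∑ α, φ α y (Y y) * starRingEnd ℂ (φ α y (Z y))).im : ℝ) : ℂ) := by
  set q := ∑ α, φ α y (Y y) * starRingEnd ℂ (φ α y (Z y)) with hq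
  have h1 : ∑ α, wedge (φ α) (φ α).conj Y Z y = q - starRingEnd ℂ q := by
    rw [hq, map_sum, ← Finset.sum_sub_distrib]
    refine Finset.sum_congr rfl fun α _ => ?_
    rw [map_mul, Complex.conj_conj, mul_comm (starRingEnd ℂ (φ α y (Y y)))]
    rfl
  rw [h1, Complex.sub_conj]
  push_cast
  linear_combination 4 * (q.im : ℂ) * Complex.I_sq

variable [IsManifold (𝓡 m) ∞ M]

/-- The structure equation holds for all pairs of fields if it holds on the frame. -/
theorem IsLieFrame.extD_toComplex_eq (hX : IsLieFrame X c) {n : ℕ} {Ω : OneForm m M ℝ}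
    (hΩ : Ω.SmoothOn univ) {φ : Fin n → OneForm m M ℂ} {y : M}
    (h : ∀ i j, extD Ω (X i) (X j) y
      = -4 * (∑ α, φ α y (X i y) * starRingEnd ℂ (φ α y (X j y))).im)
    {Y Z : VField m M} (hY : Y.SmoothAt y) (hZ : Z.SmoothAt y) :
    extD Ω.toComplex Y Z y = 2 * Complex.I * ∑ α, wedge (φ α) (φ α).conj Y Z y := by
  rw [two_I_mul_sum_wedge, extD_toComplex ((hΩ y trivial _ hY).mdifferentiableAt (n := ∞) (by simp))
    ((hΩ y trivial _ hZ).mdifferentiableAt (n := ∞) (by simp)),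
    hX.extD_eq_sum (fun j => hΩ y trivial _ (hX.smoothAt j y)) hY hZ]
  congr 1
  have h1 : ∑ α, φ α y (Y y) * starRingEnd ℂ (φ α y (Z y))
      = ∑ i, ∑ j, ((hX.coeff Y i y * hX.coeff Z j y : ℝ) : ℂ)
        * ∑ α, φ α y (X i y) * starRingEnd ℂ (φ α y (X j y)) := by
    have h2 : ∀ α, φ α y (Y y) * starRingEnd ℂ (φ α y (Z y))
        = ∑ i, ∑ j, ((hX.coeff Y i y * hX.coeff Z j y : ℝ) : ℂ)
          * (φ α y (X i y) * starRingEnd ℂ (φ α y (X j y))) := by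
      intro α
      rw [hX.apply_eq_sum (φ α) Y y, hX.apply_eq_sum (φ α) Z y, map_sum, Finset.sum_mul_sum]
      refine Finset.sum_congr rfl fun i _ => Finset.sum_congr rfl fun j _ => ?_
      simp only [Complex.real_smul, map_mul, Complex.conj_ofReal]
      push_cast
      ring
    simp only [h2, Finset.mul_sum]
    rw [Finset.sum_comm]
    exact Finset.sum_congr rfl fun i _ => Finset.sum_comm
  rw [h1]
  simp only [Complex.im_sum, Complex.im_ofReal_mul, Finset.mul_sum, h, smul_eq_mul]
  refine Finset.sum_congr rfl fun i _ => Finset.sum_congr rfl fun j _ =>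
    Finset.sum_congr rfl fun α _ => ?_
  ring

end StructureEquation
section Assembly

variable {n : ℕ} {M : Type*} [TopologicalSpace M]
  [ChartedSpace (EuclideanSpace ℝ (Fin (2 * n + 1))) M] [IsManifold (𝓡 (2 * n + 1)) ∞ M]
  {S : CRStructure n M} {X : Fin (2 * n + 1) → VField (2 * n + 1) M}
  {c : Fin (2 * n + 1) → Fin (2 * n + 1) → Fin (2 * n + 1) → ℝ}

theorem exists_conformal_factor (hL : IsLieFrame X c) (hX : ∀ i, S.IsSymmetry (X i))
    (hH : Subsingleton (DeRhamH1 (2 * n + 1) M)) {θ : OneForm (2 * n + 1) M ℝ}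
    (hθ : S.IsPseudohermitian θ) :
    ∃ u : M → ℝ, ContMDiff (𝓡 (2 * n + 1)) 𝓘(ℝ, ℝ) ∞ u ∧
      OneForm.SmoothOn (fun x => Real.exp (u x) • θ x) univ ∧
      ∀ i, LieDerivEqOn (X i) (fun x => Real.exp (u x) • θ x) 0 univ := by
  obtain ⟨u, hu, hΩ⟩ := exists_invariant_pseudohermitian hL hX hH hθ
  exact ⟨u, hu, fun x hx Y hY => (Real.contDiff_exp.contMDiff.contMDiffAt.comp x (hu x)).smul
    (hθ.smooth x hx Y hY), hΩ⟩

/-- Invariant coframes exist around each point, and satisfy the structure equation for the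
invariant contact form if the Levi form is positive. -/
theorem exists_invariant_coframe_structure (hL : IsLieFrame X c) (hX : ∀ i, S.IsSymmetry (X i))
    {θ : OneForm (2 * n + 1) M ℝ} (hθ : S.IsPseudohermitian θ) {u : M → ℝ}
    (hΩs : OneForm.SmoothOn (fun x => Real.exp (u x) • θ x) univ)
    (hΩ : ∀ i, LieDerivEqOn (X i) (fun x => Real.exp (u x) • θ x) 0 univ) {V : Set M}
    {ϑ : Fin n → OneForm (2 * n + 1) M ℂ} (hϑ : S.IsAdmissibleCoframe θ V ϑ) {x : M}
    (hx : x ∈ V) :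
    ∃ W : Set M, IsOpen W ∧ x ∈ W ∧ W ⊆ V ∧
      ∃ (U : M → Matrix (Fin n) (Fin n) ℂ) (v : M → Fin n → ℂ),
        (∀ α β, ContMDiffOn (𝓡 (2 * n + 1)) 𝓘(ℝ, ℂ) ∞ (fun y => U y α β) W) ∧
        (∀ y ∈ W, IsUnit (U y)) ∧
        (∀ α, ContMDiffOn (𝓡 (2 * n + 1)) 𝓘(ℝ, ℂ) ∞ (fun y => v y α) W) ∧
        (∀ i α, LieDerivEqOn (X i) (CRStructure.changeCoframe θ ϑ U v α) 0 W) ∧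
        (S.LeviPositive θ → ∀ y ∈ W, ∀ Y Z : VField (2 * n + 1) M, Y.SmoothAt y → Z.SmoothAt y →
          extD (OneForm.toComplex fun x => Real.exp (u x) • θ x) Y Z y
            = 2 * Complex.I * ∑ α, wedge (CRStructure.changeCoframe θ ϑ U v α)
              (CRStructure.changeCoframe θ ϑ U v α).conj Y Z y) := by
  obtain ⟨U₀, v₀, hU₀, hnormal⟩ : ∃ (U₀ : Matrix (Fin n) (Fin n) ℂ) (v₀ : Fin n → ℂ), IsUnit U₀ ∧
      (S.LeviPositive θ → ∀ y z : TangentSpace (𝓡 (2 * n + 1)) x,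
        hL.extDForm (fun x => Real.exp (u x) • θ x) x y z
          = -4 * (∑ γ, (∑ β, U₀ γ β * ϑ β x y + v₀ γ * θ x y)
            * starRingEnd ℂ (∑ β, U₀ γ β * ϑ β x z + v₀ γ * θ x z)).im) := by
    by_cases hpos : S.LeviPositive θ
    · obtain ⟨U₀, v₀, hU₀, h⟩ := exists_normal_form_at hL hθ hpos
        (fun x => Real.exp_pos (u x)) hΩs hϑ hx
      exact ⟨U₀, v₀, hU₀, fun _ => h⟩
    · exact ⟨1, 0, isUnit_one, fun h => absurd h hpos⟩
  obtain ⟨W, hW, hxW, hWV, U, v, hUx, hvx, hUs, hUunit, hvs, hφs, hφ⟩ :=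
    exists_invariant_coframe hL hX hθ hϑ hx hU₀ v₀
  obtain ⟨W', hW', hxW', hW'W, hstr⟩ : ∃ W' : Set M, IsOpen W' ∧ x ∈ W' ∧ W' ⊆ W ∧
      (S.LeviPositive θ → ∀ y ∈ W', ∀ i j,
        extD (fun x => Real.exp (u x) • θ x) (X i) (X j) y
          = -4 * (∑ α, CRStructure.changeCoframe θ ϑ U v α y (X i y)
            * starRingEnd ℂ (CRStructure.changeCoframe θ ϑ U v α y (X j y))).im) := by
    by_cases hpos : S.LeviPositive θ
    · have hev := hL.eventually_extD_eq hW hxW (fun y hy => hΩs y trivial)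
        (fun i y hy => hΩ i y trivial) hφs hφ (fun i j => by
          rw [← hL.extDForm_apply (fun j => hΩs x trivial _ (hL.smoothAt j x)) (hL.smoothAt i x)
            (hL.smoothAt j x), hnormal hpos, ← hUx, ← hvx]
          simp only [CRStructure.changeCoframe, add_apply, sum_apply, smul_apply,
            smul_eq_mul]
          rfl)
      obtain ⟨W', hsub, hopen, hmem⟩ := mem_nhds_iff.1 (hev.and (hW.mem_nhds hxW))
      exact ⟨W', hopen, hmem, fun y hy => (hsub hy).2, fun _ y hy => (hsub hy).1⟩
    · exact ⟨W, hW, hxW, subset_rfl, fun h => absurd h hpos⟩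
  exact ⟨W', hW', hxW', hW'W.trans hWV, U, v, fun α β => (hUs α β).mono hW'W,
    fun y hy => hUunit y (hW'W hy), fun α => (hvs α).mono hW'W,
    fun i α y hy => hφ α i y (hW'W hy), fun hpos y hy Y Z hY hZ =>
      hL.extD_toComplex_eq hΩs (hstr hpos y hy) hY hZ⟩

end Assembly

end CRGeom

theorem proposition1 (n : ℕ) {M : Type*} [TopologicalSpace M]
    [ChartedSpace (EuclideanSpace ℝ (Fin (2 * n + 1))) M]
    [IsManifold (𝓡 (2 * n + 1)) ∞ M] [T2Space M] [SecondCountableTopology M]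
    (S : CRGeom.CRStructure n M) (hS : S.StrictlyPseudoconvex)
    (hH : Subsingleton (CRGeom.DeRhamH1 (2 * n + 1) M))
    (X : Fin (2 * n + 1) → CRGeom.VField (2 * n + 1) M)
    (hX : ∀ i, S.IsSymmetry (X i))
    (hlin : ∀ x, LinearIndependent ℝ (fun i => X i x))
    (c : Fin (2 * n + 1) → Fin (2 * n + 1) → Fin (2 * n + 1) → ℝ)
    (hc : ∀ i j x, VectorField.mlieBracket (𝓡 (2 * n + 1)) (X i) (X j) x
      = ∑ k, c i j k • X k x)
    (θ : CRGeom.OneForm (2 * n + 1) M ℝ) (hθ : S.IsPseudohermitian θ) :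
    ∃ u : M → ℝ, ContMDiff (𝓡 (2 * n + 1)) 𝓘(ℝ, ℝ) ∞ u ∧
      ∃ Ω : CRGeom.OneForm (2 * n + 1) M ℝ, (∀ x, Ω x = Real.exp (u x) • θ x) ∧
      (∀ i, CRGeom.LieDerivEqOn (X i) Ω 0 Set.univ) ∧
      ∀ (V : Set M) (ϑ : Fin n → CRGeom.OneForm (2 * n + 1) M ℂ),
        S.IsAdmissibleCoframe θ V ϑ → ∀ x ∈ V,
        ∃ W : Set M, IsOpen W ∧ x ∈ W ∧ W ⊆ V ∧
        ∃ (U : M → Matrix (Fin n) (Fin n) ℂ) (v : M → Fin n → ℂ)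
          (Ω' : Fin n → CRGeom.OneForm (2 * n + 1) M ℂ),
          (∀ α β, ContMDiffOn (𝓡 (2 * n + 1)) 𝓘(ℝ, ℂ) ∞ (fun y => U y α β) W) ∧
          (∀ y ∈ W, IsUnit (U y)) ∧
          (∀ α, ContMDiffOn (𝓡 (2 * n + 1)) 𝓘(ℝ, ℂ) ∞ (fun y => v y α) W) ∧
          Ω' = CRGeom.CRStructure.changeCoframe θ ϑ U v ∧
          (∀ i α, CRGeom.LieDerivEqOn (X i) (Ω' α) 0 W) ∧
          (S.LeviPositive θ →
            ∀ y ∈ W, ∀ Y Z : CRGeom.VField (2 * n + 1) M, Y.SmoothAt y → Z.SmoothAt y →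
              CRGeom.extD Ω.toComplex Y Z y
                = 2 * Complex.I * ∑ α, CRGeom.wedge (Ω' α) (Ω' α).conj Y Z y) := by
  have hL : CRGeom.IsLieFrame X c := ⟨fun i => (hX i).1, hlin, hc⟩
  obtain ⟨u, hu, hΩs, hΩ⟩ := CRGeom.exists_conformal_factor hL hX hH hθ
  refine ⟨u, hu, fun x => Real.exp (u x) • θ x, fun _ => rfl, hΩ, fun V ϑ hϑ x hx => ?_⟩
  obtain ⟨W, hW, hxW, hWV, U, v, hU, hUu, hv, hinv, hstr⟩ :=
    CRGeom.exists_invariant_coframe_structure hL hX hθ hΩs hΩ hϑ hx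
  exact ⟨W, hW, hxW, hWV, U, v, _, hU, hUu, hv, rfl, hinv, hstr⟩
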